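/- **Setting.** A *measurement pattern* $\mathfrak P$ on a finite set $V$ of qubits is a finite sequence of commands $N_i$ (initialise qubit $i$ in $|+\rangle$), $E_{ij}$ with $i\neq j$ (apply a controlled-$Z$), ${}^s[M_i^\alpha]^t := M_i^\alpha Z_i^tX_i^s$ (measure qubit $i$ in the basis $|0\rangle\pm e^{i\alpha}|1\rangle$ after the corrections conditional on the signals $s,t$; $M_i^\alpha$ if there are none), and $X_i^s$, $Z_i^s$ (Pauli corrections conditional on signals $s$), such that an initialisation is the first and a measurement the last command acting on its qubit, and no command depends on a measurement not already performed. Signals are named by the measured qubits. The inputs $I$ are the qubits that are not initialised, the outputs $O$ those that are not measured. Assume that $\mathfrak P$ is in standard form (initialisations, then entangling commands, then measurements, then corrections) and that no pair of qubits is entangled more than once. The *geometry* of $\mathfrak P$ is the open graph $((V,E),I,O)$ with $u\sim v$ iff $E_{uv}$ (equivalently $E_{vu}$) occurs in $\mathfrak P$. A *flow* on it is a function $f:V\setminus O\to V\setminus I$ together with a partial order on $V$ such that for all $u\in V\setminus O$: $f(u)\sim u$; $u<f(u)$; and $u<v$ whenever $f(u)\sim v$ and $v\ne u$. A *(conditional)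 diagram* is a finite open graph (parallel edges and loops allowed) with ordered degree-one input and output vertices, whose interior vertices are $Z$- or $X$-vertices, labelled by an angle and, if the angle is non-zero, a finite set of variables, or $H$-vertices of degree two. Diagrams *rewrite* to each other if they are related by a finite sequence of label-preserving isomorphisms fixing the boundary and of applications, in any context and in either direction, of the ZX-rules (spider, anti-loop, $\alpha$-commute, identity, copying, $\pi$-commute, bialgebra, Hopf, $H$-commute, $H$-cancel, and their colour-swapped versions; scalar factors are ignored). The diagram $D(\mathfrak P)$, with inputs $I$, outputs $O$ and signals as variables, is the composite of the diagrams of the commands: $N_i$ is a degree-one $Z(0)$; $E_{ij}$ is a $Z(0)$ on wire $i$ and a $Z(0)$ on wire $j$ joined through an $H$; $X_i^s$ and $Z_i^s$ are an $X$- resp. $Z$-vertex labelled $\pi,s$ on wire $i$; $M_i^\alpha$ is a $Z$-vertex labelled $\pi,\{i\}$ followed by a $Z(-\alpha)$ ending the wire. A diagram is *circuit-like* if (C1) its vertices can be covered by a set $\mathcal P$ of disjoint directed paths, each ending in an output; (C2) every oriented cycle that contains edges from at least two different paths of $\mathcal P$ traverses some edge of a path of $\mathcal P$ in the direction opposite to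 that of the path; (C3) it is a simple graph, and no two adjacent interior vertices have the same type ($Z$, $X$ or $H$). **Corollary.** If the geometry of $\mathfrak P$ has a flow, then the subgraph of $D(\mathfrak P)$ obtained by deleting all vertices that belong to the (possibly conditional) measurements, with their incident edges, rewrites to a circuit-like diagram. -/

import Mathlib

open scoped Classical

/-! ## Open graphs and causal flow -/

/-- An open graph `((V, E), I, O)`: an undirected graph with distinguished sets of input and output
vertices (not necessarily disjoint). -/
structure OpenGraph (V : Type) where
  graph : SimpleGraph V
  inputs : Set V
  outputs : Set V

/-- `(f, ≺)` is a flow on `G`, where `f : V \ O → V \ I` and `≺` is the strict part of `ord`. -/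
def OpenGraph.IsFlow {V : Type} (G : OpenGraph V)
    (f : {v : V // v ∉ G.outputs} → {v : V // v ∉ G.inputs}) (ord : PartialOrder V) : Prop :=
  ∀ u : {v : V // v ∉ G.outputs},
    G.graph.Adj (f u) u ∧
    ord.lt u (f u) ∧
    ∀ v : V, G.graph.Adj (f u) v → (u : V) ≠ v → ord.lt u v

def OpenGraph.HasFlow {V : Type} (G : OpenGraph V) : Prop :=
  ∃ (f : {v : V // v ∉ G.outputs} → {v : V // v ∉ G.inputs}) (ord : PartialOrder V),
    G.IsFlow f ord

/-! ## Conditional diagrams of the ZX-calculus -/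

/-- The three types of interior vertices. -/
inductive VertexType
  | Z
  | X
  | H

/-- The two colours of spiders. -/
inductive Colour
  | Z
  | X

/-- The opposite colour. -/
def Colour.other : Colour → Colour
  | .Z => .X
  | .X => .Z

/-- Labels of interior vertices: a `Z` or `X` spider with an angle (modulo `2π`) and a finite set of
variables from `𝒱`, or a Hadamard vertex.  The vertex is unconditional iff the set is empty. -/
inductive Kind (𝒱 : Type)
  | spider (c : Colour) (α : Real.Angle) (U : Finset 𝒱)
  | hadamard

/-- The type (`Z`, `X` or `H`) of a vertex with a given label. -/
def Kind.type {𝒱 : Type} : Kind 𝒱 → VertexType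
  | .spider .Z _ _ => .Z
  | .spider .X _ _ => .X
  | .hadamard => .H

/-- Spider of colour `c` with angle `α`, conditional on `U`.  Spiders with angle `0` carry no set of
variables, so in that case `U` is discarded. -/
noncomputable def node {𝒱 : Type} (c : Colour) (α : Real.Angle) (U : Finset 𝒱) : Kind 𝒱 :=
  .spider c α (if α = 0 then ∅ else U)

/-- A labelled open multigraph.  The interior vertices are `V`, the input boundary vertices are
named by `I` and the output boundary vertices by `O` (with `I = Fin m` and `O = Fin n` these are
the first, second, ... input and output; any total order on finite types `I`, `O` gives such a
numbering).  Edges are undirected; parallel edges and self-loops are allowed. -/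
structure ZXGraph (𝒱 I O : Type) where
  V : Type
  kind : V → Kind 𝒱
  edges : Multiset (Sym2 (V ⊕ (I ⊕ O)))

namespace ZXGraph

variable {𝒱 I O : Type}

/-- All vertices, interior and boundary. -/
abbrev Vertex (D : ZXGraph 𝒱 I O) : Type := D.V ⊕ (I ⊕ O)

/-- The degree of a vertex; a self-loop counts twice. -/
noncomputable def degree (D : ZXGraph 𝒱 I O) (w : D.Vertex) : ℕ :=
  (D.edges.bind fun e => e.toMultiset).count w

def Adj (D : ZXGraph 𝒱 I O) (a b : D.Vertex) : Prop := s(a, b) ∈ D.edges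

/-- A conditional diagram: a finite open graph all of whose boundary vertices have degree one,
whose `H` vertices have degree two, and whose spiders with angle `0` carry no variables. -/
structure IsDiagram (D : ZXGraph 𝒱 I O) : Prop where
  finite : Finite D.V
  boundary : ∀ b : I ⊕ O, D.degree (Sum.inr b) = 1
  hadamard : ∀ v : D.V, D.kind v = Kind.hadamard → D.degree (Sum.inl v) = 2
  zero : ∀ (v : D.V) (c : Colour) (U : Finset 𝒱), D.kind v = Kind.spider c 0 U → U = ∅

/-- Isomorphism of labelled open graphs, fixing the boundary. -/
def Iso (D E : ZXGraph 𝒱 I O) : Prop :=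
  ∃ φ : D.V ≃ E.V, (∀ v, E.kind (φ v) = D.kind v) ∧
    E.edges = D.edges.map (Sym2.map (Sum.map φ id))

/-- The (induced) subgraph on the interior vertices satisfying `keep`, together with all boundary
vertices: all other vertices are deleted, with the edges incident to them. -/
noncomputable def induce (D : ZXGraph 𝒱 I O) (keep : D.V → Prop) : ZXGraph 𝒱 I O where
  V := {v : D.V // keep v}
  kind v := D.kind v.1
  edges := D.edges.filterMap fun e =>
    if h : ∀ w ∈ e, ∀ v : D.V, w = Sum.inl v → keep v then
      some (e.pmap (P := fun w => ∀ v : D.V, w = Sum.inl v → keep v)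
        (fun w hw => match w, hw with
          | Sum.inl v, hv => Sum.inl ⟨v, hv v rfl⟩
          | Sum.inr b, _ => Sum.inr b) h)
    else none

/-! ### Rewriting -/

/-- A context into which a graph with boundary `A`, `B` can be plugged: the rest of a graph with
boundary `I`, `O`, and for each boundary point of the hole the vertex of the surrounding graph to
which the corresponding wire is attached. -/
structure Context (𝒱 A B I O : Type) where
  V : Type
  kind : V → Kind 𝒱
  edges : Multiset (Sym2 (V ⊕ (I ⊕ O)))
  attach : A ⊕ B → V ⊕ (I ⊕ O)

/-- Plugging `L` into a context: take the disjoint union, erase the boundary vertices of `L`, and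
let the wires that ended there end at the prescribed vertices of the context. -/
def Context.plug {A B : Type} (C : Context 𝒱 A B I O) (L : ZXGraph 𝒱 A B) : ZXGraph 𝒱 I O where
  V := C.V ⊕ L.V
  kind := Sum.elim C.kind L.kind
  edges :=
    C.edges.map (Sym2.map (Sum.map Sum.inl id)) +
    L.edges.map (Sym2.map
      (Sum.elim (Sum.inl ∘ Sum.inr) (fun x => Sum.map Sum.inl id (C.attach x))))

/-- One wire for each boundary point, connecting it to an interior vertex. -/
def legs {V A B : Type} [Fintype A] [Fintype B] (f : A ⊕ B → V) : Multiset (Sym2 (V ⊕ (A ⊕ B))) :=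
  (Finset.univ : Finset (A ⊕ B)).val.map fun x => s(Sum.inr x, Sum.inl (f x))

/-- A single spider with inputs `A` and outputs `B`. -/
noncomputable def oneStar (A B : Type) [Fintype A] [Fintype B] (k : Kind 𝒱) : ZXGraph 𝒱 A B where
  V := Unit
  kind _ := k
  edges := legs fun _ => ()

/-- A plain wire. -/
def wire : ZXGraph 𝒱 Unit Unit where
  V := Empty
  kind v := v.elim
  edges := {s(Sum.inr (Sum.inl ()), Sum.inr (Sum.inr ()))}

/-- Two vertices with labels `k₀` (carrying the wires `A`) and `k₁` (carrying the wires `B`), joined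
by `n` parallel edges. -/
noncomputable def twoStars (A B : Type) [Fintype A] [Fintype B] (k₀ k₁ : Kind 𝒱) (n : ℕ) :
    ZXGraph 𝒱 A B where
  V := Fin 2
  kind := ![k₀, k₁]
  edges := Multiset.replicate n s(Sum.inl 0, Sum.inl 1) +
    legs (Sum.elim (fun _ => 0) (fun _ => 1))

/-- A single vertex with one self-loop. -/
noncomputable def loopStar (A B : Type) [Fintype A] [Fintype B] (k : Kind 𝒱) : ZXGraph 𝒱 A B where
  V := Unit
  kind _ := k
  edges := s(Sum.inl (), Sum.inl ()) ::ₘ legs fun _ => ()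

/-- A disconnected family of degree one vertices with label `k`, one on each output wire. -/
noncomputable def points (B : Type) [Fintype B] (k : Kind 𝒱) : ZXGraph 𝒱 Empty B where
  V := B
  kind _ := k
  edges := legs (Sum.elim Empty.elim id)

/-- A vertex labelled `k` with one input wire, whose outputs `B` each pass through a vertex
labelled `l`. -/
noncomputable def starThen (B : Type) [Fintype B] (k l : Kind 𝒱) : ZXGraph 𝒱 Unit B where
  V := Unit ⊕ B
  kind := Sum.elim (fun _ => k) (fun _ => l)
  edges := (Finset.univ : Finset B).val.map (fun b => s(Sum.inl (Sum.inl ()), Sum.inl (Sum.inr b)))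
    + legs (Sum.map id id)

/-- A vertex labelled `k` all of whose wires pass through an `H` vertex. -/
noncomputable def hadamardStar (A B : Type) [Fintype A] [Fintype B] (k : Kind 𝒱) :
    ZXGraph 𝒱 A B where
  V := Unit ⊕ (A ⊕ B)
  kind := Sum.elim (fun _ => k) (fun _ => Kind.hadamard)
  edges := (Finset.univ : Finset (A ⊕ B)).val.map
      (fun x => s(Sum.inl (Sum.inl ()), Sum.inl (Sum.inr x)))
    + legs (fun x => Sum.inr x)

/-- Two vertices labelled `k` on the two inputs, two vertices labelled `l` on the two outputs, and
an edge between each of the former and each of the latter. -/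
noncomputable def crossed (k l : Kind 𝒱) : ZXGraph 𝒱 (Fin 2) (Fin 2) where
  V := Fin 2 ⊕ Fin 2
  kind := Sum.elim (fun _ => k) (fun _ => l)
  edges := (Finset.univ : Finset (Fin 2 × Fin 2)).val.map
      (fun x => s(Sum.inl (Sum.inl x.1), Sum.inl (Sum.inr x.2)))
    + legs id

/-- The rewrite rules of the ZX-calculus with conditional vertices, for both colours `c`.
As usual, they hold up to non-zero scalar factors, which are not recorded. -/
inductive Rule : {A B : Type} → ZXGraph 𝒱 A B → ZXGraph 𝒱 A B → Prop
  /-- Adjacent spiders of the same colour and with the same condition merge.  (A spider with angle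
  `0` may be regarded as carrying any condition, see `node`.) -/
  | spider (A B : Type) [Fintype A] [Fintype B] (c : Colour) (α β : Real.Angle) (U : Finset 𝒱) :
      Rule (twoStars A B (node c α U) (node c β U) 1) (oneStar A B (node c (α + β) U))
  /-- Self-loops on spiders can be removed. -/
  | antiLoop (A B : Type) [Fintype A] [Fintype B] (c : Colour) (α : Real.Angle) (U : Finset 𝒱) :
      Rule (loopStar A B (node c α U)) (oneStar A B (node c α U))
  /-- Adjacent spiders of the same colour exchange their labels. -/
  | phaseCommute (A B : Type) [Fintype A] [Fintype B] (c : Colour) (α β : Real.Angle)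
      (U W : Finset 𝒱) :
      Rule (twoStars A B (node c α U) (node c β W) 1) (twoStars A B (node c β W) (node c α U) 1)
  /-- A spider with angle `0`, one input and one output is a wire. -/
  | identity (c : Colour) : Rule (oneStar Unit Unit (node c 0 ∅)) wire
  /-- A point of one colour is copied by a spider of the other colour. -/
  | copying (B : Type) [Fintype B] (c : Colour) :
      Rule (twoStars Empty B (node c.other 0 ∅) (node c 0 ∅) 1) (points B (node c.other 0 ∅))
  /-- A `π` vertex of one colour passes through a spider of the other colour, negating its angle.
  If the `π` vertex is conditional, this is allowed only when the negation has no effect, so that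
  the equation is true in all valuations of the variables. -/
  | piCommute (B : Type) [Fintype B] (c : Colour) (α : Real.Angle) (U W : Finset 𝒱)
      (h : W = ∅ ∨ -α = α) :
      Rule (twoStars Unit B (node c.other (Real.pi : Real.Angle) W) (node c α U) 1)
        (starThen B (node c (-α) U) (node c.other (Real.pi : Real.Angle) W))
  | bialgebra (c : Colour) :
      Rule (crossed (node c 0 ∅) (node c.other 0 ∅))
        (twoStars (Fin 2) (Fin 2) (node c.other 0 ∅) (node c 0 ∅) 1)
  | hopf (c : Colour) :
      Rule (twoStars Unit Unit (node c 0 ∅) (node c.other 0 ∅) 2)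
        (twoStars Unit Unit (node c 0 ∅) (node c.other 0 ∅) 0)
  /-- A spider with an `H` on every wire is a spider of the other colour. -/
  | hadamardCommute (A B : Type) [Fintype A] [Fintype B] (c : Colour) (α : Real.Angle)
      (U : Finset 𝒱) :
      Rule (hadamardStar A B (node c α U)) (oneStar A B (node c.other α U))
  /-- Two consecutive `H` vertices cancel. -/
  | hadamardCancel : Rule (twoStars Unit Unit Kind.hadamard Kind.hadamard 1) wire

/-- One application of a rewrite rule, inside an arbitrary context. -/
def Step (D E : ZXGraph 𝒱 I O) : Prop :=
  ∃ (A B : Type) (L R : ZXGraph 𝒱 A B) (C : Context 𝒱 A B I O),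
    Rule L R ∧ Iso D (C.plug L) ∧ Iso E (C.plug R)

/-- `D` can be rewritten to `E` by the equations of the calculus: a finite sequence of rule
applications, in either direction, and of isomorphisms of labelled open graphs.  Both sides of each
rule are diagrams with the same boundary, so a rule application preserves `IsDiagram`. -/
def Rewrites (D E : ZXGraph 𝒱 I O) : Prop :=
  Relation.EqvGen (fun D₁ D₂ => Iso D₁ D₂ ∨ Step D₁ D₂) D E

/-! ### Circuit-like diagrams -/

/-- A directed path that ends in an output vertex, as the list of the vertices it visits. -/
def IsPathToOutput (D : ZXGraph 𝒱 I O) (p : List D.Vertex) : Prop :=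
  p.Nodup ∧ p.IsChain D.Adj ∧ ∃ o : O, p.getLast? = some (Sum.inr (Sum.inr o))

/-- An oriented cycle, as the list of the vertices it visits, where the starting vertex is repeated
at the end: `v, l₁, ..., lₖ, v` with `v, l₁, ..., lₖ` distinct and `k ≥ 2`. -/
def IsOrientedCycle (D : ZXGraph 𝒱 I O) (γ : List D.Vertex) : Prop :=
  ∃ (v : D.Vertex) (l : List D.Vertex), γ = v :: l ++ [v] ∧ 2 ≤ l.length ∧ (v :: l).Nodup ∧
    γ.IsChain D.Adj

/-- The path or cycle `p` traverses the edge `{a, b}` from `a` to `b`. -/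
def Traverses {W : Type} (p : List W) (a b : W) : Prop := [a, b] <:+: p

/-- The cycle `γ` and the path `p` have an edge in common (in any direction). -/
def SharesEdge {W : Type} (γ p : List W) : Prop :=
  ∃ a b : W, Traverses γ a b ∧ (Traverses p a b ∨ Traverses p b a)

/-- Circuit-like diagrams. -/
def IsCircuitLike (D : ZXGraph 𝒱 I O) : Prop :=
  (∃ paths : Set (List D.Vertex),
    -- disjoint directed paths, ending in outputs, which cover all vertices
    (∀ p ∈ paths, D.IsPathToOutput p) ∧
    (∀ p ∈ paths, ∀ q ∈ paths, p ≠ q → p.Disjoint q) ∧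
    (∀ w : D.Vertex, ∃ p ∈ paths, w ∈ p) ∧
    -- an oriented cycle with edges from two different paths runs against one of the paths
    (∀ γ : List D.Vertex, D.IsOrientedCycle γ →
      (∃ p ∈ paths, ∃ q ∈ paths, p ≠ q ∧ SharesEdge γ p ∧ SharesEdge γ q) →
      ∃ p ∈ paths, ∃ a b : D.Vertex, Traverses γ a b ∧ Traverses p b a)) ∧
  -- the graph is simple
  D.edges.Nodup ∧ (∀ e ∈ D.edges, ¬ e.IsDiag) ∧
  -- and it is properly 3-coloured by the types of its vertices
  (∀ u v : D.V, D.Adj (Sum.inl u) (Sum.inl v) → (D.kind u).type ≠ (D.kind v).type)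

end ZXGraph

/-! ## The measurement calculus -/

/-- Commands on qubits `Q`.  The signal of a measurement is named by the measured qubit. -/
inductive Command (Q : Type)
  /-- `N_i`: initialise qubit `i` in the state `|+⟩`. -/
  | N (i : Q)
  /-- `E_ij`: entangle qubits `i` and `j` by a controlled-`Z`. -/
  | E (i j : Q)
  /-- `ˢ[M_i^α]ᵗ`: (conditional) measurement of qubit `i`, which abbreviates `M_i^α Z_i^t X_i^s`;
  it is the unconditional `M_i^α` when `s` and `t` are empty. -/
  | M (i : Q) (α : Real.Angle) (s t : Finset Q)
  /-- `X_i^s`: correction controlled by the signals `s`, or unconditional if `s` is empty. -/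
  | X (i : Q) (s : Finset Q)
  /-- `Z_i^s`: correction controlled by the signals `s`, or unconditional if `s` is empty. -/
  | Z (i : Q) (s : Finset Q)

namespace Command

variable {Q : Type}

def Initialises : Command Q → Q → Prop
  | N i, q => q = i
  | _, _ => False

def Entangles : Command Q → Q → Q → Prop
  | E i j, u, v => (u = i ∧ v = j) ∨ (u = j ∧ v = i)
  | _, _, _ => False

def Measures : Command Q → Q → Prop
  | M i _ _ _, q => q = i
  | _, _ => False

def Corrects : Command Q → Q → Prop
  | X i _, q => q = i
  | Z i _, q => q = i
  | _, _ => False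

/-- The command acts on the qubit. -/
def ActsOn (c : Command Q) (q : Q) : Prop :=
  c.Initialises q ∨ (∃ r, c.Entangles q r) ∨ c.Measures q ∨ c.Corrects q

/-- The command depends on the signal of the (measured) qubit. -/
def DependsOn : Command Q → Q → Prop
  | M _ _ s t, q => q ∈ s ∨ q ∈ t
  | X _ s, q => q ∈ s
  | Z _ s, q => q ∈ s
  | _, _ => False

/-- The vertices of the diagram of a command, listed along the wires.  Each comes with the qubit on
whose wire it lies, except for the `H` vertex between the two wires of `E_ij`. -/
noncomputable def nodes : Command Q → List (Option Q × Kind Q)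
  | N i => [(some i, node .Z 0 ∅)]
  | E i j => [(some i, node .Z 0 ∅), (none, Kind.hadamard), (some j, node .Z 0 ∅)]
  | M i α s t =>
      (if s = ∅ then [] else [(some i, node .X (Real.pi : Real.Angle) s)]) ++
      (if t = ∅ then [] else [(some i, node .Z (Real.pi : Real.Angle) t)]) ++
      [(some i, node .Z (Real.pi : Real.Angle) {i}), (some i, node .Z (-α) ∅)]
  | X i s => [(some i, node .X (Real.pi : Real.Angle) s)]
  | Z i s => [(some i, node .Z (Real.pi : Real.Angle) s)]

/-- The edges of the diagram of a command which do not lie on a wire: those joining the `H` vertex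
of `E_ij` to the spiders on the two wires. -/
noncomputable def links : (c : Command Q) → List (Fin c.nodes.length × Fin c.nodes.length)
  | E i j =>
      [((⟨0, by simp [nodes]⟩ : Fin (E i j).nodes.length), ⟨1, by simp [nodes]⟩),
        (⟨1, by simp [nodes]⟩, ⟨2, by simp [nodes]⟩)]
  | _ => []

end Command

/-- A measurement pattern with qubits `Q`: a command sequence, listed in the order of execution,
which satisfies the determinacy conditions. -/
structure Pattern (Q : Type) where
  commands : List (Command Q)
  /-- entangling operations act on two different qubits -/
  entangle_ne : ∀ c ∈ commands, ∀ u v, c.Entangles u v → u ≠ v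
  /-- the initialisation of a qubit is the first command acting on it -/
  init_first : ∀ pre c post, commands = pre ++ c :: post →
    ∀ q, c.Initialises q → ∀ d ∈ pre, ¬ d.ActsOn q
  /-- the measurement of a qubit is the last command acting on it -/
  measure_last : ∀ pre c post, commands = pre ++ c :: post →
    ∀ q, c.Measures q → ∀ d ∈ post, ¬ d.ActsOn q
  /-- no command depends on a measurement not already performed -/
  depends : ∀ pre c post, commands = pre ++ c :: post →
    ∀ q, c.DependsOn q → ∃ d ∈ pre, d.Measures q

namespace Pattern

variable {Q : Type}

/-- Standard form `C M E N`: initialisations, then entangling operations, then (possibly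
conditional) measurements, then corrections. -/
def IsStandard (P : Pattern Q) : Prop :=
  ∃ ns es ms cs : List (Command Q), P.commands = ns ++ es ++ ms ++ cs ∧
    (∀ c ∈ ns, ∃ q, c.Initialises q) ∧ (∀ c ∈ es, ∃ u v, c.Entangles u v) ∧
    (∀ c ∈ ms, ∃ q, c.Measures q) ∧ (∀ c ∈ cs, ∃ q, c.Corrects q)

/-- No pair of qubits is entangled more than once. -/
def EntanglesOnce (P : Pattern Q) : Prop :=
  P.commands.Pairwise fun c d => ∀ u v, c.Entangles u v → ¬ d.Entangles u v

/-- The inputs are the qubits which are not initialised. -/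
def inputs (P : Pattern Q) : Set Q := {q | ∀ c ∈ P.commands, ¬ c.Initialises q}

/-- The outputs are the qubits which are not measured. -/
def outputs (P : Pattern Q) : Set Q := {q | ∀ c ∈ P.commands, ¬ c.Measures q}

/-- The geometry of a pattern. -/
def geometry (P : Pattern Q) : OpenGraph Q where
  graph :=
    { Adj := fun u v => ∃ c ∈ P.commands, c.Entangles u v
      symm := by
        refine ⟨?_⟩
        rintro u v ⟨c, hc, h⟩
        refine ⟨c, hc, ?_⟩
        cases c <;> simp_all [Command.Entangles]
        tauto
      loopless := ⟨by
        rintro u ⟨c, hc, h⟩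
        exact P.entangle_ne c hc u u h rfl⟩ }
  inputs := P.inputs
  outputs := P.outputs

/-- The interior vertices of the diagram of a pattern: pairs of (the position of) a command and a
vertex of the diagram of that command. -/
abbrev Node (P : Pattern Q) : Type :=
  Σ k : Fin P.commands.length, Fin (P.commands.get k).nodes.length

/-- The vertices on the wire of qubit `q`, in the order of execution, including the boundary
vertices if `q` is an input or an output. -/
noncomputable def wire (P : Pattern Q) (q : Q) : List (P.Node ⊕ (P.inputs ⊕ P.outputs)) :=
  (if h : q ∈ P.inputs then [Sum.inr (Sum.inl ⟨q, h⟩)] else []) ++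
  ((List.finRange P.commands.length).flatMap fun k =>
    ((List.finRange (P.commands.get k).nodes.length).filter fun j =>
      ((P.commands.get k).nodes.get j).1 = some q).map fun j => Sum.inl ⟨k, j⟩) ++
  (if h : q ∈ P.outputs then [Sum.inr (Sum.inr ⟨q, h⟩)] else [])

/-- The edges joining consecutive vertices on the wire of qubit `q`. -/
noncomputable def wireEdges (P : Pattern Q) (q : Q) :
    Multiset (Sym2 (P.Node ⊕ (P.inputs ⊕ P.outputs))) :=
  ↑(((P.wire q).zip (P.wire q).tail).map fun x => s(x.1, x.2))

/-- The edges between different wires, through the `H` vertices. -/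
noncomputable def linkEdges (P : Pattern Q) :
    Multiset (Sym2 (P.Node ⊕ (P.inputs ⊕ P.outputs))) :=
  (Finset.univ : Finset (Fin P.commands.length)).val.bind fun k =>
    ↑((P.commands.get k).links.map fun x =>
      s((Sum.inl ⟨k, x.1⟩ : P.Node ⊕ (P.inputs ⊕ P.outputs)), Sum.inl ⟨k, x.2⟩))

/-- The conditional diagram `D(P)`, from the inputs to the outputs of `P`, with variables the
signals of `P`: the composite of the diagrams of its commands. -/
noncomputable def diagram [Fintype Q] (P : Pattern Q) : ZXGraph Q P.inputs P.outputs where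
  V := P.Node
  kind x := ((P.commands.get x.1).nodes.get x.2).2
  edges :=
    ((Finset.univ : Finset Q).val.bind fun q => P.wireEdges q) + P.linkEdges

/-- The subgraph of `D(P)` excluding the measurements: all vertices of the diagrams of the (possibly
conditional) measurement commands are deleted, with the edges incident to them. -/
noncomputable def measurementFreeDiagram [Fintype Q] (P : Pattern Q) :
    ZXGraph Q P.inputs P.outputs :=
  P.diagram.induce fun x : P.Node => ¬ ∃ q, (P.commands.get x.1).Measures q

end Pattern

/-! A linear extension of the flow order ranks the qubits, so that every entangling command has a
lower end `lo` and an upper end `hi`. Call it a flow command if `hi` is the image of `lo` under the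
flow `f`, and a gate otherwise. The map `f` is injective: if `f(u) = f(v)` with `u ≠ v`, then `v` is
a neighbour of `f(u)` and `u` is a neighbour of `f(v)`, so `u < v` and `v < u`. Since `f` also
increases the rank, the flow commands string the wires of the qubits together into disjoint chains,
each ending in an output. These chains, with the `H` of each flow command between two consecutive
wires, are the paths of (C1).

The `H` of a gate cannot stay on its link, where no path would cover it. A controlled-`Z` is
therefore turned into a controlled-`X`: a `Z` spider on the wire of `lo` is linked directly to an
`X` spider on the wire of `hi`, and the `H` vertices stand on both sides of that `X` spider, on its
wire. Identity spiders (`sep`, `pad`, `corrPad`) are inserted so that neighbouring vertices have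
different types, as (C3) asks; that the graph is simple uses that no pair is entangled twice.

For (C2) the vertices receive heights. Heights increase strictly along the paths, and the link of a
gate is horizontal. A cycle that never runs against a path cannot descend, so its height is
constant, so it contains no path edge at all. Such heights exist because of the last flow condition:
every gate that arrives at `f(u)` comes from a neighbour of `f(u)` other than `u`, hence from a
qubit of higher rank than `u`, so all gates on the wire of `f(u)` can be placed after the flow
command that leads to it.

For the rewriting, both diagrams are brought to the normal form `merged`, where all `Z` spiders of a
wire except the corrections are fused into one. There the order of the commuting controlled-`Z`s is
no longer visible. Starting from the circuit-like diagram one removes identities, changes the colour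
of the targets, and fuses; starting from the pattern one inserts a spider on each input wire, and
fuses.

All intermediate graphs are drawn on one fixed type of sites, as a `net` of wires (lists) and links.
This reduces isomorphisms to equalities of site sets and edge multisets. The carrying statements are
`rewrites_of_rule`, `net_change_colour` and `net_merge_all` for rewriting, `drawn_isCircuitLike` and
`circuitWire_isChain` for the height argument, and `exists_schedule` for the combinatorics of the
flow. -/

namespace ZXGraph

variable {𝒱 I O U : Type}

/-! ### Graphs drawn on a fixed set of sites -/

/-- The action of a map of interior vertices on edges. -/
def mapEdge {V W : Type} (j : V → W) : Sym2 (V ⊕ (I ⊕ O)) → Sym2 (W ⊕ (I ⊕ O)) :=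
  Sym2.map (Sum.map j id)

theorem mapEdge_injective {V W : Type} {j : V → W} (hj : Function.Injective j) :
    Function.Injective (mapEdge (I := I) (O := O) j) :=
  Sym2.map.injective (hj.sumMap Function.injective_id)

/-- `D` is drawn on the sites `S`, with labels `k` and edges `E`. -/
def Realizes (D : ZXGraph 𝒱 I O) (S : Set U) (k : U → Kind 𝒱)
    (E : Multiset (Sym2 (U ⊕ (I ⊕ O)))) : Prop :=
  ∃ j : D.V → U, Function.Injective j ∧ Set.range j = S ∧ (∀ v, k (j v) = D.kind v) ∧
    D.edges.map (mapEdge j) = E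

/-- The two embeddings have the same image, so one followed by the inverse of the other is a
bijection of vertices. Labels need to agree only on the sites in use. -/
theorem Realizes.iso {D D' : ZXGraph 𝒱 I O} {S : Set U} {k k' : U → Kind 𝒱}
    {E : Multiset (Sym2 (U ⊕ (I ⊕ O)))} (h : D.Realizes S k E) (h' : D'.Realizes S k' E)
    (hk : ∀ u ∈ S, k u = k' u) : Iso D D' := by
  obtain ⟨j, hj, hS, hkj, hE⟩ := h
  obtain ⟨j', hj', hS', hkj', hE'⟩ := h'
  have key : ∀ v, ∃ v', j' v' = j v := fun v => by
    have : j v ∈ Set.range j' := by rw [hS', ← hS]; exact ⟨v, rfl⟩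
    exact this
  choose φ hφ using key
  have hbij : Function.Bijective φ := by
    refine ⟨fun a b hab => hj (by rw [← hφ, ← hφ, hab]), fun v' => ?_⟩
    have : j' v' ∈ Set.range j := by rw [hS, ← hS']; exact ⟨v', rfl⟩
    obtain ⟨v, hv⟩ := this
    exact ⟨v, hj' (by rw [hφ, hv])⟩
  refine ⟨Equiv.ofBijective φ hbij, fun v => ?_, ?_⟩
  · change D'.kind (φ v) = _
    rw [← hkj', hφ, ← hkj, hk]
    rw [← hS]; exact ⟨v, rfl⟩
  · apply Multiset.map_injective (mapEdge_injective hj')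
    rw [hE', ← hE, Multiset.map_map]
    refine Multiset.map_congr rfl fun e _ => ?_
    simp only [mapEdge, Function.comp]
    rw [Sym2.map_map]
    congr 1
    funext x
    rcases x with x | x
    · simp [hφ]
    · simp

theorem Iso.rewrites {D E : ZXGraph 𝒱 I O} (h : Iso D E) : Rewrites D E :=
  .rel _ _ (.inl h)

/-- All interior endpoints of the edge lie in `S`. -/
def EndsIn (S : Set U) (e : Sym2 (U ⊕ (I ⊕ O))) : Prop := ∀ u : U, Sum.inl u ∈ e → u ∈ S

theorem endsIn_mk {S : Set U} {a b : U ⊕ (I ⊕ O)} :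
    EndsIn S s(a, b) ↔ (∀ u, a = Sum.inl u → u ∈ S) ∧ (∀ u, b = Sum.inl u → u ∈ S) := by
  simp only [EndsIn, Sym2.mem_iff]
  constructor
  · exact fun h => ⟨fun u hu => h u (.inl hu.symm), fun u hu => h u (.inr hu.symm)⟩
  · rintro ⟨h1, h2⟩ u (hu | hu)
    exacts [h1 u hu.symm, h2 u hu.symm]

/-- Replaces the dependent definition of `induce` by a filter on edges of the ambient vertex type.
-/
theorem induce_edges_map (D : ZXGraph 𝒱 I O) (keep : D.V → Prop) :
    (D.induce keep).edges.map (mapEdge (Subtype.val : {v : D.V // keep v} → D.V)) =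
      D.edges.filter (EndsIn {v | keep v}) := by
  rw [← Multiset.filterMap_eq_filter]
  simp only [induce]
  rw [Multiset.map_filterMap]
  congr 1
  funext e
  by_cases h : ∀ w ∈ e, ∀ v : D.V, w = Sum.inl v → keep v
  · have h' : EndsIn {v | keep v} e := fun u hu => h _ hu u rfl
    simp only [Option.guard, h', decide_true, if_true]
    rw [dif_pos h, Option.map_some]
    congr 1
    induction e with | _ a b
    rcases a with a | a <;> rcases b with b | b <;> rfl
  · have h' : ¬ EndsIn {v | keep v} e := fun h' => h fun w hw v hv => h' v (hv ▸ hw)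
    rw [dif_neg h]
    simp only [Option.guard, h', decide_false]
    rfl

/-- The part of the graph with labels `k` and edges `E` that is drawn on the sites `S`. -/
noncomputable def drawn (S : Set U) (k : U → Kind 𝒱) (E : Multiset (Sym2 (U ⊕ (I ⊕ O)))) :
    ZXGraph 𝒱 I O :=
  (⟨U, k, E⟩ : ZXGraph 𝒱 I O).induce (· ∈ S)

theorem drawn_edges_map {S : Set U} {k : U → Kind 𝒱} {E : Multiset (Sym2 (U ⊕ (I ⊕ O)))}
    (hE : ∀ e ∈ E, EndsIn S e) :
    (drawn S k E).edges.map (mapEdge (Subtype.val : S → U)) = E :=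
  (induce_edges_map ⟨U, k, E⟩ (· ∈ S)).trans (Multiset.filter_eq_self.2 hE)

theorem drawn_realizes {S : Set U} {k : U → Kind 𝒱} {E : Multiset (Sym2 (U ⊕ (I ⊕ O)))}
    (hE : ∀ e ∈ E, EndsIn S e) : (drawn S k E).Realizes S k E :=
  ⟨Subtype.val, Subtype.val_injective, Subtype.range_val, fun _ => rfl, drawn_edges_map hE⟩

/-- A subgraph may be drawn on other sites. -/
theorem induce_realizes {D : ZXGraph 𝒱 I O} {keep : D.V → Prop} {S : Set U} {k : U → Kind 𝒱}
    {E : Multiset (Sym2 (U ⊕ (I ⊕ O)))} (j : D.V → U) (hj : Set.InjOn j {v | keep v})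
    (hS : j '' {v | keep v} = S) (hk : ∀ v, keep v → k (j v) = D.kind v)
    (hE : (D.edges.filter (EndsIn {v | keep v})).map (mapEdge j) = E) :
    (D.induce keep).Realizes S k E := by
  refine ⟨fun v : {v : D.V // keep v} => j v.1, fun a b hab => Subtype.ext (hj a.2 b.2 hab),
    ?_, fun v => hk v.1 v.2, ?_⟩
  · rw [← hS]; ext u; simp [induce]
  · rw [← hE, ← induce_edges_map]
    refine Eq.trans ?_ (Multiset.map_map _ _ _).symm
    refine Multiset.map_congr rfl fun e _ => ?_
    refine Eq.trans ?_ (Sym2.map_map _).symm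
    refine congrArg (Sym2.map · e) (funext fun x => ?_)
    rcases x with x | x <;> rfl

/-! ### Applying one rule to a drawn graph -/

/-- Drawing the part of an edge that lies in the hole of a context. -/
def plugEdge {V A B : Type} (i : V → U) (att : A ⊕ B → U ⊕ (I ⊕ O)) :
    Sym2 (V ⊕ (A ⊕ B)) → Sym2 (U ⊕ (I ⊕ O)) :=
  Sym2.map (Sum.elim (Sum.inl ∘ i) att)

/-- A rule applied to a drawn graph. -/
theorem rewrites_of_rule {A B : Type} {L R : ZXGraph 𝒱 A B} (hr : Rule L R)
    {S₀ S S' : Set U} {k : U → Kind 𝒱} {E₀ E E' : Multiset (Sym2 (U ⊕ (I ⊕ O)))}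
    (iL : L.V → U) (iR : R.V → U) (att : A ⊕ B → U ⊕ (I ⊕ O))
    (hL : Function.Injective iL) (hR : Function.Injective iR)
    (hdL : ∀ v, iL v ∉ S₀) (hdR : ∀ v, iR v ∉ S₀)
    (hkL : ∀ v, k (iL v) = L.kind v) (hkR : ∀ v, k (iR v) = R.kind v)
    (hatt : ∀ x u, att x = Sum.inl u → u ∈ S₀) (hE₀ : ∀ e ∈ E₀, EndsIn S₀ e)
    (hS : S = S₀ ∪ Set.range iL) (hS' : S' = S₀ ∪ Set.range iR)
    (hE : E = E₀ + L.edges.map (plugEdge iL att)) (hE' : E' = E₀ + R.edges.map (plugEdge iR att))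
    {D D' : ZXGraph 𝒱 I O} (hD : D.Realizes S k E) (hD' : D'.Realizes S' k E') :
    Rewrites D D' := by
  -- The attachment points must be vertices of the context itself, so `att` is lifted along the
  -- inclusion of `S₀`.
  have hatt' : ∀ x, ∃ y : S₀ ⊕ (I ⊕ O), Sum.map Subtype.val id y = att x := fun x => by
    cases hx : att x with
    | inl u => exact ⟨Sum.inl ⟨u, hatt x u hx⟩, rfl⟩
    | inr b => exact ⟨Sum.inr b, rfl⟩
  choose att' hatt' using hatt'
  let C : Context 𝒱 A B I O := ⟨S₀, fun v => k v.1, (drawn S₀ k E₀).edges, att'⟩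
  -- The context occupies `S₀` and the hole avoids it, so the two embeddings together are injective
  -- and the plugged graph is drawn on the union.
  have plug : ∀ (G : ZXGraph 𝒱 A B) (i : G.V → U), Function.Injective i → (∀ v, i v ∉ S₀) →
      (∀ v, k (i v) = G.kind v) →
      (C.plug G).Realizes (S₀ ∪ Set.range i) k (E₀ + G.edges.map (plugEdge i att)) := by
    intro G i hi hd hk
    refine ⟨(Sum.elim Subtype.val i : S₀ ⊕ G.V → U), ?_, ?_, ?_, ?_⟩
    · refine Subtype.val_injective.sumElim hi fun a b hab => hd b ?_
      rw [← hab]; exact a.2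
    · exact (Set.Sum.elim_range _ _).trans (by rw [Subtype.range_val])
    · rintro (v | v)
      · rfl
      · exact hk v
    · simp only [Context.plug]
      rw [Multiset.map_add, Multiset.map_map, Multiset.map_map]
      congr 1
      · rw [← drawn_edges_map (k := k) hE₀]
        refine Multiset.map_congr rfl fun e _ => ?_
        simp only [mapEdge, Function.comp]
        rw [Sym2.map_map]
        congr 1
        funext x
        rcases x with x | x <;> rfl
      · refine Multiset.map_congr rfl fun e _ => ?_
        simp only [mapEdge, plugEdge, Function.comp]
        rw [Sym2.map_map]
        congr 1
        funext x
        rcases x with x | x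
        · rfl
        · refine Eq.trans ?_ (hatt' x)
          change Sum.map _ _ (Sum.map _ _ (att' x)) = _
          cases att' x <;> rfl
  subst hS hS' hE hE'
  exact .rel _ _ (.inr ⟨A, B, L, R, C, hr, hD.iso (plug L iL hL hdL hkL) fun _ _ => rfl,
    hD'.iso (plug R iR hR hdR hkR) fun _ _ => rfl⟩)

end ZXGraph

namespace ZXGraph

variable {𝒱 I O U : Type}

theorem Rewrites.trans' {D E F : ZXGraph 𝒱 I O} (h : Rewrites D E) (h' : Rewrites E F) :
    Rewrites D F :=
  Relation.EqvGen.trans _ _ _ h h'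

theorem Rewrites.symm' {D E : ZXGraph 𝒱 I O} (h : Rewrites D E) : Rewrites E D :=
  Relation.EqvGen.symm _ _ h

/-! ### Graphs made of wires and links -/

/-- The edges between consecutive elements of a list. -/
def chain {X : Type} : List X → Multiset (Sym2 X)
  | [] => 0
  | [_] => 0
  | a :: b :: l => s(a, b) ::ₘ chain (b :: l)

@[simp] theorem chain_nil {X : Type} : chain ([] : List X) = 0 := rfl

@[simp] theorem chain_singleton {X : Type} (a : X) : chain [a] = 0 := rfl

@[simp] theorem chain_cons_cons {X : Type} (a b : X) (l : List X) :
    chain (a :: b :: l) = s(a, b) ::ₘ chain (b :: l) := rfl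

/-- A wire is cut at a vertex that both parts retain; local changes of wires are reduced to this. -/
theorem chain_append_cons {X : Type} (l₁ l₂ : List X) (a : X) :
    chain (l₁ ++ a :: l₂) = chain (l₁ ++ [a]) + chain (a :: l₂) := by
  induction l₁ with
  | nil => simp
  | cons b l₁ ih =>
    cases l₁ with
    | nil => simp
    | cons c l₁ => simpa using ih

theorem mem_of_mem_chain {X : Type} {l : List X} {e : Sym2 X} (he : e ∈ chain l) {x : X}
    (hx : x ∈ e) : x ∈ l := by
  induction l with
  | nil => simp at he
  | cons a l ih =>
    cases l with
    | nil => simp at he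
    | cons b l =>
      rw [chain_cons_cons, Multiset.mem_cons] at he
      rcases he with rfl | he
      · rcases Sym2.mem_iff.1 hx with rfl | rfl <;> simp
      · exact List.mem_cons_of_mem _ (ih he)

theorem chain_map {X Y : Type} (g : X → Y) (l : List X) :
    (chain l).map (Sym2.map g) = chain (l.map g) := by
  induction l with
  | nil => rfl
  | cons a l ih =>
    cases l with
    | nil => rfl
    | cons b l => simpa using ih

/-- The sites on the wires `W` or at the ends of the links `L`. -/
def sites (W : Multiset (List (U ⊕ (I ⊕ O)))) (L : Multiset (Sym2 (U ⊕ (I ⊕ O)))) : Set U :=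
  {u | (∃ l ∈ W, Sum.inl u ∈ l) ∨ ∃ e ∈ L, Sum.inl u ∈ e}

theorem mem_sites {W : Multiset (List (U ⊕ (I ⊕ O)))} {L : Multiset (Sym2 (U ⊕ (I ⊕ O)))} {u : U} :
    u ∈ sites W L ↔ (∃ l ∈ W, Sum.inl u ∈ l) ∨ ∃ e ∈ L, Sum.inl u ∈ e := Iff.rfl

theorem mem_sites_cons {l : List (U ⊕ (I ⊕ O))} {W : Multiset (List (U ⊕ (I ⊕ O)))}
    {L : Multiset (Sym2 (U ⊕ (I ⊕ O)))} {u : U} :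
    u ∈ sites (l ::ₘ W) L ↔ Sum.inl u ∈ l ∨ u ∈ sites W L := by
  simp [mem_sites, or_assoc]

theorem mem_sites_link {a b : U ⊕ (I ⊕ O)} {W : Multiset (List (U ⊕ (I ⊕ O)))}
    {L : Multiset (Sym2 (U ⊕ (I ⊕ O)))} {u : U} :
    u ∈ sites W (s(a, b) ::ₘ L) ↔ (a = Sum.inl u ∨ b = Sum.inl u) ∨ u ∈ sites W L := by
  simp only [mem_sites, Multiset.mem_cons, exists_eq_or_imp, Sym2.mem_iff]
  simp only [eq_comm (a := Sum.inl u)]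
  exact or_left_comm

/-- The edges of the wires `W` together with the links `L`. -/
def netEdges (W : Multiset (List (U ⊕ (I ⊕ O)))) (L : Multiset (Sym2 (U ⊕ (I ⊕ O)))) :
    Multiset (Sym2 (U ⊕ (I ⊕ O))) :=
  W.bind chain + L

theorem netEdges_endsIn {W : Multiset (List (U ⊕ (I ⊕ O)))} {L : Multiset (Sym2 (U ⊕ (I ⊕ O)))}
    {e : Sym2 (U ⊕ (I ⊕ O))} (he : e ∈ netEdges W L) : EndsIn (sites W L) e := by
  intro u hu
  rcases Multiset.mem_add.1 he with he | he
  · obtain ⟨l, hl, he⟩ := Multiset.mem_bind.1 he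
    exact .inl ⟨l, hl, mem_of_mem_chain he hu⟩
  · exact .inr ⟨e, he, hu⟩

theorem chain_endsIn {l : List (U ⊕ (I ⊕ O))} {S : Set U} (h : ∀ u, Sum.inl u ∈ l → u ∈ S)
    {e : Sym2 (U ⊕ (I ⊕ O))} (he : e ∈ chain l) : EndsIn S e :=
  fun u hu => h u (mem_of_mem_chain he hu)

theorem EndsIn.mono {S S' : Set U} (h : S ⊆ S') {e : Sym2 (U ⊕ (I ⊕ O))} (he : EndsIn S e) :
    EndsIn S' e := fun u hu => h (he u hu)

/-- The graph with wires `W` and further edges `L`. -/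
noncomputable def net (k : U → Kind 𝒱) (W : Multiset (List (U ⊕ (I ⊕ O))))
    (L : Multiset (Sym2 (U ⊕ (I ⊕ O)))) : ZXGraph 𝒱 I O :=
  drawn (sites W L) k (netEdges W L)

theorem net_realizes (k : U → Kind 𝒱) (W : Multiset (List (U ⊕ (I ⊕ O))))
    (L : Multiset (Sym2 (U ⊕ (I ⊕ O)))) : (net k W L).Realizes (sites W L) k (netEdges W L) :=
  drawn_realizes fun _ => netEdges_endsIn

variable {k : U → Kind 𝒱}

/-- A two-terminal graph that can be replaced by a wire can be removed from a wire. -/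
theorem net_remove {G : ZXGraph 𝒱 Unit Unit} (hr : Rule G wire) {W : Multiset (List (U ⊕ (I ⊕ O)))}
    {L : Multiset (Sym2 (U ⊕ (I ⊕ O)))} {l₁ l₂ : List (U ⊕ (I ⊕ O))} {m : List U}
    (i : G.V → U) (hi : Function.Injective i) (hk : ∀ v, k (i v) = G.kind v)
    (hm : ∀ u, u ∈ m ↔ ∃ v, i v = u)
    (hG : ∀ p q : U ⊕ (I ⊕ O), G.edges.map (plugEdge i (Sum.elim (fun _ => p) fun _ => q)) =
      chain (p :: m.map Sum.inl ++ [q]))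
    (h₁ : l₁ ≠ []) (h₂ : l₂ ≠ []) (hd : ∀ u ∈ m, Sum.inl u ∉ l₁ ∧ Sum.inl u ∉ l₂ ∧ u ∉ sites W L) :
    Rewrites (net k ((l₁ ++ m.map Sum.inl ++ l₂) ::ₘ W) L) (net k ((l₁ ++ l₂) ::ₘ W) L) := by
  -- The neighbours `p` and `q` of the removed segment are the points where the wires of the rule
  -- are attached.
  obtain ⟨l₁, p, rfl⟩ := (List.eq_nil_or_concat' l₁).resolve_left h₁
  obtain ⟨q, l₂, rfl⟩ := List.exists_cons_of_ne_nil h₂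
  have hnot : ∀ v, i v ∉ sites ((l₁ ++ [p] ++ q :: l₂) ::ₘ W) L := fun v => by
    have := hd (i v) ((hm _).2 ⟨v, rfl⟩)
    rw [mem_sites_cons, List.mem_append]
    tauto
  refine rewrites_of_rule hr (S₀ := sites ((l₁ ++ [p] ++ q :: l₂) ::ₘ W) L)
    (E₀ := chain (l₁ ++ [p]) + chain (q :: l₂) + netEdges W L) i Empty.elim
    (Sum.elim (fun _ => p) fun _ => q) hi (fun a => a.elim) hnot
    (fun v => v.elim) hk (fun v => v.elim) ?_ ?_ ?_ ?_ ?_ ?_ (net_realizes _ _ _)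
    (net_realizes _ _ _)
  · rintro (x | x) u hu <;> simp only [Sum.elim_inl, Sum.elim_inr] at hu <;> subst hu <;>
      simp [mem_sites_cons]
  · intro e he
    simp only [Multiset.mem_add] at he
    rcases he with (he | he) | he
    · exact chain_endsIn (fun u hu => mem_sites_cons.2 (.inl (List.mem_append_left _ hu))) he
    · exact chain_endsIn (fun u hu => mem_sites_cons.2 (.inl (List.mem_append_right _ hu))) he
    · exact (netEdges_endsIn he).mono fun u hu => mem_sites_cons.2 (.inr hu)
  · ext u
    simp only [mem_sites_cons, List.mem_append, Set.mem_union, Set.mem_range, ← hm, List.mem_map,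
      Sum.inl.injEq, exists_eq_right]
    tauto
  · ext u
    simp only [Set.mem_union, iff_self_or]
    rintro ⟨v, -⟩
    exact v.elim
  · rw [hG, netEdges, Multiset.cons_bind]
    have : chain (l₁ ++ [p] ++ m.map Sum.inl ++ q :: l₂) =
        chain (l₁ ++ [p]) + chain (p :: m.map Sum.inl ++ [q]) + chain (q :: l₂) := by
      rw [chain_append_cons, List.append_assoc, List.append_assoc,
        List.singleton_append, chain_append_cons, List.cons_append]
    rw [this, netEdges]
    abel
  · have : chain (l₁ ++ [p] ++ q :: l₂) = chain (l₁ ++ [p]) + {s(p, q)} + chain (q :: l₂) := by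
      rw [List.append_assoc, List.singleton_append, chain_append_cons, chain_cons_cons,
        ← Multiset.singleton_add, add_assoc]
    have hw : Multiset.map (plugEdge (Empty.elim : Empty → U)
        (Sum.elim (fun _ => p) fun _ => q : Unit ⊕ Unit → U ⊕ (I ⊕ O))) (wire (𝒱 := 𝒱)).edges =
        {s(p, q)} := rfl
    rw [netEdges, Multiset.cons_bind, this, netEdges]
    refine Eq.trans ?_ (congrArg _ hw.symm)
    abel

/-- Identity vertices can be removed. -/
theorem net_remove_identity {W : Multiset (List (U ⊕ (I ⊕ O)))} {L : Multiset (Sym2 (U ⊕ (I ⊕ O)))}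
    {l₁ l₂ : List (U ⊕ (I ⊕ O))} {x : U} {c : Colour} (hx : k x = node c 0 ∅)
    (h₁ : l₁ ≠ []) (h₂ : l₂ ≠ []) (hl₁ : Sum.inl x ∉ l₁) (hl₂ : Sum.inl x ∉ l₂)
    (hW : x ∉ sites W L) :
    Rewrites (net k ((l₁ ++ Sum.inl x :: l₂) ::ₘ W) L) (net k ((l₁ ++ l₂) ::ₘ W) L) := by
  have := net_remove (k := k) (Rule.identity c) (W := W) (L := L) (m := [x])
    (fun _ => x) (fun _ _ _ => rfl) (fun _ => hx) (by simp [oneStar, eq_comm]) (fun p q => ?_) h₁ h₂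
    (by simp [*])
  · simpa using this
  · change _ = s(p, Sum.inl x) ::ₘ s(Sum.inl x, q) ::ₘ 0
    rw [Sym2.eq_swap (a := Sum.inl x)]
    rfl

/-- Two consecutive `H` vertices can be removed. -/
theorem net_cancel_hadamard {W : Multiset (List (U ⊕ (I ⊕ O)))}
    {L : Multiset (Sym2 (U ⊕ (I ⊕ O)))}
    {l₁ l₂ : List (U ⊕ (I ⊕ O))} {g h : U} (hg : k g = Kind.hadamard) (hh : k h = Kind.hadamard)
    (hgh : g ≠ h) (h₁ : l₁ ≠ []) (h₂ : l₂ ≠ []) (hg₁ : Sum.inl g ∉ l₁) (hg₂ : Sum.inl g ∉ l₂)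
    (hgW : g ∉ sites W L) (hh₁ : Sum.inl h ∉ l₁) (hh₂ : Sum.inl h ∉ l₂) (hhW : h ∉ sites W L) :
    Rewrites (net k ((l₁ ++ Sum.inl g :: Sum.inl h :: l₂) ::ₘ W) L)
      (net k ((l₁ ++ l₂) ::ₘ W) L) := by
  have := net_remove (k := k) Rule.hadamardCancel (W := W) (L := L) (m := [g, h])
    ![g, h] ?_ ?_ ?_ (fun p q => ?_) h₁ h₂ (by simp [*])
  · simpa using this
  · intro a b hab
    change Fin 2 at a b
    fin_cases a <;> fin_cases b <;> first | rfl | exact absurd hab hgh | exact absurd hab.symm hgh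
  · intro v
    change Fin 2 at v
    fin_cases v <;> simp [hg, hh, twoStars]
  · intro u
    change _ ↔ ∃ v : Fin 2, _
    simp [Fin.exists_fin_two, eq_comm]
  · change _ = s(p, Sum.inl g) ::ₘ s(Sum.inl g, Sum.inl h) ::ₘ s(Sum.inl h, q) ::ₘ 0
    rw [Sym2.eq_swap (a := Sum.inl h), Multiset.cons_swap]
    rfl

end ZXGraph

namespace ZXGraph

variable {𝒱 I O U : Type} {k : U → Kind 𝒱}

/-! ### Merging spiders -/

/-- Without a loop at `x`, each edge at `x` has exactly one other endpoint, so `N` lists the legs of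
the spider `x` with multiplicity. -/
theorem exists_star {X : Type} (E : Multiset (Sym2 X)) (x : X) (hx : s(x, x) ∉ E) :
    ∃ (E₀ : Multiset (Sym2 X)) (N : Multiset X), E = E₀ + N.map (fun y => s(y, x)) ∧
      (∀ e ∈ E₀, x ∉ e) ∧ x ∉ N := by
  induction E using Multiset.induction with
  | empty => exact ⟨0, 0, by simp⟩
  | cons e E ih =>
    rw [Multiset.mem_cons, not_or] at hx
    obtain ⟨E₀, N, rfl, h₀, hN⟩ := ih hx.2
    by_cases he : x ∈ e
    · obtain ⟨y, rfl⟩ := he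
      refine ⟨E₀, y ::ₘ N, by rw [Multiset.map_cons, Sym2.eq_swap, Multiset.add_cons], h₀, ?_⟩
      rw [Multiset.mem_cons, not_or]
      exact ⟨fun h => hx.1 (by rw [← h]), hN⟩
    · refine ⟨e ::ₘ E₀, N, (Multiset.cons_add _ _ _).symm, ?_, hN⟩
      simpa [he] using h₀

theorem legs_map {V A B : Type} [Fintype A] [Fintype B] (f : A ⊕ B → V) (i : V → U)
    (att : A ⊕ B → U ⊕ (I ⊕ O)) :
    (legs f).map (plugEdge i att) =
      (Finset.univ : Finset (A ⊕ B)).val.map fun x => s(att x, Sum.inl (i (f x))) := by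
  rw [legs, Multiset.map_map]
  rfl

theorem univ_sum_map {A B X : Type} [Fintype A] [Fintype B] (g : A ⊕ B → X) :
    (Finset.univ : Finset (A ⊕ B)).val.map g =
      (Finset.univ : Finset A).val.map (fun a => g (.inl a)) +
        (Finset.univ : Finset B).val.map (fun b => g (.inr b)) := by
  change ((Finset.univ : Finset A).disjSum Finset.univ).val.map g = _
  rw [Finset.val_disjSum, Multiset.disjSum, Multiset.map_add, Multiset.map_map, Multiset.map_map]
  rfl

theorem univ_fin_map_get {X Y : Type} (l : List X) (g : X → Y) :
    (Finset.univ : Finset (Fin l.length)).val.map (fun a => g (l.get a)) =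
      (l : Multiset X).map g := by
  rw [Fin.univ_val_map, Multiset.map_coe]
  congr 1
  conv_rhs => rw [← List.ofFn_get l, List.map_ofFn]
  rfl

/-- Replace the vertex `b` by `a`. -/
noncomputable def merge (a b : U) (u : U) : U := if u = b then a else u

theorem mapEdge_merge_of_notMem {a b : U} {e : Sym2 (U ⊕ (I ⊕ O))} (h : Sum.inl b ∉ e) :
    mapEdge (merge a b) e = e := by
  refine (Sym2.map_congr fun x hx => ?_).trans (Sym2.map_id' ▸ rfl : Sym2.map id e = e)
  rcases x with x | x
  · have : x ≠ b := fun h' => h (h' ▸ hx)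
    simp [merge, this]
  · rfl

/-- The spider rule for phase-free spiders. All legs in the rule end in the context, so a second
edge between `a` and `b` and loops at either have to be excluded. The fused spider keeps the name
`a`. -/
theorem rewrites_merge {c : Colour} {S S' : Set U} {E E' : Multiset (Sym2 (U ⊕ (I ⊕ O)))} {a b : U}
    (ha : k a = node c 0 ∅) (hb : k b = node c 0 ∅) (hab : a ≠ b) (haS : a ∈ S) (hbS : b ∈ S)
    (hE : ∀ e ∈ E, EndsIn S e) (h₁ : s(Sum.inl a, Sum.inl b) ∉ E)
    (h₂ : s(Sum.inl a, Sum.inl a) ∉ E) (h₃ : s(Sum.inl b, Sum.inl b) ∉ E)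
    (hS' : S' = S \ {b}) (hE' : E' = E.map (mapEdge (merge a b)))
    {D D' : ZXGraph 𝒱 I O} (hD : D.Realizes S k (s(Sum.inl a, Sum.inl b) ::ₘ E))
    (hD' : D'.Realizes S' k E') : Rewrites D D' := by
  -- The legs of `a` are split off first and those of `b` from the rest, so that `E₀` touches
  -- neither spider.
  obtain ⟨E₁, N, rfl, hE₁, hN⟩ := exists_star E (Sum.inl a) h₂
  obtain ⟨E₀, M, rfl, hE₀, hM⟩ := exists_star E₁ (Sum.inl b)
    fun h => h₃ (Multiset.mem_add.2 (.inl h))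
  have hbN : Sum.inl b ∉ N := fun h => h₁ <| by
    rw [Sym2.eq_swap]
    exact Multiset.mem_add.2 (.inr (Multiset.mem_map.2 ⟨_, h, rfl⟩))
  have haM : Sum.inl a ∉ M := fun h => hE₁ s(Sum.inl a, Sum.inl b)
    (Multiset.mem_add.2 (.inr (Multiset.mem_map.2 ⟨_, h, rfl⟩))) (by simp)
  have haE₀ : ∀ e ∈ E₀, Sum.inl a ∉ e := fun e he => hE₁ e (Multiset.mem_add.2 (.inl he))
  clear h₁ h₂ h₃ hE₁
  -- Choosing an order on the legs makes `Fin N.length` and `Fin M.length` available as boundary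
  -- types for the rule.
  induction N using Quotient.inductionOn with | _ N
  induction M using Quotient.inductionOn with | _ M
  simp only [Multiset.quot_mk_to_coe, Multiset.mem_coe] at *
  have hNS : ∀ y ∈ N, ∀ u, y = Sum.inl u → u ∈ S := fun y hy u hu =>
    (endsIn_mk.1 (hE s(y, Sum.inl a) (Multiset.mem_add.2 (.inr
      (Multiset.mem_map.2 ⟨_, hy, rfl⟩))))).1 u hu
  have hMS : ∀ y ∈ M, ∀ u, y = Sum.inl u → u ∈ S := fun y hy u hu =>
    (endsIn_mk.1 (hE s(y, Sum.inl b) (Multiset.mem_add.2 (.inl (Multiset.mem_add.2 (.inr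
      (Multiset.mem_map.2 ⟨_, hy, rfl⟩))))))).1 u hu
  have hr := Rule.spider (Fin N.length) (Fin M.length) c 0 0 (∅ : Finset 𝒱)
  rw [add_zero] at hr
  refine rewrites_of_rule hr (S₀ := S \ {a, b}) (E₀ := E₀) ![a, b] (fun _ => a)
    (Sum.elim N.get M.get) ?_ (fun _ _ _ => rfl) ?_ ?_ ?_ ?_ ?_ ?_ ?_ ?_ ?_ ?_ hD hD'
  · intro x y hxy
    change Fin 2 at x y
    fin_cases x <;> fin_cases y <;> first | rfl | exact absurd hxy hab | exact absurd hxy.symm hab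
  · intro x
    change Fin 2 at x
    fin_cases x <;> simp
  · simp
  · intro x
    change Fin 2 at x
    fin_cases x <;> simp [twoStars, ha, hb]
  · intro x
    exact ha
  · have aux : ∀ u ∈ S, u ≠ a → u ≠ b → u ∈ S \ {a, b} := fun u hu h h' => by simp [hu, h, h']
    rintro (x | x) u hu
    · have hx : Sum.inl u ∈ N := by rw [← hu]; exact List.get_mem _ _
      exact aux u (hNS _ hx u rfl) (fun h => hN (h ▸ hx)) (fun h => hbN (h ▸ hx))
    · have hx : Sum.inl u ∈ M := by rw [← hu]; exact List.get_mem _ _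
      exact aux u (hMS _ hx u rfl) (fun h => haM (h ▸ hx)) (fun h => hM (h ▸ hx))
  · intro e he u hu
    refine ⟨hE e (by simp [he]) u hu, ?_⟩
    rintro (rfl | rfl)
    exacts [haE₀ e he hu, hE₀ e he hu]
  · ext u
    change _ ↔ _ ∨ ∃ v : Fin 2, _
    rw [Fin.exists_fin_two]
    constructor
    · intro hu
      by_cases h : u = a
      · exact .inr (.inl h.symm)
      by_cases h' : u = b
      · exact .inr (.inr h'.symm)
      exact .inl ⟨hu, by simp [h, h']⟩
    · rintro (h | rfl | rfl)
      exacts [h.1, haS, hbS]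
  · rw [hS']
    ext u
    constructor
    · rintro ⟨hu, h'⟩
      by_cases h : u = a
      · exact .inr ⟨(), h.symm⟩
      exact .inl ⟨hu, by rintro (rfl | rfl) <;> simp_all⟩
    · rintro (h | ⟨-, rfl⟩)
      exacts [⟨h.1, fun h' => h.2 (.inr h')⟩, ⟨haS, hab⟩]
  · simp only [twoStars, Multiset.map_add]
    rw [legs_map, univ_sum_map]
    simp only [Sum.elim_inl, Sum.elim_inr, Matrix.cons_val_zero, Matrix.cons_val_one]
    rw [univ_fin_map_get N fun y => s(y, Sum.inl a), univ_fin_map_get M fun y => s(y, Sum.inl b)]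
    rw [← Multiset.singleton_add]
    have : Multiset.map (plugEdge (![a, b] : Fin 2 → U) (Sum.elim N.get M.get))
      (Multiset.replicate 1 s(Sum.inl 0, Sum.inl 1)) = {s(Sum.inl a, Sum.inl b)} := rfl
    rw [this]
    abel
  · rw [hE']
    simp only [oneStar, Multiset.map_add]
    rw [legs_map, univ_sum_map]
    simp only [Sum.elim_inl, Sum.elim_inr]
    rw [univ_fin_map_get N fun y => s(y, Sum.inl a), univ_fin_map_get M fun y => s(y, Sum.inl a)]
    have e₀ : E₀.map (mapEdge (merge a b)) = E₀ := by
      refine (Multiset.map_congr rfl fun e he => ?_).trans (Multiset.map_id _)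
      exact mapEdge_merge_of_notMem (hE₀ e he)
    have hfix : ∀ y : U ⊕ (I ⊕ O), y ≠ Sum.inl b → Sum.map (merge a b) id y = y := by
      rintro (y | y) hy
      · have : y ≠ b := fun h => hy (h ▸ rfl)
        simp [merge, this]
      · rfl
    rw [e₀, Multiset.map_map, Multiset.map_map]
    have eN : (N : Multiset (U ⊕ (I ⊕ O))).map (mapEdge (merge a b) ∘ fun y => s(y, Sum.inl a)) =
        (N : Multiset _).map fun y => s(y, Sum.inl a) :=
      Multiset.map_congr rfl fun y hy => by
        have h1 := hfix y fun h => hbN (h ▸ hy)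
        have h2 := hfix (Sum.inl a) fun h => hab (Sum.inl_injective h)
        simp only [Function.comp, mapEdge, Sym2.map_mk]
        rw [h1, h2]
    have eM : (M : Multiset (U ⊕ (I ⊕ O))).map (mapEdge (merge a b) ∘ fun y => s(y, Sum.inl b)) =
        (M : Multiset _).map fun y => s(y, Sum.inl a) :=
      Multiset.map_congr rfl fun y hy => by
        have h1 := hfix y fun h => hM (h ▸ hy)
        simp only [Function.comp, mapEdge, Sym2.map_mk]
        rw [h1]
        simp [merge]
    rw [eN, eM]
    abel

/-- Merging two consecutive spiders on a wire. -/
theorem net_merge {c : Colour} {W : Multiset (List (U ⊕ (I ⊕ O)))}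
    {L : Multiset (Sym2 (U ⊕ (I ⊕ O)))} {l₁ l₂ : List (U ⊕ (I ⊕ O))} {a b : U}
    (ha : k a = node c 0 ∅) (hb : k b = node c 0 ∅) (hab : a ≠ b)
    (ha₁ : Sum.inl a ∉ l₁) (ha₂ : Sum.inl a ∉ l₂) (haW : ∀ l ∈ W, Sum.inl a ∉ l)
    (hb₁ : Sum.inl b ∉ l₁) (hb₂ : Sum.inl b ∉ l₂) (hbW : ∀ l ∈ W, Sum.inl b ∉ l)
    (hL : s(Sum.inl a, Sum.inl a) ∉ L.map (mapEdge (merge a b))) :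
    Rewrites (net k ((l₁ ++ Sum.inl a :: Sum.inl b :: l₂) ::ₘ W) L)
      (net k ((l₁ ++ Sum.inl a :: l₂) ::ₘ W) (L.map (mapEdge (merge a b)))) := by
  -- A link joining `a` to `a`, `a` to `b` or `b` to `b` would become a loop at `a`, so the one
  -- hypothesis `hL` excludes all three.
  have hL' : ∀ e ∈ L, mapEdge (merge a b) e ≠ s(Sum.inl a, Sum.inl a) := fun e he h =>
    hL (Multiset.mem_map.2 ⟨e, he, h⟩)
  have hE : netEdges ((l₁ ++ Sum.inl a :: Sum.inl b :: l₂) ::ₘ W) L = s(Sum.inl a, Sum.inl b) ::ₘ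
      (chain (l₁ ++ [Sum.inl a]) + chain (Sum.inl b :: l₂) + netEdges W L) := by
    rw [netEdges, Multiset.cons_bind, chain_append_cons, chain_cons_cons, netEdges,
      ← Multiset.singleton_add, ← Multiset.singleton_add]
    abel
  have hnot : ∀ x y : U, (x = a ∨ x = b) → (y = a ∨ y = b) →
      s(Sum.inl x, Sum.inl y) ∉
        chain (l₁ ++ [Sum.inl a]) + chain (Sum.inl b :: l₂) + netEdges W L := by
    intro x y hx hy h
    simp only [Multiset.mem_add, netEdges, Multiset.mem_bind] at h
    rcases h with (h | h) | ⟨l, hl, h⟩ | h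
    · have hb' : Sum.inl b ∉ l₁ ++ [Sum.inl a] := by simp [hb₁, hab.symm]
      have h1 := mem_of_mem_chain h (x := Sum.inl x) (by simp)
      have h2 := mem_of_mem_chain h (x := Sum.inl y) (by simp)
      rcases hx with rfl | rfl
      · rcases hy with rfl | rfl
        · rcases List.eq_nil_or_concat' l₁ with rfl | ⟨l₁, p, rfl⟩
          · simp at h
          · rw [List.append_assoc, List.singleton_append, chain_append_cons, chain_cons_cons] at h
            simp only [chain_singleton, Multiset.mem_add, Multiset.mem_cons,
              Multiset.notMem_zero, or_false] at h
            rcases h with h | h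
            · exact ha₁ (mem_of_mem_chain h (by simp))
            · rw [Sym2.eq_iff] at h
              rcases h with ⟨h, -⟩ | ⟨-, h⟩ <;> simp [h] at ha₁
        · exact hb' h2
      · exact hb' h1
    · have ha' : Sum.inl a ∉ Sum.inl b :: l₂ := by simp [ha₂, hab]
      have h1 := mem_of_mem_chain h (x := Sum.inl x) (by simp)
      have h2 := mem_of_mem_chain h (x := Sum.inl y) (by simp)
      rcases hx with rfl | rfl
      · exact ha' h1
      · rcases hy with rfl | rfl
        · exact ha' h2
        · cases l₂ with
          | nil => simp at h
          | cons q l₂ =>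
            rw [chain_cons_cons, Multiset.mem_cons] at h
            rcases h with h | h
            · rw [Sym2.eq_iff] at h
              rcases h with ⟨-, h⟩ | ⟨h, -⟩ <;> simp [h] at hb₂
            · exact hb₂ (mem_of_mem_chain h (by simp))
    · have h1 := mem_of_mem_chain h (x := Sum.inl x) (by simp)
      rcases hx with rfl | rfl
      exacts [haW l hl h1, hbW l hl h1]
    · refine hL' _ h ?_
      rcases hx with rfl | rfl <;> rcases hy with rfl | rfl <;> simp [mapEdge, merge]
  have hmapchain : ∀ l : List (U ⊕ (I ⊕ O)), Sum.inl b ∉ l →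
      (chain l).map (mapEdge (merge a b)) = chain l := fun l hl =>
    (Multiset.map_congr rfl fun e he => mapEdge_merge_of_notMem fun h =>
      hl (mem_of_mem_chain he h)).trans (Multiset.map_id _)
  have hfix : l₂.map (Sum.map (merge a b) id) = l₂ := by
    refine (List.map_congr_left fun y hy => ?_).trans (List.map_id _)
    rcases y with y | y
    · have : y ≠ b := fun h => hb₂ (h ▸ hy)
      simp [merge, this]
    · rfl
  refine rewrites_merge ha hb hab ?_ ?_ ?_ (hnot a b (.inl rfl) (.inr rfl))
    (hnot a a (.inl rfl) (.inl rfl)) (hnot b b (.inr rfl) (.inr rfl)) ?_ ?_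
    (hE ▸ net_realizes _ _ _) (net_realizes _ _ _)
  · simp [mem_sites_cons]
  · simp [mem_sites_cons]
  · intro e he
    exact netEdges_endsIn (hE ▸ Multiset.mem_cons_of_mem he)
  · ext u
    simp only [Set.mem_sdiff, Set.mem_singleton_iff, mem_sites, Multiset.mem_cons,
      exists_eq_or_imp, List.mem_append, List.mem_cons, Sum.inl.injEq, Multiset.mem_map,
      exists_exists_and_eq_and]
    have hmem : ∀ e ∈ L, Sum.inl u ∈ mapEdge (merge a b) e ↔
        u ≠ b ∧ Sum.inl u ∈ e ∨ u = a ∧ Sum.inl b ∈ e := by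
      intro e _
      simp only [mapEdge, Sym2.mem_map, Sum.exists, Sum.map_inl, Sum.inl.injEq, Sum.map_inr,
        reduceCtorEq, and_false, exists_false, or_false, merge]
      constructor
      · rintro ⟨v, hv, h⟩
        split_ifs at h with h'
        · subst h' h; exact .inr ⟨rfl, hv⟩
        · subst h; exact .inl ⟨h', hv⟩
      · rintro (⟨h, hu⟩ | ⟨rfl, hb⟩)
        · exact ⟨u, hu, if_neg h⟩
        · exact ⟨b, hb, if_pos rfl⟩
    constructor
    · rintro ((h | ⟨l, hl, h⟩) | ⟨e, he, h⟩)
      · refine ⟨by tauto, ?_⟩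
        rintro rfl
        rcases h with h | h | h
        exacts [hb₁ h, hab h.symm, hb₂ h]
      · exact ⟨.inl (.inr ⟨l, hl, h⟩), fun h' => hbW l hl (h' ▸ h)⟩
      · rcases (hmem e he).1 h with ⟨h1, h2⟩ | ⟨rfl, h2⟩
        · exact ⟨.inr ⟨e, he, h2⟩, h1⟩
        · exact ⟨.inl (.inl (.inr (.inl rfl))), hab⟩
    · rintro ⟨(h | ⟨l, hl, h⟩) | ⟨e, he, h⟩, hub⟩
      · exact .inl (.inl (by tauto))
      · exact .inl (.inr ⟨l, hl, h⟩)
      · exact .inr ⟨e, he, (hmem e he).2 (.inl ⟨hub, h⟩)⟩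
  · rw [netEdges, Multiset.cons_bind, chain_append_cons]
    simp only [Multiset.map_add, netEdges]
    rw [hmapchain (l₁ ++ [Sum.inl a]) (by simp [hb₁, hab.symm])]
    have : (chain (Sum.inl b :: l₂)).map (mapEdge (merge a b)) = chain (Sum.inl a :: l₂) := by
      rw [mapEdge, chain_map, List.map_cons, hfix]
      simp [merge]
    rw [this, Multiset.map_bind, Multiset.bind_congr fun l hl => hmapchain l (hbW l hl)]
    abel

end ZXGraph

namespace ZXGraph

variable {𝒱 I O U : Type} {k : U → Kind 𝒱}

/-! ### Exchanging colours -/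

/-- An `X` vertex between two `H` vertices on a wire is a `Z` vertex, if an `H` vertex is inserted
in its link. -/
theorem net_change_colour {W : Multiset (List (U ⊕ (I ⊕ O)))} {L : Multiset (Sym2 (U ⊕ (I ⊕ O)))}
    {l₁ l₂ : List (U ⊕ (I ⊕ O))} {z : U ⊕ (I ⊕ O)} {p x q g h₁ h₂ h : U}
    (hx : k x = node .X 0 ∅) (hg : k g = node .Z 0 ∅) (hp : k p = .hadamard) (hq : k q = .hadamard)
    (hh₁ : k h₁ = .hadamard) (hh₂ : k h₂ = .hadamard) (hh : k h = .hadamard)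
    (hnd : [p, x, q, g, h₁, h₂, h].Nodup)
    (hd : ∀ u ∈ [p, x, q, g, h₁, h₂, h], Sum.inl u ∉ l₁ ∧ Sum.inl u ∉ l₂ ∧ Sum.inl u ≠ z ∧
      u ∉ sites W L) (hl₁ : l₁ ≠ []) (hl₂ : l₂ ≠ []) :
    Rewrites (net k ((l₁ ++ Sum.inl p :: Sum.inl x :: Sum.inl q :: l₂) ::ₘ W)
        (s(z, Sum.inl x) ::ₘ L))
      (net k ((l₁ ++ Sum.inl g :: l₂) ::ₘ W)
        (s(Sum.inl g, Sum.inl h) ::ₘ s(Sum.inl h, z) ::ₘ L)) := by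
  simp only [List.nodup_cons, List.mem_cons, List.not_mem_nil, or_false, not_or, not_false_eq_true,
    List.nodup_nil, and_true] at hnd hd
  -- With an `H` on each of its three legs, the `Z` spider `g` equals the `X` spider `x`. Two of
  -- these `H` vertices will cancel against `p` and `q`; the third remains in the link.
  have step : Rewrites
      (net k ((l₁ ++ Sum.inl p :: Sum.inl h₁ :: Sum.inl g :: Sum.inl h₂ :: Sum.inl q :: l₂) ::ₘ W)
        (s(Sum.inl g, Sum.inl h) ::ₘ s(Sum.inl h, z) ::ₘ L))
      (net k ((l₁ ++ Sum.inl p :: Sum.inl x :: Sum.inl q :: l₂) ::ₘ W)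
        (s(z, Sum.inl x) ::ₘ L)) := by
    refine rewrites_of_rule
      (Rule.hadamardCommute (Unit ⊕ Unit) Unit .Z 0 (∅ : Finset 𝒱))
      (S₀ := sites ((l₁ ++ Sum.inl p :: Sum.inl q :: l₂) ::ₘ [z] ::ₘ W) L)
      (E₀ := chain (l₁ ++ [Sum.inl p]) + chain (Sum.inl q :: l₂) + netEdges W L)
      (Sum.elim (fun _ => g) (Sum.elim (Sum.elim (fun _ => h₁) fun _ => h₂) fun _ => h))
      (fun _ => x)
      (Sum.elim (Sum.elim (fun _ => Sum.inl p) fun _ => Sum.inl q) fun _ => z)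
      ?_ (fun _ _ _ => rfl) ?_ ?_ ?_ ?_ ?_ ?_ ?_ ?_ ?_ ?_ (net_realizes _ _ _)
      (net_realizes _ _ _)
    · rintro (a | (a | a) | a) (b | (b | b) | b) hab <;>
        simp only [Sum.elim_inl, Sum.elim_inr] at hab <;> first | rfl | (exfalso; grind)
    · rintro (a | (a | a) | a) <;>
        simp only [Sum.elim_inl, Sum.elim_inr, mem_sites_cons, List.mem_append, List.mem_cons,
          Sum.inl.injEq, List.not_mem_nil, or_false] <;> grind
    · intro a
      simp only [mem_sites_cons, List.mem_append, List.mem_cons,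
          Sum.inl.injEq, List.not_mem_nil, or_false]
      grind
    · rintro (a | (a | a) | a)
      exacts [hg, hh₁, hh₂, hh]
    · intro a
      exact hx
    · rintro ((a | a) | a) u hu <;> simp only [Sum.elim_inl, Sum.elim_inr] at hu <;>
        simp only [mem_sites_cons, List.mem_append, List.mem_cons, hu, true_or, or_true]
    · intro e he
      simp only [Multiset.mem_add] at he
      rcases he with (he | he) | he
      · refine chain_endsIn (fun u hu => mem_sites_cons.2 (.inl ?_)) he
        simp only [List.mem_append, List.mem_cons, List.not_mem_nil, or_false] at hu ⊢
        tauto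
      · refine chain_endsIn (fun u hu => mem_sites_cons.2 (.inl ?_)) he
        simp only [List.mem_append, List.mem_cons] at hu ⊢
        tauto
      · exact (netEdges_endsIn he).mono fun u hu =>
          mem_sites_cons.2 (.inr (mem_sites_cons.2 (.inr hu)))
    · ext u
      change _ ↔ _ ∨ ∃ v : Unit ⊕ ((Unit ⊕ Unit) ⊕ Unit), _
      simp only [mem_sites_cons, mem_sites_link, List.mem_append, List.mem_cons, Sum.inl.injEq,
        Sum.exists, Sum.elim_inl, Sum.elim_inr, exists_const, List.not_mem_nil, or_false]
      grind
    · ext u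
      change _ ↔ _ ∨ ∃ v : Unit, _
      simp only [mem_sites_cons, mem_sites_link, List.mem_append, List.mem_cons, Sum.inl.injEq,
        exists_const, List.not_mem_nil, or_false]
      grind
    · have hc : chain
          (l₁ ++ Sum.inl p :: Sum.inl h₁ :: Sum.inl g :: Sum.inl h₂ :: Sum.inl q :: l₂) =
          chain (l₁ ++ [Sum.inl p]) + chain [Sum.inl p, Sum.inl h₁, Sum.inl g, Sum.inl h₂, Sum.inl q]
            + chain (Sum.inl q :: l₂) := by
        rw [chain_append_cons, add_assoc]
        exact congrArg _ (chain_append_cons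
          [Sum.inl p, Sum.inl h₁, Sum.inl g, Sum.inl h₂] l₂ (Sum.inl q))
      rw [netEdges, Multiset.cons_bind, hc, netEdges]
      have : ((hadamardStar (Unit ⊕ Unit) Unit (node .Z 0 (∅ : Finset 𝒱))).edges.map
          (plugEdge (Sum.elim (fun _ => g) (Sum.elim (Sum.elim (fun _ => h₁) fun _ => h₂) fun _ => h))
            (Sum.elim (Sum.elim (fun _ => Sum.inl p) fun _ => Sum.inl q) fun _ => z))
            : Multiset (Sym2 (U ⊕ (I ⊕ O)))) =
          {s(Sum.inl g, Sum.inl h₁), s(Sum.inl g, Sum.inl h₂), s(Sum.inl g, Sum.inl h)} +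
          {s(Sum.inl p, Sum.inl h₁), s(Sum.inl q, Sum.inl h₂), s(z, Sum.inl h)} := rfl
      refine Eq.trans ?_ (congrArg _ this.symm)
      rw [chain_cons_cons, chain_cons_cons, chain_cons_cons, chain_cons_cons, chain_singleton,
        Sym2.eq_swap (a := Sum.inl h₁), Sym2.eq_swap (a := Sum.inl h₂) (b := Sum.inl q),
        Sym2.eq_swap (a := Sum.inl h)]
      simp only [← Multiset.singleton_add, Multiset.insert_eq_cons]
      abel
    · have hc : chain (l₁ ++ Sum.inl p :: Sum.inl x :: Sum.inl q :: l₂) =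
          chain (l₁ ++ [Sum.inl p]) + chain [Sum.inl p, Sum.inl x, Sum.inl q]
            + chain (Sum.inl q :: l₂) := by
        rw [chain_append_cons, add_assoc]
        exact congrArg _ (chain_append_cons [Sum.inl p, Sum.inl x] l₂ (Sum.inl q))
      rw [netEdges, Multiset.cons_bind, hc, netEdges]
      have : ((oneStar (Unit ⊕ Unit) Unit (node Colour.Z.other 0 (∅ : Finset 𝒱))).edges.map
          (plugEdge (fun _ => x)
            (Sum.elim (Sum.elim (fun _ => Sum.inl p) fun _ => Sum.inl q) fun _ => z))
            : Multiset (Sym2 (U ⊕ (I ⊕ O)))) =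
          {s(Sum.inl p, Sum.inl x), s(Sum.inl q, Sum.inl x), s(z, Sum.inl x)} := rfl
      refine Eq.trans ?_ (congrArg _ this.symm)
      rw [chain_cons_cons, chain_cons_cons, chain_singleton,
        Sym2.eq_swap (a := Sum.inl x) (b := Sum.inl q)]
      simp only [← Multiset.singleton_add, Multiset.insert_eq_cons]
      abel
  refine step.symm'.trans' ((net_cancel_hadamard hp hh₁ ?_ hl₁ (by simp) ?_ ?_ ?_ ?_ ?_ ?_).trans' ?_)
  any_goals first | grind | (simp only [mem_sites_link, Sum.inl.injEq]; grind)
  have := net_cancel_hadamard (k := k) (l₁ := l₁ ++ [Sum.inl g]) (l₂ := l₂) (W := W)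
    (L := s(Sum.inl g, Sum.inl h) ::ₘ s(Sum.inl h, z) ::ₘ L) hh₂ hq ?_ (by simp) hl₂ ?_ ?_ ?_ ?_ ?_ ?_
  · simpa using this
  all_goals first
    | grind
    | (simp only [mem_sites_link, Sum.inl.injEq]
       grind)

/-! ### Processing whole wires -/

/-- Remove all identity vertices from a wire. -/
theorem net_filter {W : Multiset (List (U ⊕ (I ⊕ O)))} {L : Multiset (Sym2 (U ⊕ (I ⊕ O)))}
    {P : U ⊕ (I ⊕ O) → Prop} {l₁ l₂ : List (U ⊕ (I ⊕ O))} (hl₁ : l₁ ≠ [])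
    (hlast : ∀ x ∈ l₂.getLast?, P x) (hnd : l₂.Nodup)
    (h : ∀ x ∈ l₂, ¬ P x → ∃ u c, x = Sum.inl u ∧ k u = node c 0 ∅ ∧ u ∉ sites W L ∧ x ∉ l₁) :
    Rewrites (net k ((l₁ ++ l₂) ::ₘ W) L) (net k ((l₁ ++ l₂.filter P) ::ₘ W) L) := by
  induction l₂ generalizing l₁ with
  | nil => exact Iso.rewrites ((net_realizes k _ L).iso (net_realizes _ _ _) fun _ _ => rfl)
  | cons x l₂ ih =>
    have hlast' : ∀ y ∈ l₂.getLast?, P y := fun y hy => hlast y (by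
      rw [List.getLast?_cons]; simp_all)
    rw [List.nodup_cons] at hnd
    by_cases hx : P x
    · have := ih (l₁ := l₁ ++ [x]) (by simp) hlast' hnd.2 fun y hy hPy => by
        obtain ⟨u, c, h1, h2, h3, h4⟩ := h y (by simp [hy]) hPy
        refine ⟨u, c, h1, h2, h3, ?_⟩
        rw [List.mem_append, not_or, List.mem_singleton]
        exact ⟨h4, fun h' => hPy (h' ▸ hx)⟩
      simpa [hx] using this
    · obtain ⟨u, c, rfl, h2, h3, h4⟩ := h x (by simp) hx
      -- The last vertex is kept, so a removed vertex always has a right neighbour.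
      have hne : l₂ ≠ [] := by
        rintro rfl
        exact hx (hlast _ (by simp))
      have := ih hl₁ hlast' hnd.2 fun y hy => h y (by simp [hy])
      rw [List.filter_cons_of_neg (by simpa using hx)]
      exact (net_remove_identity h2 hl₁ hne h4 hnd.1 h3).trans' this

/-- Merge consecutive spiders into the first one. -/
theorem net_merge_list {c : Colour} {W : Multiset (List (U ⊕ (I ⊕ O)))}
    {L : Multiset (Sym2 (U ⊕ (I ⊕ O)))} {l₁ l₂ : List (U ⊕ (I ⊕ O))} {a : U} {m : List U}
    (hk : ∀ b ∈ a :: m, k b = node c 0 ∅) (hnd : (a :: m).Nodup)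
    (h₁ : ∀ b ∈ a :: m, Sum.inl b ∉ l₁) (h₂ : ∀ b ∈ a :: m, Sum.inl b ∉ l₂)
    (hW : ∀ b ∈ a :: m, ∀ l ∈ W, Sum.inl b ∉ l)
    (hL : s(Sum.inl a, Sum.inl a) ∉ L.map (mapEdge fun u => if u ∈ m then a else u)) :
    Rewrites (net k ((l₁ ++ Sum.inl a :: (m.map Sum.inl ++ l₂)) ::ₘ W) L)
      (net k ((l₁ ++ Sum.inl a :: l₂) ::ₘ W)
        (L.map (mapEdge fun u => if u ∈ m then a else u))) := by
  induction m generalizing L with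
  | nil =>
    have : (mapEdge fun u => if u ∈ ([] : List U) then a else u) =
        (id : Sym2 (U ⊕ (I ⊕ O)) → _) := by
      funext e
      induction e with | _ x y
      rcases x with x | x <;> rcases y with y | y <;> simp [mapEdge]
    rw [this, Multiset.map_id]
    exact Iso.rewrites ((net_realizes k _ L).iso (net_realizes _ _ _) fun _ _ => rfl)
  | cons b m ih =>
    simp only [List.forall_mem_cons] at hk h₁ h₂ hW ih
    simp only [List.nodup_cons, List.mem_cons, not_or] at hnd ih hL ⊢
    have hcomp : (L.map (mapEdge (merge a b))).map (mapEdge fun u => if u ∈ m then a else u) =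
        L.map (mapEdge fun u => if u = b ∨ u ∈ m then a else u) := by
      rw [Multiset.map_map]
      refine Multiset.map_congr rfl fun e _ => ?_
      simp only [mapEdge, Function.comp]
      rw [Sym2.map_map]
      congr 1
      funext x
      rcases x with x | x
      · simp only [Function.comp, Sum.map_inl, merge]
        by_cases hxb : x = b <;> simp [hxb, hnd]
      · rfl
    have hL' : s(Sum.inl a, Sum.inl a) ∉ L.map (mapEdge (merge a b)) := fun h => by
      refine hL ?_
      rw [← hcomp]
      exact Multiset.mem_map.2 ⟨_, h, by simp [mapEdge]⟩
    refine (net_merge hk.1 hk.2.1 hnd.1.1 h₁.1 ?_ hW.1 h₁.2.1 ?_ hW.2.1 hL').trans' ?_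
    · simp [hnd.1.2, h₂.1]
    · simp [hnd.2.1, h₂.2.1]
    · rw [← hcomp]
      exact ih ⟨hk.1, hk.2.2⟩ ⟨hnd.1.2, hnd.2.2⟩ ⟨h₁.1, h₁.2.2⟩ ⟨h₂.1, h₂.2.2⟩
        ⟨hW.1, hW.2.2⟩ (by rw [hcomp]; exact hL)

/-- Rewrite the wires one after the other. -/
theorem net_all_wires {Q : Type} [Fintype Q] {w w' : Q → List (U ⊕ (I ⊕ O))}
    (L : Finset Q → Multiset (Sym2 (U ⊕ (I ⊕ O)))) (home : U ⊕ (I ⊕ O) → Q)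
    (hw : ∀ q, ∀ x ∈ w q, home x = q) (hw' : ∀ q, ∀ x ∈ w' q, home x = q)
    (h : ∀ q T W, q ∉ T → (∀ l ∈ W, ∀ x ∈ l, home x ≠ q) →
      Rewrites (net k (w q ::ₘ W) (L T)) (net k (w' q ::ₘ W) (L (insert q T)))) :
    Rewrites (net k ((Finset.univ : Finset Q).val.map w) (L ∅))
      (net k ((Finset.univ : Finset Q).val.map w') (L Finset.univ)) := by
  -- The wires in `T` have been rewritten, the others not yet. Since `home` tells wires apart, the
  -- wire treated next shares no vertex with the rest.
  let mix : Finset Q → Q → List (U ⊕ (I ⊕ O)) := fun T q => if q ∈ T then w' q else w q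
  have hmix : ∀ T q, ∀ x ∈ mix T q, home x = q := fun T q x hx => by
    simp only [mix] at hx
    split_ifs at hx
    exacts [hw' q x hx, hw q x hx]
  have key : ∀ T : Finset Q, Rewrites (net k ((Finset.univ : Finset Q).val.map w) (L ∅))
      (net k ((Finset.univ : Finset Q).val.map (mix T)) (L T)) := by
    intro T
    induction T using Finset.induction with
    | empty =>
      have : mix ∅ = w := by funext q; simp [mix]
      rw [this]
      exact Relation.EqvGen.refl _
    | insert q T hq ih =>
      refine ih.trans' ?_
      have hu : (Finset.univ : Finset Q).val = q ::ₘ (Finset.univ.erase q).val := by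
        rw [Finset.erase_val, Multiset.cons_erase (Finset.mem_univ_val q)]
      have h1 : mix T q = w q := if_neg hq
      have h2 : mix (insert q T) q = w' q := if_pos (Finset.mem_insert_self q T)
      have h3 : (Finset.univ.erase q).val.map (mix (insert q T)) =
          (Finset.univ.erase q).val.map (mix T) := by
        refine Multiset.map_congr rfl fun r hr => ?_
        have hrq : r ≠ q := Finset.ne_of_mem_erase hr
        simp [mix, hrq]
      rw [hu, Multiset.map_cons, Multiset.map_cons, h1, h2, h3]
      refine h q T _ hq fun l hl x hx => ?_
      obtain ⟨r, hr, rfl⟩ := Multiset.mem_map.1 hl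
      rw [hmix T r x hx]
      exact Finset.ne_of_mem_erase hr
  have := key Finset.univ
  have hfull : mix Finset.univ = w' := by funext q; simp [mix]
  rwa [hfull] at this

end ZXGraph

/-! ### Merging spiders on all wires -/

namespace ZXGraph

variable {𝒱 I O U : Type} {k : U → Kind 𝒱}

/-- Merge the spiders `m q` on each wire into the preceding spider `a q`. -/
theorem net_merge_all {Q : Type} [Fintype Q] {c : Colour} {L : Multiset (Sym2 (U ⊕ (I ⊕ O)))}
    {pre post : Q → List (U ⊕ (I ⊕ O))} {a : Q → U} {m : Q → List U} (ρ : U → U)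
    (home : U ⊕ (I ⊕ O) → Q)
    (hpre : ∀ q, ∀ x ∈ pre q, home x = q) (hpost : ∀ q, ∀ x ∈ post q, home x = q)
    (ha : ∀ q, home (Sum.inl (a q)) = q) (hm : ∀ q, ∀ u ∈ m q, home (Sum.inl u) = q)
    (hρ : ∀ q, ∀ u ∈ m q, ρ u = a q) (hρ' : ∀ u, (∀ q, u ∉ m q) → ρ u = u)
    (hk : ∀ q, ∀ b ∈ a q :: m q, k b = node c 0 ∅) (hnd : ∀ q, (a q :: m q).Nodup)
    (h₁ : ∀ q, ∀ b ∈ a q :: m q, Sum.inl b ∉ pre q)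
    (h₂ : ∀ q, ∀ b ∈ a q :: m q, Sum.inl b ∉ post q)
    (hL : ∀ q, s(Sum.inl (a q), Sum.inl (a q)) ∉ L.map (mapEdge ρ)) :
    Rewrites (net k ((Finset.univ : Finset Q).val.map fun q =>
        pre q ++ Sum.inl (a q) :: ((m q).map Sum.inl ++ post q)) L)
      (net k ((Finset.univ : Finset Q).val.map fun q => pre q ++ Sum.inl (a q) :: post q)
        (L.map (mapEdge ρ))) := by
  -- The substitution `ρ`, carried out only on the wires in `T`.
  let ρ' : Finset Q → U → U := fun T u => if home (Sum.inl u) ∈ T then ρ u else u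
  have hρa : ∀ q, ρ (a q) = a q := fun q => hρ' _ fun r hr => by
    have h1 := hm r _ hr
    rw [ha] at h1
    subst h1
    exact (List.nodup_cons.1 (hnd q)).1 hr
  have hmap : ∀ {f g h : U → U}, (∀ u, f (g u) = h u) → ∀ M : Multiset (Sym2 (U ⊕ (I ⊕ O))),
      (M.map (mapEdge g)).map (mapEdge f) = M.map (mapEdge h) := by
    intro f g h hfg M
    rw [Multiset.map_map]
    refine Multiset.map_congr rfl fun e _ => ?_
    simp only [mapEdge, Function.comp, Sym2.map_map]
    congr 1
    funext x
    rcases x with x | x <;> simp [hfg]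
  have hid : ∀ u, ρ' ∅ u = u := fun u => by simp [ρ']
  have hfull : ρ' Finset.univ = ρ := by funext u; simp [ρ']
  have hL0 : L.map (mapEdge (ρ' ∅)) = L := by
    refine (Multiset.map_congr rfl fun e _ => ?_).trans (Multiset.map_id _)
    induction e with | _ x y
    rcases x with x | x <;> rcases y with y | y <;> simp [mapEdge, hid]
  have := net_all_wires (k := k) (w := fun q => pre q ++ Sum.inl (a q) :: ((m q).map Sum.inl ++ post q))
    (w' := fun q => pre q ++ Sum.inl (a q) :: post q) (fun T => L.map (mapEdge (ρ' T))) home ?_ ?_ ?_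
  · rwa [hL0, hfull] at this
  · intro q x hx
    simp only [List.mem_append, List.mem_cons, List.mem_map] at hx
    rcases hx with hx | rfl | ⟨u, hu, rfl⟩ | hx
    exacts [hpre q x hx, ha q, hm q u hu, hpost q x hx]
  · intro q x hx
    simp only [List.mem_append, List.mem_cons] at hx
    rcases hx with hx | rfl | hx
    exacts [hpre q x hx, ha q, hpost q x hx]
  · intro q T W hq hW
    -- A vertex of a processed wire is sent by `ρ` to a vertex of the same wire, so the substitution
    -- on the new wire `q` does not affect it.
    have hcomp : ∀ u, (if ρ' T u ∈ m q then a q else ρ' T u) = ρ' (insert q T) u := by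
      intro u
      by_cases hu : home (Sum.inl u) ∈ T
      · have h1 : ρ' T u = ρ u := if_pos hu
        have h2 : ρ' (insert q T) u = ρ u := if_pos (Finset.mem_insert_of_mem hu)
        rw [h1, h2, if_neg]
        intro hmem
        have h3 := hm q _ hmem
        by_cases hu' : ∃ r, u ∈ m r
        · obtain ⟨r, hr⟩ := hu'
          rw [hρ r u hr, ha] at h3
          rw [hm r u hr, h3] at hu
          exact hq hu
        · rw [hρ' u (not_exists.1 hu')] at h3
          rw [h3] at hu
          exact hq hu
      · have h1 : ρ' T u = u := if_neg hu
        rw [h1]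
        by_cases hu' : u ∈ m q
        · rw [if_pos hu']
          have : home (Sum.inl u) ∈ insert q T := by rw [hm q u hu']; exact Finset.mem_insert_self _ _
          simp only [ρ']
          rw [if_pos this, hρ q u hu']
        · rw [if_neg hu']
          simp only [ρ']
          split_ifs with h'
          · have h4 : home (Sum.inl u) = q := (Finset.mem_insert.1 h').resolve_right hu
            rw [hρ' u fun r hr => ?_]
            have := hm r u hr
            rw [h4] at this
            exact hu' (this ▸ hr)
          · rfl
    have hmem : ∀ b ∈ a q :: m q, home (Sum.inl b) = q := by
      intro b hb
      rcases List.mem_cons.1 hb with rfl | hb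
      exacts [ha q, hm q b hb]
    have hcomp' := hmap (f := fun u => if u ∈ m q then a q else u) hcomp L
    rw [← hcomp']
    refine net_merge_list (hk q) (hnd q) (h₁ q) (h₂ q)
      (fun b hb l hl hbl => hW l hl _ hbl (hmem b hb)) ?_
    rw [hcomp']
    intro hbad
    refine hL q ?_
    -- Because `ρ` absorbs the partial substitution and fixes `a q`, a loop at `a q` at an
    -- intermediate stage would persist to the end, where `hL` excludes it.
    have : L.map (mapEdge ρ) = (L.map (mapEdge (ρ' (insert q T)))).map (mapEdge ρ) := by
      refine (hmap (fun u => ?_) L).symm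
      simp only [ρ']
      split_ifs
      · by_cases hu' : ∃ r, u ∈ m r
        · obtain ⟨r, hr⟩ := hu'
          rw [hρ r u hr, hρa]
        · rw [hρ' u (not_exists.1 hu'), hρ' u (not_exists.1 hu')]
      · rfl
    rw [this]
    exact Multiset.mem_map.2 ⟨_, hbad, by simp [mapEdge, hρa]⟩

end ZXGraph

/-! ## Sites for the diagrams of a pattern -/

namespace Command

variable {Q : Type}

/-- The position of the type of command in the standard form. -/
def stage : Command Q → ℕ
  | N _ => 0
  | E _ _ => 1
  | M _ _ _ _ => 2
  | X _ _ => 3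
  | Z _ _ => 3

/-- The (first) qubit the command acts on. -/
def fst : Command Q → Q
  | N i => i
  | E i _ => i
  | M i _ _ _ => i
  | X i _ => i
  | Z i _ => i

/-- The last qubit the command acts on. -/
def snd : Command Q → Q
  | E _ j => j
  | c => c.fst

/-- The label of a correction. -/
noncomputable def corrKind : Command Q → Kind Q
  | X _ s => node .X (Real.pi : Real.Angle) s
  | Z _ s => node .Z (Real.pi : Real.Angle) s
  | _ => node .Z 0 ∅

/-- The label of an identity vertex that can be placed next to a correction. -/
noncomputable def corrPadKind : Command Q → Kind Q
  | X _ _ => node .Z 0 ∅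
  | _ => node .X 0 ∅

end Command

/-- Names for the vertices of the diagrams that occur in the rewriting of a pattern with qubits `Q`
and commands indexed by `K`. -/
inductive Site (Q K : Type)
  /-- the first spider on a wire -/
  | start (q : Q)
  /-- an identity vertex -/
  | pad (q : Q)
  /-- the spider whose links go to later wires -/
  | exit (q : Q)
  /-- the vertices of an entangling command -/
  | left (k : K)
  | had (k : K)
  | right (k : K)
  /-- a correction -/
  | corr (k : K)
  /-- an identity vertex next to a correction -/
  | corrPad (k : K)
  /-- the target of a controlled-`X`, the `H` vertices around it, and an identity vertex -/
  | hIn (k : K)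
  | target (k : K)
  | hOut (k : K)
  | sep (k : K)
  /-- the target after a change of colour, and the `H` vertices which this introduces -/
  | fused (k : K)
  | auxIn (k : K)
  | auxOut (k : K)

namespace Pattern

variable {Q : Type} (P : Pattern Q)

/-- Positions of commands. -/
abbrev Idx : Type := Fin P.commands.length

def cmd (k : P.Idx) : Command Q := P.commands.get k

/-- Vertices of the diagrams, including the boundary. -/
abbrev Vtx : Type := Site Q P.Idx ⊕ (P.inputs ⊕ P.outputs)

noncomputable def siteKind : Site Q P.Idx → Kind Q
  | .start _ => node .Z 0 ∅
  | .pad _ => node .X 0 ∅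
  | .exit _ => node .Z 0 ∅
  | .left _ => node .Z 0 ∅
  | .had _ => .hadamard
  | .right _ => node .Z 0 ∅
  | .corr k => (P.cmd k).corrKind
  | .corrPad k => (P.cmd k).corrPadKind
  | .hIn _ => .hadamard
  | .target _ => node .X 0 ∅
  | .hOut _ => .hadamard
  | .sep _ => node .Z 0 ∅
  | .fused _ => node .Z 0 ∅
  | .auxIn _ => .hadamard
  | .auxOut _ => .hadamard

def IsE (k : P.Idx) : Prop := (P.cmd k).stage = 1

noncomputable def inList (q : Q) : List P.Vtx :=
  if h : q ∈ P.inputs then [Sum.inr (Sum.inl ⟨q, h⟩)] else []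

noncomputable def outList (q : Q) : List P.Vtx :=
  if h : q ∈ P.outputs then [Sum.inr (Sum.inr ⟨q, h⟩)] else []

/-- The corrections on a qubit. -/
noncomputable def corrs (q : Q) : List P.Idx :=
  (List.finRange P.commands.length).filter fun k => (P.cmd k).stage = 3 ∧ (P.cmd k).fst = q

/-- The ends of entangling commands on a qubit. -/
noncomputable def entList (q : Q) : List (Site Q P.Idx) :=
  (List.finRange P.commands.length).flatMap fun k =>
    if P.IsE k then
      (if (P.cmd k).fst = q then [.left k] else []) ++
        (if (P.cmd k).snd = q then [.right k] else [])
    else []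

/-- Positions of entangling commands. -/
noncomputable def ents : Multiset P.Idx := (Finset.univ.filter fun k => P.IsE k).val

/-- The wires with all spiders merged. -/
noncomputable def mergedWire (q : Q) : List P.Vtx :=
  P.inList q ++ Sum.inl (.start q) :: ((P.corrs q).map (fun k => Sum.inl (.corr k)) ++ P.outList q)

noncomputable def mergedLinks : Multiset (Sym2 P.Vtx) :=
  P.ents.bind fun k => {s(Sum.inl (.start (P.cmd k).fst), Sum.inl (.had k)),
    s(Sum.inl (.had k), Sum.inl (.start (P.cmd k).snd))}

/-- The common normal form of the diagram of the pattern and the circuit-like diagram. -/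
noncomputable def merged [Fintype Q] : ZXGraph Q P.inputs P.outputs :=
  ZXGraph.net P.siteKind ((Finset.univ : Finset Q).val.map P.mergedWire) P.mergedLinks

theorem inList_home {home : P.Vtx → Q} (h : ∀ i : P.inputs, home (Sum.inr (Sum.inl i)) = i) (q : Q)
    {x : P.Vtx} (hx : x ∈ P.inList q) : home x = q := by
  unfold inList at hx
  split_ifs at hx with hq
  · rw [List.mem_singleton.1 hx, h]
  · simp at hx

theorem outList_home {home : P.Vtx → Q} (h : ∀ i : P.outputs, home (Sum.inr (Sum.inr i)) = i)
    (q : Q) {x : P.Vtx} (hx : x ∈ P.outList q) : home x = q := by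
  unfold outList at hx
  split_ifs at hx with hq
  · rw [List.mem_singleton.1 hx, h]
  · simp at hx

theorem inl_notMem_inList (u : Site Q P.Idx) (q : Q) : Sum.inl u ∉ P.inList q := by
  unfold inList; split_ifs <;> simp

theorem inl_notMem_outList (u : Site Q P.Idx) (q : Q) : Sum.inl u ∉ P.outList q := by
  unfold outList; split_ifs <;> simp

theorem mem_corrs {q : Q} {k : P.Idx} :
    k ∈ P.corrs q ↔ (P.cmd k).stage = 3 ∧ (P.cmd k).fst = q := by simp [corrs]

theorem ents_nodup : P.ents.Nodup := Finset.nodup _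

theorem mem_ents {k : P.Idx} : k ∈ P.ents ↔ P.IsE k := by simp [ents]

theorem IsE.exists {k : P.Idx} (h : P.IsE k) : ∃ i j, P.cmd k = .E i j ∧ i ≠ j := by
  unfold IsE at h
  cases hc : P.cmd k with
  | E i j =>
    exact ⟨i, j, rfl, P.entangle_ne (P.cmd k) (List.get_mem _ _) i j
      (by rw [hc]; exact .inl ⟨rfl, rfl⟩)⟩
  | _ => rw [hc] at h; simp [Command.stage] at h

theorem IsE.fst_ne_snd {k : P.Idx} (h : P.IsE k) : (P.cmd k).fst ≠ (P.cmd k).snd := by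
  obtain ⟨i, j, hc, hij⟩ := IsE.exists P h
  rw [hc]
  exact hij

/-! ### Merging the spiders of the diagram of the pattern -/

/-- The wires without the measurements, beginning with an additional identity vertex if the qubit is
an input. -/
noncomputable def openWire (q : Q) : List P.Vtx :=
  P.inList q ++ Sum.inl (.start q) ::
    ((P.entList q).map Sum.inl ++ ((P.corrs q).map (fun k => Sum.inl (.corr k)) ++ P.outList q))

noncomputable def openLinks : Multiset (Sym2 P.Vtx) :=
  P.ents.bind fun k => {s(Sum.inl (.left k), Sum.inl (.had k)),
    s(Sum.inl (.had k), Sum.inl (.right k))}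

/-- The spider into which the ends of entangling commands are merged. -/
noncomputable def openMerge : Site Q P.Idx → Site Q P.Idx
  | .left k => if P.IsE k then .start (P.cmd k).fst else .left k
  | .right k => if P.IsE k then .start (P.cmd k).snd else .right k
  | u => u

/-- The wire of a vertex of the diagram of the pattern. -/
def openHome : P.Vtx → Q
  | .inl (.start q) => q
  | .inl (.pad q) => q
  | .inl (.exit q) => q
  | .inl (.right k) => (P.cmd k).snd
  | .inl (.left k) | .inl (.had k) | .inl (.corr k) | .inl (.corrPad k) | .inl (.hIn k)
  | .inl (.target k) | .inl (.hOut k) | .inl (.sep k) | .inl (.fused k) | .inl (.auxIn k)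
  | .inl (.auxOut k) => (P.cmd k).fst
  | .inr (.inl i) => i
  | .inr (.inr o) => o

theorem mem_entList {q : Q} {u : Site Q P.Idx} :
    u ∈ P.entList q ↔ (∃ k, P.IsE k ∧ (P.cmd k).fst = q ∧ u = .left k) ∨
      ∃ k, P.IsE k ∧ (P.cmd k).snd = q ∧ u = .right k := by
  simp only [entList, List.mem_flatMap, List.mem_finRange, true_and]
  constructor
  · rintro ⟨k, hk⟩
    split_ifs at hk <;> simp only [List.mem_append, List.mem_singleton, List.not_mem_nil,
      or_false, false_or] at hk <;> grind
  · rintro (⟨k, hk, h, rfl⟩ | ⟨k, hk, h, rfl⟩) <;> refine ⟨k, ?_⟩ <;> simp [hk, h]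

theorem entList_nodup (q : Q) : (P.entList q).Nodup := by
  rw [entList, List.nodup_flatMap]
  constructor
  · intro k _
    split_ifs <;> simp
  · refine (List.nodup_finRange _).imp fun {k k'} hkk' => ?_
    simp only [Function.onFun]
    split_ifs <;> simp [hkk', hkk'.symm]

/-- The ends of the entangling commands are phase-free `Z` spiders directly after `start q`, so they
fuse into it. No loop arises, since each link has an `H` vertex at one end and this is never merged.
-/
theorem open_rewrites_merged [Fintype Q] :
    ZXGraph.Rewrites
      (ZXGraph.net P.siteKind ((Finset.univ : Finset Q).val.map P.openWire) P.openLinks)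
      P.merged := by
  have hmap : P.openLinks.map (ZXGraph.mapEdge P.openMerge) = P.mergedLinks := by
    rw [openLinks, mergedLinks, Multiset.map_bind]
    refine Multiset.bind_congr fun k hk => ?_
    simp [ZXGraph.mapEdge, openMerge, P.mem_ents.1 hk]
  have := ZXGraph.net_merge_all (k := P.siteKind) (c := .Z) (L := P.openLinks) (pre := P.inList)
    (post := fun q => (P.corrs q).map (fun k => Sum.inl (.corr k)) ++ P.outList q)
    (a := .start) (m := P.entList) P.openMerge P.openHome
    (fun q x => P.inList_home (fun _ => rfl) q) ?_ (fun _ => rfl) ?_ ?_ ?_ ?_ ?_ ?_ ?_ ?_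
  · rw [hmap] at this
    exact this
  · intro q x hx
    rcases List.mem_append.1 hx with hx | hx
    · obtain ⟨k, hk, rfl⟩ := List.mem_map.1 hx
      exact (P.mem_corrs.1 hk).2
    · exact P.outList_home (fun _ => rfl) q hx
  · intro q u hu
    rcases P.mem_entList.1 hu with ⟨k, -, h, rfl⟩ | ⟨k, -, h, rfl⟩ <;> exact h
  · intro q u hu
    rcases P.mem_entList.1 hu with ⟨k, hk, h, rfl⟩ | ⟨k, hk, h, rfl⟩ <;>
      exact (if_pos hk).trans (congrArg _ h)
  · intro u hu
    cases u with
    | left k => exact if_neg fun hk => hu _ (P.mem_entList.2 (.inl ⟨k, hk, rfl, rfl⟩))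
    | right k => exact if_neg fun hk => hu _ (P.mem_entList.2 (.inr ⟨k, hk, rfl, rfl⟩))
    | _ => rfl
  · intro q b hb
    rcases List.mem_cons.1 hb with rfl | hb
    · rfl
    · rcases P.mem_entList.1 hb with ⟨k, -, h, rfl⟩ | ⟨k, -, h, rfl⟩ <;> rfl
  · intro q
    rw [List.nodup_cons]
    refine ⟨fun h => ?_, P.entList_nodup q⟩
    rcases P.mem_entList.1 h with ⟨k, -, h, h'⟩ | ⟨k, -, h, h'⟩ <;> cases h'
  · intro q b _
    exact P.inl_notMem_inList b q
  · intro q b hb hb'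
    rcases List.mem_append.1 hb' with hb' | hb'
    · obtain ⟨k, hk, h⟩ := List.mem_map.1 hb'
      cases h
      rcases List.mem_cons.1 hb with h | hb
      · cases h
      · rcases P.mem_entList.1 hb with ⟨k, -, h, h'⟩ | ⟨k, -, h, h'⟩ <;> cases h'
    · exact P.inl_notMem_outList _ _ hb'
  · intro q h
    rw [hmap, mergedLinks] at h
    obtain ⟨k, hk, h⟩ := Multiset.mem_bind.1 h
    simp at h

end Pattern

/-! ### Schedules, and the circuit-like diagram built from one -/

namespace Pattern

variable {Q : Type} (P : Pattern Q)

/-- An arrangement of the entangling commands in time, compatible with a flow. -/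
structure Schedule where
  rank : Q → ℕ
  /-- the ends of an entangling command, in the order of their ranks -/
  lo : P.Idx → Q
  hi : P.Idx → Q
  ends : ∀ k, P.IsE k → (lo k = (P.cmd k).fst ∧ hi k = (P.cmd k).snd) ∨
    (lo k = (P.cmd k).snd ∧ hi k = (P.cmd k).fst)
  rank_lt : ∀ k, P.IsE k → rank (lo k) < rank (hi k)
  /-- the commands that entangle a qubit with its successor in the flow -/
  flow : P.Idx → Prop
  isE : ∀ k, flow k → P.IsE k
  flow_exists : ∀ q, q ∉ P.outputs → ∃ k, flow k ∧ lo k = q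
  lo_notMem : ∀ k, flow k → lo k ∉ P.outputs
  hi_notMem : ∀ k, flow k → hi k ∉ P.inputs
  -- With `hi_inj`, the flow commands form a partial injection on qubits; as the rank increases
  -- along it, the qubits fall into disjoint chains.
  lo_inj : ∀ k k', flow k → flow k' → lo k = lo k' → k = k'
  hi_inj : ∀ k k', flow k → flow k' → hi k = hi k' → k = k'
  -- The trace of the last flow condition: the flow command reaches a wire before all the gates on
  -- it.
  flow_first : ∀ k k', flow k → P.IsE k' → ¬ flow k' → hi k' = hi k → rank (lo k) < rank (lo k')
  /-- the other commands that entangle a qubit with an earlier one -/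
  gates : Q → List P.Idx
  mem_gates : ∀ q k, k ∈ gates q ↔ P.IsE k ∧ ¬ flow k ∧ hi k = q
  -- The wire of a measured qubit must end with its `exit`, from which the path goes on along the
  -- flow.
  corrs_eq_nil : ∀ q, q ∉ P.outputs → P.corrs q = []
  gates_sorted : ∀ q, (gates q).Pairwise fun k k' => rank (lo k) < rank (lo k')

namespace Schedule

variable {P} (S : P.Schedule)

theorem gates_nodup (q : Q) : (S.gates q).Nodup :=
  (S.gates_sorted q).imp fun h h' => by subst h'; exact lt_irrefl _ h

/-- A correction and an identity vertex. -/
def corrPair (P : Pattern Q) (k : P.Idx) : List P.Vtx :=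
  -- In either case the pair reads `X`, `Z`, so any sequence of pairs alternates when it follows the
  -- `Z` spider `exit`.
  match P.cmd k with
  | .X _ _ => [Sum.inl (.corr k), Sum.inl (.corrPad k)]
  | _ => [Sum.inl (.corrPad k), Sum.inl (.corr k)]

/-- The wires of the circuit-like diagram after the first spider. -/
noncomputable def tail (q : Q) : List P.Vtx :=
  -- The `Z` spider `sep` separates the `H` vertices of successive gates, and the `X` spider `pad`
  -- separates `exit` from the preceding `sep` or `start`. Links to later wires leave from `exit`,
  -- after all incoming gates.
  (S.gates q).flatMap (fun k => [Sum.inl (.hIn k), Sum.inl (.target k), Sum.inl (.hOut k),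
    Sum.inl (.sep k)]) ++
    ([Sum.inl (.pad q), Sum.inl (.exit q)] ++ ((P.corrs q).flatMap (corrPair P) ++ P.outList q))

/-- The wires of the circuit-like diagram. -/
noncomputable def circuitWire (q : Q) : List P.Vtx :=
  P.inList q ++ Sum.inl (.start q) :: S.tail q

/-- The `H` vertex of a flow command will lie on a path. The link of a gate is a single edge without
a vertex of its own, because the `H` vertices have moved to the wire of `hi k`. -/
noncomputable def circuitLink (k : P.Idx) : Multiset (Sym2 P.Vtx) :=
  if S.flow k then {s(Sum.inl (.exit (S.lo k)), Sum.inl (.had k)),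
    s(Sum.inl (.had k), Sum.inl (.start (S.hi k)))}
  else {s(Sum.inl (.exit (S.lo k)), Sum.inl (.target k))}

noncomputable def circuitLinks : Multiset (Sym2 P.Vtx) := P.ents.bind S.circuitLink

/-- The circuit-like diagram. -/
noncomputable def circuit [Fintype Q] : ZXGraph Q P.inputs P.outputs :=
  ZXGraph.net P.siteKind ((Finset.univ : Finset Q).val.map S.circuitWire) S.circuitLinks

/-- The wire of a vertex of the circuit-like diagram. -/
def home : P.Vtx → Q
  | .inl (.start q) => q
  | .inl (.pad q) => q
  | .inl (.exit q) => q
  | .inl (.corr k) | .inl (.corrPad k) => (P.cmd k).fst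
  | .inl (.left k) | .inl (.right k) | .inl (.had k) | .inl (.hIn k) | .inl (.target k)
  | .inl (.hOut k) | .inl (.sep k) | .inl (.fused k) | .inl (.auxIn k) | .inl (.auxOut k) => S.hi k
  | .inr (.inl i) => i
  | .inr (.inr o) => o

theorem mem_corrPair {k : P.Idx} {x : P.Vtx} :
    x ∈ corrPair P k ↔ x = Sum.inl (.corr k) ∨ x = Sum.inl (.corrPad k) := by
  unfold corrPair
  split <;> simp [or_comm]

theorem home_inList (q : Q) {x : P.Vtx} (hx : x ∈ P.inList q) : S.home x = q :=
  P.inList_home (fun _ => rfl) q hx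

theorem home_outList (q : Q) {x : P.Vtx} (hx : x ∈ P.outList q) : S.home x = q :=
  P.outList_home (fun _ => rfl) q hx

theorem hi_of_mem_gates {q : Q} {k : P.Idx} (hk : k ∈ S.gates q) : S.hi k = q :=
  ((S.mem_gates q k).1 hk).2.2

theorem mem_tail {q : Q} {x : P.Vtx} : x ∈ S.tail q ↔
    (∃ k ∈ S.gates q, x = Sum.inl (.hIn k) ∨ x = Sum.inl (.target k) ∨ x = Sum.inl (.hOut k) ∨
      x = Sum.inl (.sep k)) ∨ x = Sum.inl (.pad q) ∨ x = Sum.inl (.exit q) ∨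
    (∃ k ∈ P.corrs q, x = Sum.inl (.corr k) ∨ x = Sum.inl (.corrPad k)) ∨ x ∈ P.outList q := by
  simp only [tail, List.mem_append, List.mem_flatMap, List.mem_cons, List.not_mem_nil, or_false,
    mem_corrPair, or_assoc]

theorem mem_circuitWire {q : Q} {x : P.Vtx} : x ∈ S.circuitWire q ↔
    x ∈ P.inList q ∨ x = Sum.inl (.start q) ∨ x ∈ S.tail q := by
  simp [circuitWire]

theorem home_tail (q : Q) {x : P.Vtx} (hx : x ∈ S.tail q) : S.home x = q := by
  rcases S.mem_tail.1 hx with ⟨k, hk, rfl | rfl | rfl | rfl⟩ | rfl | rfl | ⟨k, hk, rfl | rfl⟩ | hx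
  any_goals rfl
  any_goals exact S.hi_of_mem_gates hk
  any_goals exact (P.mem_corrs.1 hk).2
  exact S.home_outList q hx

theorem home_circuitWire (q : Q) {x : P.Vtx} (hx : x ∈ S.circuitWire q) : S.home x = q := by
  rcases S.mem_circuitWire.1 hx with hx | rfl | hx
  exacts [S.home_inList q hx, rfl, S.home_tail q hx]

/-! ### Removing the identity vertices of the circuit-like diagram -/

/-- The vertices that are not identity vertices. -/
def Keep (x : P.Vtx) : Prop :=
  (∀ q, x ≠ Sum.inl (.pad q)) ∧ (∀ k, x ≠ Sum.inl (.sep k)) ∧ ∀ k, x ≠ Sum.inl (.corrPad k)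

noncomputable def gateWire (q : Q) : List P.Vtx :=
  (P.inList q ++ [Sum.inl (.start q)]) ++
    ((S.gates q).flatMap (fun k => [Sum.inl (.hIn k), Sum.inl (.target k), Sum.inl (.hOut k)]) ++
    (Sum.inl (.exit q) :: ((P.corrs q).map (fun k => Sum.inl (.corr k)) ++ P.outList q)))

theorem filter_outList (q : Q) : (P.outList q).filter (fun x => Keep x) = P.outList q := by
  unfold outList
  split_ifs <;> simp [Keep]

theorem filter_tail (q : Q) : (S.tail q).filter (fun x => Keep x) =
    (S.gates q).flatMap (fun k => [Sum.inl (.hIn k), Sum.inl (.target k), Sum.inl (.hOut k)]) ++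
    (Sum.inl (.exit q) :: ((P.corrs q).map (fun k => Sum.inl (.corr k)) ++ P.outList q)) := by
  simp only [tail, List.filter_append, filter_outList, List.filter_flatMap]
  congr 1
  · congr 1
    funext k
    simp [Keep]
  · rw [← List.flatMap_singleton' ((P.corrs q).map _), List.flatMap_map]
    have : (fun k => (corrPair P k).filter (fun x => Keep x)) = fun k => [(Sum.inl (.corr k) : P.Vtx)] := by
      funext k
      unfold corrPair
      split <;> simp [Keep]
    rw [this]
    simp [Keep]

theorem tail_nodup (q : Q) : (S.tail q).Nodup := by
  have hc : (P.corrs q).Nodup := (List.nodup_finRange _).filter _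
  simp only [tail, List.nodup_append, List.nodup_flatMap]
  refine ⟨⟨by simp, (S.gates_nodup q).imp fun h => ?_⟩, ⟨by simp, ⟨⟨fun k _ => ?_, ?_⟩, ?_, ?_⟩, ?_⟩, ?_⟩
  · simp [Function.onFun, h.symm]
  · unfold corrPair
    split <;> simp
  · refine hc.imp fun h x hx hx' => ?_
    rcases mem_corrPair.1 hx with rfl | rfl <;> rcases mem_corrPair.1 hx' with h' | h' <;>
      simp_all
  · unfold outList
    split_ifs <;> simp
  · intro x hx y hy hxy
    subst hxy
    obtain ⟨k, -, hx⟩ := List.mem_flatMap.1 hx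
    rcases mem_corrPair.1 hx with rfl | rfl <;> exact P.inl_notMem_outList _ _ hy
  · intro x hx y hy hxy
    subst hxy
    simp only [List.mem_cons, List.not_mem_nil, or_false] at hx
    rcases List.mem_append.1 hy with hy | hy
    · obtain ⟨k, -, hy⟩ := List.mem_flatMap.1 hy
      rcases mem_corrPair.1 hy with rfl | rfl <;> simp at hx
    · rcases hx with rfl | rfl <;> exact P.inl_notMem_outList _ _ hy
  · intro x hx y hy hxy
    subst hxy
    simp only [List.mem_flatMap, List.mem_cons, List.not_mem_nil, or_false, List.mem_append,
      mem_corrPair] at hx hy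
    obtain ⟨k, -, hx⟩ := hx
    rcases hy with hy | ⟨k', -, hy⟩ | hy
    · grind
    · grind
    · rcases hx with rfl | rfl | rfl | rfl <;> exact P.inl_notMem_outList _ _ hy

theorem tail_getLast (q : Q) : ∀ x ∈ (S.tail q).getLast?, Keep x := by
  intro x hx
  unfold tail at hx
  by_cases hq : q ∈ P.outputs
  · rw [outList, dif_pos hq] at hx
    simp only [← List.append_assoc, List.getLast?_concat, Option.mem_some_iff] at hx
    subst hx
    simp [Keep]
  · simp [outList, hq, S.corrs_eq_nil q hq] at hx
    subst hx
    simp [Keep]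

theorem mem_circuitLinks {e : Sym2 P.Vtx} (he : e ∈ S.circuitLinks) {u : Site Q P.Idx}
    (hu : Sum.inl u ∈ e) : (∃ q, u = .exit q) ∨ (∃ q, u = .start q) ∨ (∃ k, S.flow k ∧ u = .had k) ∨
      ∃ k, P.IsE k ∧ ¬ S.flow k ∧ u = .target k := by
  obtain ⟨k, hk, he⟩ := Multiset.mem_bind.1 he
  unfold circuitLink at he
  split_ifs at he with hf
  · simp only [Multiset.insert_eq_cons, Multiset.mem_cons, Multiset.mem_singleton] at he
    rcases he with rfl | rfl <;> simp only [Sym2.mem_iff, Sum.inl.injEq] at hu <;> grind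
  · rw [Multiset.mem_singleton] at he
    subst he
    simp only [Sym2.mem_iff, Sum.inl.injEq] at hu
    have := P.mem_ents.1 hk
    grind

/-- No link ends at a `pad`, `sep` or `corrPad`, so each of these is an identity with exactly its
two wire edges. -/
theorem circuit_rewrites_gate [Fintype Q] : ZXGraph.Rewrites S.circuit
    (ZXGraph.net P.siteKind ((Finset.univ : Finset Q).val.map S.gateWire) S.circuitLinks) := by
  refine ZXGraph.net_all_wires (fun _ => S.circuitLinks) S.home (fun q x => S.home_circuitWire q) ?_ ?_
  · intro q x hx
    simp only [gateWire, ← filter_tail, List.mem_append, List.mem_singleton, List.mem_filter] at hx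
    rcases hx with (hx | rfl) | hx
    exacts [S.home_inList q hx, rfl, S.home_tail q hx.1]
  · intro q T W hq hW
    have := ZXGraph.net_filter (k := P.siteKind) (W := W) (L := S.circuitLinks) (P := Keep)
      (l₁ := P.inList q ++ [Sum.inl (.start q)]) (l₂ := S.tail q) (by simp) (S.tail_getLast q)
      (S.tail_nodup q) ?_
    · rw [filter_tail] at this
      simpa [circuitWire, gateWire] using this
    · intro x hx hk
      have hW' : ∀ u, x = Sum.inl u → (∃ l ∈ W, Sum.inl u ∈ l) → False := by
        rintro u rfl ⟨l, hl, hu⟩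
        exact hW l hl _ hu (S.home_tail q hx)
      have hl₁ : ∀ u, u ≠ .start q → Sum.inl u ∉ P.inList q ++ [Sum.inl (.start q)] := by
        intro u hu h
        rcases List.mem_append.1 h with h | h
        · exact P.inl_notMem_inList _ _ h
        · exact hu (Sum.inl_injective (List.mem_singleton.1 h))
      have aux : ∀ u c, x = Sum.inl u → P.siteKind u = node c 0 ∅ →
          (∀ q, u ≠ .exit q) → (∀ q, u ≠ .start q) → (∀ k, u ≠ .had k) → (∀ k, u ≠ .target k) →
          ∃ u c, x = Sum.inl u ∧ P.siteKind u = node c 0 ∅ ∧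
            u ∉ ZXGraph.sites W S.circuitLinks ∧ x ∉ P.inList q ++ [Sum.inl (.start q)] := by
        rintro u c rfl hc h1 h2 h3 h4
        refine ⟨u, c, rfl, hc, ?_, hl₁ u (h2 q)⟩
        rintro (h | ⟨e, he, hu⟩)
        · exact hW' u rfl h
        · rcases S.mem_circuitLinks he hu with ⟨r, h⟩ | ⟨r, h⟩ | ⟨r, -, h⟩ | ⟨r, -, -, h⟩
          exacts [h1 r h, h2 r h, h3 r h, h4 r h]
      rcases x with u | x
      · cases u with
        | pad q => exact aux _ .X rfl rfl (by simp) (by simp) (by simp) (by simp)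
        | sep q => exact aux _ .Z rfl rfl (by simp) (by simp) (by simp) (by simp)
        | corrPad k =>
          have : ∃ c, P.siteKind (.corrPad k) = node c 0 ∅ := by
            simp only [siteKind]
            unfold Command.corrPadKind
            split
            exacts [⟨_, rfl⟩, ⟨_, rfl⟩]
          obtain ⟨c, hc⟩ := this
          exact aux _ c rfl hc (by simp) (by simp) (by simp) (by simp)
        | _ => exact absurd (by simp [Keep]) hk
      · exact absurd (by simp [Keep]) hk

/-! ### Changing the colour of the targets -/

/-- The link of an entangling command, when the wires in `T` have been processed. -/
noncomputable def gateLink (T : Finset Q) (k : P.Idx) : Multiset (Sym2 P.Vtx) :=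
  if ¬ S.flow k ∧ S.hi k ∈ T then {s(Sum.inl (.fused k), Sum.inl (.had k)),
    s(Sum.inl (.had k), Sum.inl (.exit (S.lo k)))}
  else S.circuitLink k

noncomputable def fusedWire (q : Q) : List P.Vtx :=
  (P.inList q ++ [Sum.inl (.start q)]) ++
    ((S.gates q).map (fun k => Sum.inl (.fused k)) ++
    (Sum.inl (.exit q) :: ((P.corrs q).map (fun k => Sum.inl (.corr k)) ++ P.outList q)))

/-- The colour of the targets on one wire is changed gate by gate. Generalising over `L` lets the
links already converted join the untouched ones, and generalising over `l₁` does the same for the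
wire. -/
theorem net_gates {W : Multiset (List P.Vtx)} {L : Multiset (Sym2 P.Vtx)} (g : List P.Idx)
    (l₁ l₂ : List P.Vtx) (h₁ : l₁ ≠ []) (h₂ : l₂ ≠ []) (hg : g.Nodup)
    (hd : ∀ k ∈ g, ∀ u : Site Q P.Idx, u ∈ ([.hIn k, .target k, .hOut k, .fused k, .auxIn k, .auxOut k, .had k] :
      List (Site Q P.Idx)) → Sum.inl u ∉ l₁ ∧ Sum.inl u ∉ l₂ ∧ u ∉ ZXGraph.sites W L) :
    ZXGraph.Rewrites
      (ZXGraph.net P.siteKind ((l₁ ++ (g.flatMap (fun k => [Sum.inl (.hIn k), Sum.inl (.target k),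
          Sum.inl (.hOut k)]) ++ l₂)) ::ₘ W)
        ((g : Multiset P.Idx).bind (fun k => {s(Sum.inl (.exit (S.lo k)), Sum.inl (.target k))}) + L))
      (ZXGraph.net P.siteKind ((l₁ ++ (g.map (fun k => Sum.inl (.fused k)) ++ l₂)) ::ₘ W)
        ((g : Multiset P.Idx).bind (fun k => {s(Sum.inl (.fused k), Sum.inl (.had k)),
          s(Sum.inl (.had k), Sum.inl (.exit (S.lo k)))}) + L)) := by
  induction g generalizing l₁ L with
  | nil => exact Relation.EqvGen.refl _
  | cons k g ih =>
    rw [List.nodup_cons] at hg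
    rw [← Multiset.cons_coe, Multiset.cons_bind, Multiset.cons_bind]
    have h1 := ZXGraph.net_change_colour (k := P.siteKind) (W := W)
      (L := (g : Multiset P.Idx).bind
        (fun k => {s(Sum.inl (.exit (S.lo k)), Sum.inl (.target k))}) + L)
      (l₁ := l₁) (l₂ := g.flatMap (fun k => [Sum.inl (.hIn k), Sum.inl (.target k),
          Sum.inl (.hOut k)]) ++ l₂) (z := Sum.inl (.exit (S.lo k)))
      (p := .hIn k) (x := .target k) (q := .hOut k) (g := .fused k) (h₁ := .auxIn k)
      (h₂ := .auxOut k) (h := .had k) rfl rfl rfl rfl rfl rfl rfl (by simp) ?_ h₁ (by simp [h₂])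
    · have h2 := ih (L := {s(Sum.inl (.fused k), Sum.inl (.had k)),
          s(Sum.inl (.had k), Sum.inl (.exit (S.lo k)))} + L) (l₁ ++ [Sum.inl (.fused k)])
          (by simp) hg.2 ?_
      · have e1 : ∀ X : Multiset (Sym2 P.Vtx),
            s(Sum.inl (.fused k), Sum.inl (.had k)) ::ₘ
              s(Sum.inl (.had k), Sum.inl (.exit (S.lo k))) ::ₘ (X + L) =
            X + ({s(Sum.inl (.fused k), Sum.inl (.had k)),
              s(Sum.inl (.had k), Sum.inl (.exit (S.lo k)))} + L) := by
          intro X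
          simp only [← Multiset.singleton_add, Multiset.insert_eq_cons]
          abel
        have e2 : ∀ X : Multiset (Sym2 P.Vtx), X + ({s(Sum.inl (.fused k), Sum.inl (.had k)),
              s(Sum.inl (.had k), Sum.inl (.exit (S.lo k)))} + L) =
            {s(Sum.inl (.fused k), Sum.inl (.had k)),
              s(Sum.inl (.had k), Sum.inl (.exit (S.lo k)))} + X + L := fun X => by abel
        rw [e1] at h1
        rw [e2, e2] at h2
        rw [e2] at h1
        simp only [List.flatMap_cons, List.map_cons, List.cons_append, List.nil_append,
          List.append_assoc] at h1 h2 ⊢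
        rw [add_assoc, Multiset.singleton_add]
        exact h1.trans' h2
      · intro k' hk' u hu
        have hne : k ≠ k' := fun h => hg.1 (h ▸ hk')
        obtain ⟨a1, a2, a3⟩ := hd k' (List.mem_cons_of_mem _ hk') u hu
        refine ⟨?_, a2, ?_⟩
        · rw [List.mem_append, List.mem_singleton, not_or]
          refine ⟨a1, fun h => ?_⟩
          cases h
          simp [hne] at hu
        · simp only [Multiset.insert_eq_cons, Multiset.cons_add, Multiset.singleton_add,
            ZXGraph.mem_sites_link, Sum.inl.injEq]
          simp only [List.mem_cons, List.not_mem_nil, or_false] at hu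
          grind
    · intro u hu
      obtain ⟨a1, a2, a3⟩ := hd k (by simp) u hu
      simp only [List.mem_cons, List.not_mem_nil, or_false] at hu
      refine ⟨a1, ?_, ?_, ?_⟩
      · simp only [List.mem_append, List.mem_flatMap, List.mem_cons, List.not_mem_nil, or_false,
          Sum.inl.injEq]
        grind
      · grind
      · rintro (h | ⟨e, he, h⟩)
        · exact a3 (.inl h)
        · rcases Multiset.mem_add.1 he with he | he
          · obtain ⟨k', hk', he⟩ := Multiset.mem_bind.1 he
            rw [Multiset.mem_singleton] at he
            subst he
            have hk'' : k' ∈ g := hk'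
            simp only [Sym2.mem_iff, Sum.inl.injEq] at h
            grind
          · exact a3 (.inr ⟨e, he, h⟩)

/-- Every gate has its target on exactly one wire, that of `hi`; treating the wire `q` converts
precisely the links of `gates q`. -/
theorem gate_rewrites_fused [Fintype Q] : ZXGraph.Rewrites
    (ZXGraph.net P.siteKind ((Finset.univ : Finset Q).val.map S.gateWire) S.circuitLinks)
    (ZXGraph.net P.siteKind ((Finset.univ : Finset Q).val.map S.fusedWire)
      (P.ents.bind (S.gateLink Finset.univ))) := by
  have hcorr : ∀ q, ∀ x ∈ (P.corrs q).map (fun k => (Sum.inl (.corr k) : P.Vtx)) ++ P.outList q,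
      S.home x = q := by
    intro q x hx
    rcases List.mem_append.1 hx with hx | hx
    · obtain ⟨k, hk, rfl⟩ := List.mem_map.1 hx
      exact (P.mem_corrs.1 hk).2
    · exact S.home_outList q hx
  have h0 : P.ents.bind (S.gateLink ∅) = S.circuitLinks :=
    Multiset.bind_congr fun k _ => by simp [gateLink]
  rw [← h0]
  refine ZXGraph.net_all_wires (fun T => P.ents.bind (S.gateLink T)) S.home ?_ ?_ ?_
  · intro q x hx
    simp only [gateWire, ← filter_tail, List.mem_append, List.mem_singleton, List.mem_filter] at hx
    rcases hx with (hx | rfl) | hx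
    exacts [S.home_inList q hx, rfl, S.home_tail q hx.1]
  · intro q x hx
    rcases List.mem_append.1 hx with hx | hx
    · rcases List.mem_append.1 hx with hx | hx
      · exact S.home_inList q hx
      · rw [List.mem_singleton.1 hx]
        rfl
    · rcases List.mem_append.1 hx with hx | hx
      · obtain ⟨k, hk, rfl⟩ := List.mem_map.1 hx
        exact S.hi_of_mem_gates hk
      · rcases List.mem_cons.1 hx with rfl | hx
        · rfl
        · exact hcorr q x hx
  · intro q T W hq hW
    have hsplit : ∀ g : P.Idx → Multiset (Sym2 P.Vtx), P.ents.bind g =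
        (S.gates q : Multiset P.Idx).bind g +
          (P.ents.filter fun k => k ∉ S.gates q).bind g := by
      intro g
      conv_lhs => rw [← Multiset.filter_add_not (fun k => k ∈ S.gates q) P.ents]
      rw [Multiset.add_bind]
      congr 2
      refine (Multiset.Nodup.ext (P.ents_nodup.filter _) (Multiset.coe_nodup.2 (S.gates_nodup q))).2 fun k => ?_
      rw [Multiset.mem_filter, P.mem_ents, Multiset.mem_coe]
      exact ⟨fun h => h.2, fun h => ⟨((S.mem_gates q k).1 h).1, h⟩⟩
    have hrest : (P.ents.filter fun k => k ∉ S.gates q).bind (S.gateLink (insert q T)) =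
        (P.ents.filter fun k => k ∉ S.gates q).bind (S.gateLink T) := by
      refine Multiset.bind_congr fun k hk => ?_
      rw [Multiset.mem_filter, P.mem_ents, S.mem_gates] at hk
      unfold gateLink
      congr 1
      simp only [Finset.mem_insert, eq_iff_iff]
      tauto
    have hg : (S.gates q : Multiset P.Idx).bind (S.gateLink T) =
        (S.gates q : Multiset P.Idx).bind
          fun k => {s(Sum.inl (.exit (S.lo k)), Sum.inl (.target k))} := by
      refine Multiset.bind_congr fun k hk => ?_
      have := (S.mem_gates q k).1 hk
      rw [gateLink, if_neg, circuitLink, if_neg this.2.1]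
      rw [this.2.2]
      exact fun h => hq h.2
    have hg' : (S.gates q : Multiset P.Idx).bind (S.gateLink (insert q T)) =
        (S.gates q : Multiset P.Idx).bind
          fun k => {s(Sum.inl (.fused k), Sum.inl (.had k)),
            s(Sum.inl (.had k), Sum.inl (.exit (S.lo k)))} := by
      refine Multiset.bind_congr fun k hk => ?_
      have := (S.mem_gates q k).1 hk
      rw [gateLink, if_pos ⟨this.2.1, by rw [this.2.2]; exact Finset.mem_insert_self _ _⟩]
    rw [hsplit, hsplit (S.gateLink (insert q T)), hrest, hg, hg']
    refine S.net_gates (S.gates q) _ _ (by simp) (by simp) (S.gates_nodup q) fun k hk u hu => ?_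
    have hhome : S.home (Sum.inl u) = q := by
      rw [← S.hi_of_mem_gates hk]
      simp only [List.mem_cons, List.not_mem_nil, or_false] at hu
      rcases hu with rfl | rfl | rfl | rfl | rfl | rfl | rfl <;> rfl
    simp only [List.mem_cons, List.not_mem_nil, or_false] at hu
    refine ⟨?_, ?_, ?_⟩
    · rw [List.mem_append, not_or]
      refine ⟨P.inl_notMem_inList u q, ?_⟩
      rw [List.mem_singleton, Sum.inl.injEq]
      grind
    · rw [List.mem_cons, List.mem_append, not_or, not_or]
      refine ⟨?_, ?_, P.inl_notMem_outList u q⟩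
      · rw [Sum.inl.injEq]
        grind
      · simp only [List.mem_map, Sum.inl.injEq, not_exists]
        grind
    · rintro (⟨l, hl, h⟩ | ⟨e, he, h⟩)
      · exact hW l hl _ h hhome
      · obtain ⟨k', hk', he⟩ := Multiset.mem_bind.1 he
        have hne : k' ≠ k := by
          rintro rfl
          exact (Multiset.mem_filter.1 hk').2 hk
        unfold gateLink circuitLink at he
        split_ifs at he
        all_goals
          simp only [Multiset.insert_eq_cons, Multiset.mem_cons, Multiset.mem_singleton] at he
        · rcases he with rfl | rfl <;> simp only [Sym2.mem_iff, Sum.inl.injEq] at h <;> grind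
        · rcases he with rfl | rfl <;> simp only [Sym2.mem_iff, Sum.inl.injEq] at h <;> grind
        · subst he
          simp only [Sym2.mem_iff, Sum.inl.injEq] at h
          grind

/-! ### Merging the spiders -/

noncomputable def circuitMerge : Site Q P.Idx → Site Q P.Idx
  | .fused k => if P.IsE k ∧ ¬ S.flow k then .start (S.hi k) else .fused k
  | .exit q => .start q
  | u => u

/-- After the change of colour, all spiders on a wire other than corrections are phase-free `Z`
spiders, and the links of gates as well as of flow commands have an `H` vertex between two such
spiders. Fusing turns both kinds of link into the same form. -/
theorem fused_rewrites_merged [Fintype Q] : ZXGraph.Rewrites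
    (ZXGraph.net P.siteKind ((Finset.univ : Finset Q).val.map S.fusedWire)
      (P.ents.bind (S.gateLink Finset.univ))) P.merged := by
  have hmap : (P.ents.bind (S.gateLink Finset.univ)).map (ZXGraph.mapEdge S.circuitMerge) =
      P.mergedLinks := by
    rw [mergedLinks, Multiset.map_bind]
    refine Multiset.bind_congr fun k hk => ?_
    rw [P.mem_ents] at hk
    simp only [gateLink, circuitLink, Finset.mem_univ, and_true]
    -- The link may be listed from the other end, according to which qubit of the command is the
    -- lower one.
    have key : ∀ a b c : P.Vtx, ({s(a, b), s(b, c)} : Multiset (Sym2 P.Vtx)) =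
        {s(c, b), s(b, a)} := fun a b c => by
      rw [Multiset.pair_comm, Sym2.eq_swap, Sym2.eq_swap (a := a)]
    by_cases hf : S.flow k <;> rcases S.ends k hk with h | h <;>
      simp only [hf, hk, not_true_eq_false, not_false_eq_true, if_false, if_true, and_self, h,
        Multiset.insert_eq_cons, Multiset.map_cons, Multiset.map_singleton, ZXGraph.mapEdge,
        Sym2.map_mk, Sum.map_inl, circuitMerge]
    exacts [key _ _ _, key _ _ _]
  have := ZXGraph.net_merge_all (k := P.siteKind) (c := .Z)
    (L := P.ents.bind (S.gateLink Finset.univ)) (pre := P.inList)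
    (post := fun q => (P.corrs q).map (fun k => Sum.inl (.corr k)) ++ P.outList q)
    (a := .start) (m := fun q => (S.gates q).map .fused ++ [.exit q]) S.circuitMerge S.home
    (fun q x => S.home_inList q) ?_ (fun _ => rfl) ?_ ?_ ?_ ?_ ?_ ?_ ?_ ?_
  · rw [hmap] at this
    have hw : ∀ q, S.fusedWire q = P.inList q ++ Sum.inl (.start q) ::
        (((S.gates q).map Site.fused ++ [Site.exit q]).map Sum.inl ++
          ((P.corrs q).map (fun k => Sum.inl (.corr k)) ++ P.outList q)) := fun q => by
      simp [fusedWire]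
    rw [funext hw]
    exact this
  · intro q x hx
    rcases List.mem_append.1 hx with hx | hx
    · obtain ⟨k, hk, rfl⟩ := List.mem_map.1 hx
      exact (P.mem_corrs.1 hk).2
    · exact S.home_outList q hx
  all_goals try simp only [List.mem_append, List.mem_map, List.mem_cons, List.not_mem_nil, or_false]
  · rintro q u (⟨k, hk, rfl⟩ | rfl)
    · exact S.hi_of_mem_gates hk
    · rfl
  · rintro q u (⟨k, hk, rfl⟩ | rfl)
    · have := (S.mem_gates q k).1 hk
      exact (if_pos ⟨this.1, this.2.1⟩).trans (congrArg _ this.2.2)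
    · rfl
  · intro u hu
    cases u with
    | fused k =>
      refine if_neg fun h => hu (S.hi k) (.inl ⟨k, ?_, rfl⟩)
      exact (S.mem_gates _ k).2 ⟨h.1, h.2, rfl⟩
    | exit q => exact absurd (.inr rfl) (hu q)
    | _ => rfl
  · rintro q u (rfl | ⟨k, hk, rfl⟩ | rfl) <;> rfl
  · intro q
    have := (S.gates_nodup q).map (f := (Site.fused : P.Idx → Site Q P.Idx))
      fun a b h => by injection h
    simp [List.nodup_append, this]
  · exact fun q b _ => P.inl_notMem_inList b q
  · rintro q b hb (⟨k, hk, h⟩ | h)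
    · rcases hb with rfl | ⟨k', hk', rfl⟩ | rfl <;> simp at h
    · exact P.inl_notMem_outList _ _ h
  · intro q h
    rw [hmap, mergedLinks] at h
    obtain ⟨k, hk, h⟩ := Multiset.mem_bind.1 h
    simp at h

theorem circuit_rewrites_merged [Fintype Q] : ZXGraph.Rewrites S.circuit P.merged :=
  S.circuit_rewrites_gate.trans' (S.gate_rewrites_fused.trans' S.fused_rewrites_merged)

end Schedule

end Pattern

/-! ### The diagram of the pattern -/

theorem List.eq_filter_stages {X : Type} (t : X → ℕ) (l : List X) (h : l.Pairwise fun a b => t a ≤ t b)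
    (h3 : ∀ a ∈ l, t a ≤ 3) :
    l = l.filter (fun a => t a = 0) ++ (l.filter (fun a => t a = 1) ++
      (l.filter (fun a => t a = 2) ++ l.filter fun a => t a = 3)) := by
  induction l with
  | nil => rfl
  | cons a l ih =>
    rw [List.pairwise_cons] at h
    have ih := ih h.2 fun b hb => h3 b (List.mem_cons_of_mem _ hb)
    have hlow : ∀ s, s < t a → l.filter (fun b => t b = s) = [] := by
      intro s hs
      rw [List.filter_eq_nil_iff]
      intro b hb
      have := h.1 b hb
      simp only [decide_eq_true_eq]
      omega
    have ha := h3 a (by simp)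
    conv_lhs => rw [ih]
    simp only [List.filter_cons]
    have hcases : t a = 0 ∨ t a = 1 ∨ t a = 2 ∨ t a = 3 := by omega
    rcases hcases with h' | h' | h' | h'
    · simp [h']
    · simp [h', hlow 0 (by omega)]
    · simp [h', hlow 0 (by omega), hlow 1 (by omega)]
    · simp [h', hlow 0 (by omega), hlow 1 (by omega), hlow 2 (by omega)]

theorem List.flatMap_filter' {X Y : Type} (p : X → Prop) [DecidablePred p] (f : X → List Y) (l : List X) :
    (l.filter fun a => p a).flatMap f = l.flatMap fun a => if p a then f a else [] := by
  induction l with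
  | nil => rfl
  | cons a l ih => by_cases h : p a <;> simp [h, ih]

theorem Multiset.bind_filter' {X Y : Type} (p : X → Prop) (f : X → Multiset Y) (s : Multiset X) :
    (s.filter p).bind f = s.bind fun a => if p a then f a else 0 := by
  induction s using Multiset.induction with
  | empty => rfl
  | cons a s ih => by_cases h : p a <;> simp [h, ih]

namespace ZXGraph

theorem chain_eq_zip {X : Type} (l : List X) :
    chain l = ↑((l.zip l.tail).map fun x => s(x.1, x.2)) := by
  induction l with
  | nil => rfl
  | cons a l ih =>
    cases l with
    | nil => rfl
    | cons b l => rw [chain_cons_cons, ih]; rfl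

/-- Every edge lost has an endpoint in the discarded tail, and every edge within the head survives.
This computes the effect of deleting the measurements once they have been listed last. -/
theorem chain_filter_append {X : Type} (p : X → Prop) (q : Sym2 X → Prop)
    (hq : ∀ a b, q s(a, b) ↔ p a ∧ p b) (l₁ l₂ : List X) (h₁ : ∀ x ∈ l₁, p x) (h₂ : ∀ x ∈ l₂, ¬ p x) :
    (chain (l₁ ++ l₂)).filter q = chain l₁ := by
  induction l₁ with
  | nil =>
    simp only [List.nil_append, chain_nil, Multiset.filter_eq_nil]
    intro e he
    induction e with | _ a b
    rw [hq]
    exact fun h => h₂ a (mem_of_mem_chain he (by simp)) h.1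
  | cons a l₁ ih =>
    rw [List.forall_mem_cons] at h₁
    cases l₁ with
    | nil =>
      have := ih h₁.2
      cases l₂ with
      | nil => simp
      | cons b l₂ =>
        have hb : ¬ q s(a, b) := fun h => h₂ b (by simp) ((hq a b).1 h).2
        simp only [List.cons_append, List.nil_append, chain_cons_cons] at this ⊢
        rw [Multiset.filter_cons_of_neg _ hb, this]
        rfl
    | cons b l₁ =>
      have hab : q s(a, b) := (hq a b).2 ⟨h₁.1, h₁.2 b (by simp)⟩
      simp only [List.cons_append, chain_cons_cons] at ih ⊢
      rw [Multiset.filter_cons_of_pos _ hab, ih h₁.2]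

end ZXGraph

namespace Pattern

variable {Q : Type} (P : Pattern Q)

/-- The site of the `j`-th vertex of the diagram of the `k`-th command. -/
def siteName {K : Type} (c : Command Q) (k : K) (j : ℕ) : Site Q K :=
  match c with
  | .N i => .start i
  | .E _ _ => if j = 0 then .left k else if j = 1 then .had k else .right k
  | .M _ _ _ _ => .left k
  | .X _ _ => .corr k
  | .Z _ _ => .corr k

def site (x : P.Node) : Site Q P.Idx := siteName (P.cmd x.1) x.1 x.2.val

/-- The sites of the vertices of the `k`-th command on the wire `q`. -/
noncomputable def siteList {K : Type} (c : Command Q) (k : K) (q : Q) : List (Site Q K) :=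
  ((List.finRange c.nodes.length).filter fun j => (c.nodes.get j).1 = some q).map
    fun j => siteName c k j.val

theorem siteList_N {K : Type} (i : Q) (k : K) (q : Q) :
    siteList (.N i) k q = if i = q then [.start q] else [] := by
  change ((List.finRange 1).filter fun j => (((Command.N i).nodes).get j).1 = some q).map _ = _
  simp only [List.finRange_succ, List.finRange_zero, List.map_nil]
  by_cases h : i = q
  · subst h; simp [Command.nodes, siteName]
  · simp [Command.nodes, h]

theorem siteList_E {K : Type} (i j : Q) (k : K) (q : Q) :
    siteList (.E i j) k q =
      (if i = q then [.left k] else []) ++ (if j = q then [.right k] else []) := by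
  change ((List.finRange 3).filter fun a => (((Command.E i j).nodes).get a).1 = some q).map _ = _
  simp only [List.finRange_succ, List.finRange_zero, List.map_nil, List.map_cons]
  by_cases h : i = q <;> by_cases h' : j = q <;> simp [Command.nodes, h, h', siteName]

theorem siteList_corr {K : Type} (c : Command Q) (hc : c.stage = 3) (k : K) (q : Q) :
    siteList c k q = if c.fst = q then [.corr k] else [] := by
  cases c with
  | X i s =>
    change ((List.finRange 1).filter fun j => (((Command.X i s).nodes).get j).1 = some q).map _ = _
    simp only [List.finRange_succ, List.finRange_zero, List.map_nil]
    by_cases h : i = q <;> simp [Command.nodes, h, siteName, Command.fst]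
  | Z i s =>
    change ((List.finRange 1).filter fun j => (((Command.Z i s).nodes).get j).1 = some q).map _ = _
    simp only [List.finRange_succ, List.finRange_zero, List.map_nil]
    by_cases h : i = q <;> simp [Command.nodes, h, siteName, Command.fst]
  | _ => simp [Command.stage] at hc

theorem siteName_injective {K : Type} (c : Command Q) (hc : c.stage ≠ 2) (k : K)
    (j j' : Fin c.nodes.length) (h : siteName c k j.val = siteName c k j'.val) : j = j' := by
  cases c with
  | N i => exact Subsingleton.elim (α := Fin 1) j j'
  | X i => exact Subsingleton.elim (α := Fin 1) j j'
  | Z i => exact Subsingleton.elim (α := Fin 1) j j'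
  | M => simp [Command.stage] at hc
  | E a b =>
    have hj : j.val < 3 := j.2
    have hj' : j'.val < 3 := j'.2
    apply Fin.ext
    revert h hj hj'
    generalize j.val = m
    generalize j'.val = n
    intro h hm hn
    interval_cases m <;> interval_cases n <;> first | rfl | simp [siteName] at h

theorem siteKind_siteName (c : Command Q) (hc : c.stage ≠ 2) (k : P.Idx) (hk : P.cmd k = c)
    (j : Fin c.nodes.length) : P.siteKind (siteName c k j.val) = (c.nodes.get j).2 := by
  cases c with
  | N i =>
    change Fin 1 at j
    fin_cases j; rfl
  | X i =>
    change Fin 1 at j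
    fin_cases j
    simp [siteName, siteKind, hk, Command.corrKind, Command.nodes]
  | Z i =>
    change Fin 1 at j
    fin_cases j
    simp [siteName, siteKind, hk, Command.corrKind, Command.nodes]
  | M => simp [Command.stage] at hc
  | E a b =>
    change Fin 3 at j
    fin_cases j <;> rfl

/-! ### Positions of commands in standard form -/

theorem measures_iff (c : Command Q) : (∃ q, c.Measures q) ↔ c.stage = 2 := by
  cases c <;> simp [Command.Measures, Command.stage]

theorem measures_iff' (c : Command Q) (q : Q) : c.Measures q ↔ c.stage = 2 ∧ c.fst = q := by
  cases c <;> simp [Command.Measures, Command.stage, Command.fst, eq_comm]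

theorem initialises_iff (c : Command Q) (q : Q) : c.Initialises q ↔ c = .N q := by
  cases c <;> simp [Command.Initialises, eq_comm]

theorem corrects_iff (c : Command Q) (q : Q) : c.Corrects q ↔ c.stage = 3 ∧ c.fst = q := by
  cases c <;> simp [Command.Corrects, Command.stage, Command.fst, eq_comm]

theorem mem_commands {c : Command Q} : c ∈ P.commands ↔ ∃ k, P.cmd k = c := List.mem_iff_get

theorem stage_mono (hs : P.IsStandard) {k k' : P.Idx} (h : k < k') :
    (P.cmd k).stage ≤ (P.cmd k').stage := by
  obtain ⟨ns, es, ms, cs, he, hn, hE, hm, hc⟩ := hs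
  have hn : ∀ c ∈ ns, c.stage = 0 := fun c hc' => by
    obtain ⟨q, hq⟩ := hn c hc'
    rw [(initialises_iff c q).1 hq]; rfl
  have hE : ∀ c ∈ es, c.stage = 1 := fun c hc' => by
    obtain ⟨u, v, hq⟩ := hE c hc'
    cases c <;> simp_all [Command.Entangles, Command.stage]
  have hm : ∀ c ∈ ms, c.stage = 2 := fun c hc' => (measures_iff c).1 (hm c hc')
  have hc : ∀ c ∈ cs, c.stage = 3 := fun c hc' => by
    obtain ⟨q, hq⟩ := hc c hc'
    exact ((corrects_iff c q).1 hq).1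
  have hpair : P.commands.Pairwise fun a b => a.stage ≤ b.stage := by
    have hconst : ∀ (l : List (Command Q)) s, (∀ c ∈ l, c.stage = s) →
        l.Pairwise fun a b => a.stage ≤ b.stage := by
      intro l s hl
      refine List.pairwise_of_forall_mem_list fun a ha b hb => ?_
      rw [hl a ha, hl b hb]
    rw [he]
    simp only [List.pairwise_append, List.mem_append]
    refine ⟨⟨⟨hconst _ _ hn, hconst _ _ hE, ?_⟩, hconst _ _ hm, ?_⟩, hconst _ _ hc, ?_⟩
    · intro a ha b hb; rw [hn a ha, hE b hb]; omega
    · rintro a (ha | ha) b hb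
      · rw [hn a ha, hm b hb]; omega
      · rw [hE a ha, hm b hb]; omega
    · rintro a ((ha | ha) | ha) b hb
      · rw [hn a ha, hc b hb]; omega
      · rw [hE a ha, hc b hb]; omega
      · rw [hm a ha, hc b hb]; omega
  exact List.pairwise_iff_get.1 hpair k k' h

theorem stage_le (c : Command Q) : c.stage ≤ 3 := by cases c <;> simp [Command.stage]

theorem split_at (k : P.Idx) :
    P.commands = P.commands.take k ++ P.cmd k :: P.commands.drop (k + 1) := by
  have h := List.take_append_drop k.val P.commands
  rw [List.drop_eq_getElem_cons k.2] at h
  exact h.symm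

theorem mem_drop {k k' : P.Idx} (h : k < k') : P.cmd k' ∈ P.commands.drop (k + 1) := by
  rw [List.mem_drop_iff_getElem]
  have h1 : k.val < k'.val := h
  have h2 := k'.2
  refine ⟨k'.val - (k.val + 1), by omega, ?_⟩
  simp only [cmd, List.get_eq_getElem]
  congr 1
  omega

theorem mem_take {k k' : P.Idx} (h : k' < k) : P.cmd k' ∈ P.commands.take k := by
  rw [List.mem_take_iff_getElem]
  exact ⟨k', lt_min h k'.2, rfl⟩

/-- The later of two initialisations would not be the first command on its qubit. This matters
because the vertex of `N` is named by the qubit and not by the position of the command. -/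
theorem init_unique {k k' : P.Idx} {q : Q} (h : P.cmd k = .N q) (h' : P.cmd k' = .N q) : k = k' := by
  have key : ∀ a b : P.Idx, P.cmd a = .N q → P.cmd b = .N q → ¬ a < b := by
    intro a b ha hb hab
    refine P.init_first _ _ _ (P.split_at b) q (by rw [hb]; rfl) _ (P.mem_take hab) (.inl ?_)
    rw [ha]; rfl
  rcases lt_trichotomy k k' with hlt | heq | hlt
  exacts [absurd hlt (key _ _ h h'), heq, absurd hlt (key _ _ h' h)]

theorem mem_inputs {q : Q} : q ∈ P.inputs ↔ ∀ k, P.cmd k ≠ .N q := by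
  simp only [inputs, Set.mem_ofPred_eq, initialises_iff]
  constructor
  · exact fun h k hk => h _ (P.mem_commands.2 ⟨k, rfl⟩) hk
  · rintro h c hc rfl
    obtain ⟨k, hk⟩ := P.mem_commands.1 hc
    exact h k hk

theorem mem_outputs {q : Q} : q ∈ P.outputs ↔ ∀ k, (P.cmd k).stage = 2 → (P.cmd k).fst ≠ q := by
  simp only [outputs, Set.mem_ofPred_eq, measures_iff']
  constructor
  · exact fun h k hk hq => h _ (P.mem_commands.2 ⟨k, rfl⟩) ⟨hk, hq⟩
  · rintro h c hc hq
    obtain ⟨k, rfl⟩ := P.mem_commands.1 hc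
    exact h k hq.1 hq.2

/-- A correction before the measurement violates the standard form, and one after it violates
`measure_last`. -/
theorem corrs_eq_nil (hs : P.IsStandard) {q : Q} (hq : q ∉ P.outputs) : P.corrs q = [] := by
  rw [List.eq_nil_iff_forall_not_mem]
  intro k hk
  rw [mem_corrs] at hk
  rw [mem_outputs] at hq
  push Not at hq
  obtain ⟨k', hk', hq⟩ := hq
  rcases lt_trichotomy k k' with h | h | h
  · have := P.stage_mono hs h
    omega
  · subst h; omega
  · refine P.measure_last _ _ _ (P.split_at k') q ((measures_iff' _ _).2 ⟨hk', hq⟩) _ (P.mem_drop h) ?_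
    exact .inr (.inr (.inr ((corrects_iff _ _).2 hk)))

/-! ### Deleting the measurements from the wires -/

/-- The wires of the diagram of the pattern, without the measurements. -/
noncomputable def initWire (q : Q) : List P.Vtx :=
  P.inList q ++ ((if q ∈ P.inputs then [] else [Sum.inl (.start q)]) ++
    ((P.entList q).map Sum.inl ++ ((P.corrs q).map (fun k => Sum.inl (.corr k)) ++ P.outList q)))

/-- The vertices of the `k`-th command on the wire `q`. -/
noncomputable def nodeList (q : Q) (k : P.Idx) : List (P.Node ⊕ (P.inputs ⊕ P.outputs)) :=
  ((List.finRange (P.commands.get k).nodes.length).filter fun j =>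
    ((P.commands.get k).nodes.get j).1 = some q).map fun j => Sum.inl ⟨k, j⟩

theorem nodeList_map (q : Q) (k : P.Idx) : (P.nodeList q k).map (Sum.map P.site id) =
    (siteList (P.cmd k) k q).map Sum.inl := by
  rw [nodeList, siteList, List.map_map, List.map_map]
  rfl

noncomputable def atStage (s : ℕ) : List P.Idx :=
  (List.finRange P.commands.length).filter fun k => (P.cmd k).stage = s

theorem mem_atStage {s : ℕ} {k : P.Idx} : k ∈ P.atStage s ↔ (P.cmd k).stage = s := by
  simp [atStage]

/-- An output carries no measurement, and any other qubit carries neither a correction nor an output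
vertex. On each wire the measurement vertices may thus be listed last, and deleting them truncates
the wire. -/
theorem wire_eq (hs : P.IsStandard) (q : Q) : P.wire q =
    ((if h : q ∈ P.inputs then [Sum.inr (Sum.inl ⟨q, h⟩)] else []) ++
      ((P.atStage 0).flatMap (P.nodeList q) ++ ((P.atStage 1).flatMap (P.nodeList q) ++
        ((P.atStage 3).flatMap (P.nodeList q) ++
          (if h : q ∈ P.outputs then [Sum.inr (Sum.inr ⟨q, h⟩)] else []))))) ++
      (P.atStage 2).flatMap (P.nodeList q) := by
  have hsplit : List.finRange P.commands.length =
      P.atStage 0 ++ (P.atStage 1 ++ (P.atStage 2 ++ P.atStage 3)) :=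
    List.eq_filter_stages (fun k => (P.cmd k).stage) _
      ((List.pairwise_lt_finRange _).imp fun h => P.stage_mono hs h) fun _ _ => stage_le _
  have hwire : P.wire q = (if h : q ∈ P.inputs then [Sum.inr (Sum.inl ⟨q, h⟩)] else []) ++
      (List.finRange P.commands.length).flatMap (P.nodeList q) ++
      (if h : q ∈ P.outputs then [Sum.inr (Sum.inr ⟨q, h⟩)] else []) := rfl
  rw [hwire, hsplit]
  have hnil : ∀ k, (P.cmd k).fst ≠ q → (P.cmd k).stage = 2 ∨ (P.cmd k).stage = 3 →
      P.nodeList q k = [] := by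
    intro k hk hst
    rw [nodeList, List.map_eq_nil_iff, List.filter_eq_nil_iff]
    intro j _
    have hnode : ∀ c : Command Q, (c.stage = 2 ∨ c.stage = 3) → ∀ x ∈ c.nodes, x.1 = some c.fst := by
      intro c hc x hx
      cases c with
      | M i α s t =>
        simp only [Command.nodes, List.mem_append, List.mem_cons, List.not_mem_nil, or_false] at hx
        rcases hx with (hx | hx) | hx
        · split_ifs at hx <;> simp_all [Command.fst]
        · split_ifs at hx <;> simp_all [Command.fst]
        · rcases hx with rfl | rfl <;> rfl
      | X i s => simp only [Command.nodes, List.mem_singleton] at hx; subst hx; rfl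
      | Z i s => simp only [Command.nodes, List.mem_singleton] at hx; subst hx; rfl
      | _ => simp [Command.stage] at hc
    have := hnode _ hst _ (List.get_mem (P.cmd k).nodes j)
    simp only [decide_eq_true_eq]
    intro h
    exact hk (Option.some_injective _ (this.symm.trans h))
  simp only [List.flatMap_append]
  by_cases hq : q ∈ P.outputs
  · have h2 : (P.atStage 2).flatMap (P.nodeList q) = [] := by
      rw [List.flatMap_eq_nil_iff]
      intro k hk
      rw [mem_atStage] at hk
      exact hnil k (P.mem_outputs.1 hq k hk) (.inl hk)
    simp [h2]
  · have h3 : (P.atStage 3).flatMap (P.nodeList q) = [] := by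
      rw [List.flatMap_eq_nil_iff]
      intro k hk
      rw [mem_atStage] at hk
      refine hnil k (fun h => ?_) (.inr hk)
      have := P.mem_corrs.2 ⟨hk, h⟩
      rw [P.corrs_eq_nil hs hq] at this
      simp at this
    simp [h3, hq]

theorem flatMap_map_site (q : Q) (l : List P.Idx) :
    (l.flatMap (P.nodeList q)).map (Sum.map P.site id) =
      (l.flatMap fun k => siteList (P.cmd k) k q).map Sum.inl := by
  rw [List.map_flatMap, List.map_flatMap]
  congr 1
  funext k
  exact P.nodeList_map q k

theorem stage_zero_sites (q : Q) : ((P.atStage 0).flatMap fun k => siteList (P.cmd k) k q) =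
    if q ∈ P.inputs then [] else [.start q] := by
  have h : ((P.atStage 0).flatMap fun k => siteList (P.cmd k) k q) =
      ((List.finRange P.commands.length).filter fun k => P.cmd k = .N q).flatMap
        fun _ => [.start q] := by
    rw [atStage, List.flatMap_filter', List.flatMap_filter']
    congr 1
    funext k
    cases hc : P.cmd k with
    | N i => simp [Command.stage, siteList_N]
    | _ => simp [Command.stage]
  rw [h]
  split_ifs with hq
  · rw [List.flatMap_eq_nil_iff]
    intro k hk
    rw [List.mem_filter] at hk
    exact absurd (by simpa using hk.2) (P.mem_inputs.1 hq k)
  · rw [mem_inputs] at hq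
    push Not at hq
    obtain ⟨k, hk⟩ := hq
    have : ((List.finRange P.commands.length).filter fun k => P.cmd k = .N q) = [k] := by
      rw [← List.perm_singleton, List.perm_ext_iff_of_nodup
        ((List.nodup_finRange _).filter _) (List.nodup_singleton _)]
      intro k'
      simp only [List.mem_filter, List.mem_finRange, true_and, decide_eq_true_eq,
        List.mem_singleton]
      exact ⟨fun h' => P.init_unique h' hk, fun h' => h' ▸ hk⟩
    rw [this]
    rfl

theorem stage_one_sites (q : Q) :
    ((P.atStage 1).flatMap fun k => siteList (P.cmd k) k q) = P.entList q := by
  rw [atStage, List.flatMap_filter', entList]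
  congr 1
  funext k
  cases hc : P.cmd k with
  | E i j =>
    simp only [IsE, hc, Command.stage, siteList_E, Command.fst, Command.snd, if_true]
    by_cases h : i = q <;> by_cases h' : j = q <;> simp only [h, h', if_true, if_false]
  | _ => simp [IsE, hc, Command.stage]

theorem stage_three_sites (q : Q) :
    ((P.atStage 3).flatMap fun k => siteList (P.cmd k) k q) = (P.corrs q).map .corr := by
  rw [← List.flatMap_singleton' ((P.corrs q).map _), List.flatMap_map, corrs, atStage,
    List.flatMap_filter', List.flatMap_filter']
  congr 1
  funext k
  by_cases h3 : (P.cmd k).stage = 3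
  · simp only [h3, if_true, true_and, siteList_corr _ h3]
  · simp [h3]

/-- The vertices of the diagram of the pattern that do not belong to measurements. -/
def Kept (x : P.Node) : Prop := ¬ ∃ q, (P.commands.get x.1).Measures q

theorem kept_iff (x : P.Node) : P.Kept x ↔ (P.cmd x.1).stage ≠ 2 :=
  not_congr (measures_iff _)

/-- An input wire has no initial spider, so an identity is inserted behind its boundary vertex. This
requires an edge there, and `hwire` provides a next vertex: an end of an entangling command or the
output. -/
theorem inits_rewrites_open [Fintype Q] (hwire : ∀ q ∈ P.inputs, (P.entList q) ≠ [] ∨ q ∈ P.outputs) :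
    ZXGraph.Rewrites
      (ZXGraph.net P.siteKind ((Finset.univ : Finset Q).val.map P.openWire) P.openLinks)
      (ZXGraph.net P.siteKind ((Finset.univ : Finset Q).val.map P.initWire) P.openLinks) := by
  have hhome : ∀ q, ∀ x ∈ P.openWire q, P.openHome x = q := by
    intro q x hx
    simp only [openWire, List.mem_append, List.mem_cons, List.mem_map] at hx
    rcases hx with hx | rfl | ⟨u, hu, rfl⟩ | ⟨k, hk, rfl⟩ | hx
    · exact P.inList_home (fun _ => rfl) q hx
    · rfl
    · rcases P.mem_entList.1 hu with ⟨k, -, h, rfl⟩ | ⟨k, -, h, rfl⟩ <;> exact h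
    · exact (P.mem_corrs.1 hk).2
    · exact P.outList_home (fun _ => rfl) q hx
  refine ZXGraph.net_all_wires (fun _ => P.openLinks) P.openHome hhome ?_ ?_
  · intro q x hx
    refine hhome q x ?_
    simp only [initWire, openWire, List.mem_append, List.mem_cons] at hx ⊢
    split_ifs at hx
    · simp only [List.not_mem_nil, false_or] at hx
      tauto
    · simp only [List.mem_singleton] at hx
      tauto
  · intro q T W _ hW
    unfold openWire initWire
    split_ifs with hq
    · refine ZXGraph.net_remove_identity (c := .Z) rfl ?_ ?_ (P.inl_notMem_inList _ _) ?_ ?_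
      · simp [inList, hq]
      · rcases hwire q hq with h | h
        · simp [h]
        · simp [outList, h]
      · simp only [List.mem_append, List.mem_map, not_or]
        refine ⟨?_, ?_, P.inl_notMem_outList _ _⟩
        · rintro ⟨u, hu, h⟩
          cases h
          rcases P.mem_entList.1 hu with ⟨k, -, h, h'⟩ | ⟨k, -, h, h'⟩ <;> cases h'
        · rintro ⟨u, hu, h⟩
          cases h
      · rintro (⟨l, hl, h⟩ | ⟨e, he, h⟩)
        · exact hW l hl _ h rfl
        · obtain ⟨k, -, he⟩ := Multiset.mem_bind.1 he
          simp only [Multiset.insert_eq_cons, Multiset.mem_cons, Multiset.mem_singleton] at he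
          rcases he with rfl | rfl <;> simp at h
    · exact Relation.EqvGen.refl _

theorem wireEdges_map (hs : P.IsStandard) (q : Q) :
    ((P.wireEdges q).filter (ZXGraph.EndsIn {x | P.Kept x})).map (ZXGraph.mapEdge P.site) =
      ZXGraph.chain (P.initWire q) := by
  rw [wireEdges, ← ZXGraph.chain_eq_zip, P.wire_eq hs]
  have hmemNode : ∀ s, ∀ x ∈ (P.atStage s).flatMap (P.nodeList q),
      ∃ y : P.Node, x = Sum.inl y ∧ (P.cmd y.1).stage = s := by
    intro s x hx
    obtain ⟨k, hk, hx⟩ := List.mem_flatMap.1 hx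
    obtain ⟨j, -, rfl⟩ := List.mem_map.1 hx
    exact ⟨_, rfl, P.mem_atStage.1 hk⟩
  rw [ZXGraph.chain_filter_append (fun x => ∀ y, x = Sum.inl y → P.Kept y)
    (ZXGraph.EndsIn {x | P.Kept x}) (fun a b => ZXGraph.endsIn_mk)]
  · rw [ZXGraph.mapEdge, ZXGraph.chain_map]
    congr 1
    simp only [List.map_append, flatMap_map_site, stage_zero_sites, stage_one_sites,
      stage_three_sites, initWire]
    congr 1
    · unfold inList
      split_ifs <;> rfl
    · congr 1
      · split_ifs <;> rfl
      · congr 1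
        congr 1
        · rw [List.map_map]; rfl
        · unfold outList
          split_ifs <;> rfl
  · intro x hx y hxy
    subst hxy
    rw [kept_iff]
    simp only [List.mem_append] at hx
    rcases hx with hx | hx | hx | hx | hx
    · split_ifs at hx <;> simp at hx
    · obtain ⟨y', h, h'⟩ := hmemNode _ _ hx
      cases h; omega
    · obtain ⟨y', h, h'⟩ := hmemNode _ _ hx
      cases h; omega
    · obtain ⟨y', h, h'⟩ := hmemNode _ _ hx
      cases h; omega
    · split_ifs at hx <;> simp at hx
  · intro x hx h
    obtain ⟨y, rfl, h'⟩ := hmemNode _ _ hx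
    exact (P.kept_iff y).1 (h y rfl) h'

theorem linkEdges_map :
    (P.linkEdges.filter (ZXGraph.EndsIn {x | P.Kept x})).map (ZXGraph.mapEdge P.site) =
      P.openLinks := by
  have hlinks : ∀ c : Command Q, c.stage ≠ 1 → c.links = [] := by
    intro c hc
    cases c <;> first | rfl | exact absurd rfl hc
  rw [Multiset.filter_eq_self.2]
  · rw [linkEdges, openLinks, ents, Finset.filter_val, Multiset.bind_filter', Multiset.map_bind]
    refine Multiset.bind_congr fun k _ => ?_
    rw [Multiset.map_coe, List.map_map]
    have key : ∀ c : Command Q, ((c.links.map fun x =>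
        s((Sum.inl (siteName c k x.1.val) : P.Vtx), Sum.inl (siteName c k x.2.val)) : List _) :
          Multiset (Sym2 P.Vtx)) = if c.stage = 1 then {s(Sum.inl (.left k), Sum.inl (.had k)),
            s(Sum.inl (.had k), Sum.inl (.right k))} else 0 := by
      intro c
      cases c with
      | E i j => rfl
      | _ => simp [Command.links, Command.stage]
    refine Eq.trans (key (P.cmd k)) ?_
    by_cases h : (P.cmd k).stage = 1 <;> simp [IsE, h]
  · intro e he u hu
    obtain ⟨k, -, he⟩ := Multiset.mem_bind.1 he
    obtain ⟨x, hx, rfl⟩ := List.mem_map.1 (Multiset.mem_coe.1 he)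
    have h1 : (P.cmd k).stage = 1 := by
      by_contra h
      have := hlinks _ h
      rw [show (P.commands.get k).links = [] from this] at hx
      simp at hx
    change P.Kept u
    rw [kept_iff]
    rw [Sym2.mem_iff] at hu
    rcases hu with hu | hu <;> cases hu <;> simp [h1]

/-- The name of a surviving vertex determines its command: by position, or for an initialisation by
`init_unique`. -/
theorem site_injOn : Set.InjOn P.site {x | P.Kept x} := by
  rintro ⟨k, j⟩ hx ⟨k', j'⟩ hy h
  have hx : (P.cmd k).stage ≠ 2 := (P.kept_iff _).1 hx
  have hy : (P.cmd k').stage ≠ 2 := (P.kept_iff _).1 hy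
  have hk : k = k' := by
    simp only [site] at h
    cases hc : P.cmd k <;> cases hc' : P.cmd k' <;> rw [hc, hc'] at h <;>
      simp only [siteName] at h
    case N.N => exact P.init_unique hc (by rw [hc']; injection h with h; rw [h])
    all_goals first
      | (split_ifs at h <;> cases h <;> rfl)
      | (cases h; rfl)
      | (cases h)
  subst hk
  have := siteName_injective (P.cmd k) hx k j j' h
  rw [this]

theorem measurementFree_realizes [Fintype Q] (hs : P.IsStandard) :
    P.measurementFreeDiagram.Realizes
      (ZXGraph.sites ((Finset.univ : Finset Q).val.map P.initWire) P.openLinks) P.siteKind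
      (ZXGraph.netEdges ((Finset.univ : Finset Q).val.map P.initWire) P.openLinks) := by
  refine ZXGraph.induce_realizes P.site P.site_injOn ?_ ?_ ?_
  · ext u
    have hw : (∃ l ∈ (Finset.univ : Finset Q).val.map P.initWire, Sum.inl u ∈ l) ↔
        (∃ q, q ∉ P.inputs ∧ u = .start q) ∨ (∃ k, P.IsE k ∧ (u = .left k ∨ u = .right k)) ∨
          ∃ k, (P.cmd k).stage = 3 ∧ u = .corr k := by
      simp only [Multiset.mem_map, Finset.mem_val, Finset.mem_univ, true_and,
        exists_exists_eq_and, initWire, List.mem_append, P.inl_notMem_inList, false_or,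
        P.inl_notMem_outList, or_false, List.mem_map, Sum.inl.injEq, exists_eq_right, mem_entList,
        mem_corrs]
      constructor
      · rintro ⟨q, h | (⟨k, hk, h, rfl⟩ | ⟨k, hk, h, rfl⟩) | ⟨k, hk, rfl⟩⟩
        · split_ifs at h with hq
          · simp at h
          · exact .inl ⟨q, hq, by simpa using h⟩
        · exact .inr (.inl ⟨k, hk, .inl rfl⟩)
        · exact .inr (.inl ⟨k, hk, .inr rfl⟩)
        · exact .inr (.inr ⟨k, hk.1, rfl⟩)
      · rintro (⟨q, hq, rfl⟩ | ⟨k, hk, rfl | rfl⟩ | ⟨k, hk, rfl⟩)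
        · exact ⟨q, .inl (by simp [hq])⟩
        · exact ⟨_, .inr (.inl (.inl ⟨k, hk, rfl, rfl⟩))⟩
        · exact ⟨_, .inr (.inl (.inr ⟨k, hk, rfl, rfl⟩))⟩
        · exact ⟨_, .inr (.inr ⟨k, ⟨hk, rfl⟩, rfl⟩)⟩
    have hl : (∃ e ∈ P.openLinks, Sum.inl u ∈ e) ↔
        ∃ k, P.IsE k ∧ (u = .left k ∨ u = .had k ∨ u = .right k) := by
      simp only [openLinks, Multiset.mem_bind, mem_ents, Multiset.insert_eq_cons,
        Multiset.mem_cons, Multiset.mem_singleton]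
      constructor
      · rintro ⟨e, ⟨k, hk, rfl | rfl⟩, hu⟩ <;> rw [Sym2.mem_iff] at hu <;>
          simp only [Sum.inl.injEq] at hu <;> exact ⟨k, hk, by tauto⟩
      · rintro ⟨k, hk, rfl | rfl | rfl⟩
        · exact ⟨_, ⟨k, hk, .inl rfl⟩, by simp⟩
        · exact ⟨_, ⟨k, hk, .inl rfl⟩, by simp⟩
        · exact ⟨_, ⟨k, hk, .inr rfl⟩, by simp⟩
    rw [ZXGraph.mem_sites, hw, hl]
    constructor
    · rintro ⟨⟨k, j⟩, hx, rfl⟩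
      have hx : (P.cmd k).stage ≠ 2 := (P.kept_iff _).1 hx
      simp only [site]
      cases hc : P.cmd k with
      | N i => exact .inl (.inl ⟨i, fun h => P.mem_inputs.1 h k hc, rfl⟩)
      | E a b =>
        refine .inr ⟨k, by rw [IsE, hc]; rfl, ?_⟩
        simp only [siteName]
        split_ifs <;> simp
      | M => rw [hc] at hx; exact absurd rfl hx
      | X => exact .inl (.inr (.inr ⟨k, by rw [hc]; rfl, rfl⟩))
      | Z => exact .inl (.inr (.inr ⟨k, by rw [hc]; rfl, rfl⟩))
    · have hE : ∀ k, P.IsE k → ∀ v, (v = .left k ∨ v = .had k ∨ v = .right k) →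
          v ∈ P.site '' {x | P.Kept x} := by
        intro k hk v hv
        obtain ⟨i, j, hc, -⟩ := IsE.exists P hk
        have hlen : (P.commands.get k).nodes.length = 3 := by
          change (P.cmd k).nodes.length = 3
          rw [hc]; rfl
        have hkept : ∀ j, P.Kept ⟨k, j⟩ := fun j => (P.kept_iff _).2 (by
          change (P.cmd k).stage ≠ 2
          rw [hc]; simp [Command.stage])
        rcases hv with rfl | rfl | rfl
        · exact ⟨⟨k, ⟨0, by omega⟩⟩, hkept _, by simp [site, hc, siteName]⟩
        · exact ⟨⟨k, ⟨1, by omega⟩⟩, hkept _, by simp [site, hc, siteName]⟩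
        · exact ⟨⟨k, ⟨2, by omega⟩⟩, hkept _, by simp [site, hc, siteName]⟩
      rintro ((⟨q, hq, rfl⟩ | ⟨k, hk, h⟩ | ⟨k, hk, rfl⟩) | ⟨k, hk, h⟩)
      · rw [mem_inputs] at hq
        push Not at hq
        obtain ⟨k, hc⟩ := hq
        have hlen : (P.commands.get k).nodes.length = 1 := by
          change (P.cmd k).nodes.length = 1
          rw [hc]; rfl
        refine ⟨⟨k, ⟨0, by omega⟩⟩, (P.kept_iff _).2 ?_, by simp [site, hc, siteName]⟩
        change (P.cmd k).stage ≠ 2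
        rw [hc]; simp [Command.stage]
      · exact hE k hk u (by tauto)
      · have hlen : (P.commands.get k).nodes.length = 1 := by
          change (P.cmd k).nodes.length = 1
          cases hc : P.cmd k <;> first | rfl | (rw [hc] at hk; simp [Command.stage] at hk)
        refine ⟨⟨k, ⟨0, by omega⟩⟩, (P.kept_iff _).2 ?_, ?_⟩
        · change (P.cmd k).stage ≠ 2
          omega
        · simp only [site]
          cases hc : P.cmd k <;> first | rfl | (rw [hc] at hk; simp [Command.stage] at hk)
      · exact hE k hk u h
  · rintro ⟨k, j⟩ hx
    exact P.siteKind_siteName (P.cmd k) ((P.kept_iff _).1 hx) k rfl j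
  · have h : (((((Finset.univ : Finset Q).val.bind fun q => P.wireEdges q) + P.linkEdges).filter
        (ZXGraph.EndsIn {x | P.Kept x})).map (ZXGraph.mapEdge P.site)) =
        ZXGraph.netEdges ((Finset.univ : Finset Q).val.map P.initWire) P.openLinks := ?_
    · exact h
    rw [Multiset.filter_add, Multiset.map_add, P.linkEdges_map, ZXGraph.netEdges,
      Multiset.filter_bind, Multiset.map_bind, Multiset.bind_map]
    congr 1
    exact Multiset.bind_congr fun q _ => P.wireEdges_map hs q

theorem measurementFree_rewrites_merged [Fintype Q] (hs : P.IsStandard)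
    (hwire : ∀ q ∈ P.inputs, (P.entList q) ≠ [] ∨ q ∈ P.outputs) :
    P.measurementFreeDiagram.Rewrites P.merged :=
  (((P.measurementFree_realizes hs).iso (ZXGraph.net_realizes _ _ _)
    fun _ _ => rfl).rewrites.trans' (P.inits_rewrites_open hwire).symm').trans'
    P.open_rewrites_merged

end Pattern

namespace ZXGraph

variable {𝒱 I O U : Type}

/-! ### Drawn circuit-like diagrams -/

/-- The degree of a vertex in a multiset of edges. -/
noncomputable def edgeDegree {X : Type} (E : Multiset (Sym2 X)) (x : X) : ℕ :=
  (E.bind fun e => e.toMultiset).count x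

theorem traverses_iff {X : Type} {l : List X} {a b : X} :
    Traverses l a b ↔ ∃ l₁ l₂, l = l₁ ++ a :: b :: l₂ := by
  unfold Traverses
  constructor
  · rintro ⟨l₁, l₂, h⟩
    exact ⟨l₁, l₂, by simp [← h]⟩
  · rintro ⟨l₁, l₂, h⟩
    exact ⟨l₁, l₂, by simp [h]⟩

theorem rel_of_traverses {X : Type} {R : X → X → Prop} {l : List X} (h : l.IsChain R) {a b : X}
    (hab : Traverses l a b) : R a b := by
  obtain ⟨l₁, l₂, h'⟩ := traverses_iff.1 hab
  exact List.isChain_iff_forall_rel_of_append_cons_cons.1 h h'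

theorem isChain_of_traverses {X : Type} {R : X → X → Prop} {l : List X}
    (h : ∀ a b, Traverses l a b → R a b) : l.IsChain R :=
  List.isChain_iff_forall_rel_of_append_cons_cons.2 fun a b l₁ l₂ hl =>
    h a b (traverses_iff.2 ⟨l₁, l₂, hl⟩)

theorem Traverses.map {X Y : Type} {l : List X} {a b : X} (h : Traverses l a b) (f : X → Y) :
    Traverses (l.map f) (f a) (f b) := by
  obtain ⟨l₁, l₂, rfl⟩ := traverses_iff.1 h
  exact traverses_iff.2 ⟨l₁.map f, l₂.map f, by simp⟩

theorem traverses_of_map {X Y : Type} {f : X → Y} (hf : Function.Injective f) {l : List X} {a b : X}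
    (h : Traverses (l.map f) (f a) (f b)) : Traverses l a b := by
  obtain ⟨l₁, l₂, h⟩ := traverses_iff.1 h
  rw [List.map_eq_append_iff] at h
  obtain ⟨m₁, m₂, rfl, rfl, h⟩ := h
  obtain ⟨a', m₂, rfl, ha, h⟩ := List.map_eq_cons_iff.1 h
  obtain ⟨b', m₂, rfl, hb, h⟩ := List.map_eq_cons_iff.1 h
  rw [hf ha, hf hb]
  exact traverses_iff.2 ⟨_, _, rfl⟩

/-- A quantity that never decreases along a closed walk is constant on it. -/
theorem eq_of_closed_monotone {X : Type} (Φ : X → ℕ) (v : X) (l : List X)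
    (h : (v :: l ++ [v]).IsChain fun a b => Φ a ≤ Φ b) : ∀ x ∈ v :: l, Φ x = Φ v := by
  have hp : (v :: l ++ [v]).Pairwise fun a b => Φ a ≤ Φ b := by
    have : IsTrans X fun a b => Φ a ≤ Φ b := ⟨fun _ _ _ => le_trans⟩
    exact List.isChain_iff_pairwise.1 h
  intro x hx
  rw [List.pairwise_append] at hp
  refine le_antisymm (hp.2.2 x hx v (by simp)) ?_
  rcases List.mem_cons.1 hx with rfl | hx
  · exact le_rfl
  · exact (List.pairwise_cons.1 hp.1).1 x hx

/-- The potential `Φ` increases along the paths and is constant across all other edges. On a cycle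
that never runs against a path it cannot decrease, so it is constant, which no path edge allows.
Strict increase also prevents a path from repeating a vertex. -/
theorem drawn_isCircuitLike {S : Set U} {k : U → Kind 𝒱} {E : Multiset (Sym2 (U ⊕ (I ⊕ O)))}
    (hE : ∀ e ∈ E, EndsIn S e) (paths : Set (List (U ⊕ (I ⊕ O)))) (Φ : U ⊕ (I ⊕ O) → ℕ)
    (hchain : ∀ p ∈ paths, p.IsChain fun a b => s(a, b) ∈ E ∧ Φ a < Φ b)
    (hlast : ∀ p ∈ paths, ∃ o, p.getLast? = some (Sum.inr (Sum.inr o)))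
    (hmem : ∀ p ∈ paths, ∀ u, Sum.inl u ∈ p → u ∈ S)
    (hdisj : ∀ p ∈ paths, ∀ q ∈ paths, p ≠ q → p.Disjoint q)
    (hcover : ∀ x, (∀ u, x = Sum.inl u → u ∈ S) → ∃ p ∈ paths, x ∈ p)
    (hedge : ∀ a b, s(a, b) ∈ E → (∃ p ∈ paths, Traverses p a b ∨ Traverses p b a) ∨ Φ a = Φ b)
    (hnodup : E.Nodup) (hdiag : ∀ e ∈ E, ¬ e.IsDiag)
    (htype : ∀ u v, s(Sum.inl u, Sum.inl v) ∈ E → (k u).type ≠ (k v).type) :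
    (drawn S k E).IsCircuitLike := by
  let ι : (drawn S k E).Vertex → U ⊕ (I ⊕ O) := Sum.map (Subtype.val : S → U) id
  have hι : Function.Injective ι := Subtype.val_injective.sumMap Function.injective_id
  have hmapE : (drawn S k E).edges.map (Sym2.map ι) = E := drawn_edges_map hE
  have hadj : ∀ a b, (drawn S k E).Adj a b ↔ s(ι a, ι b) ∈ E := by
    intro a b
    conv_rhs => rw [← hmapE]
    exact (Multiset.mem_map_of_injective (Sym2.map.injective hι) (a := s(a, b))).symm
  have hlift : ∀ p : List (U ⊕ (I ⊕ O)), (∀ u, Sum.inl u ∈ p → u ∈ S) → ∃ p' : List (drawn S k E).Vertex, p'.map ι = p := by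
    intro p hp
    induction p with
    | nil => exact ⟨[], rfl⟩
    | cons x p ih =>
      obtain ⟨p', rfl⟩ := ih fun u hu => hp u (List.mem_cons_of_mem _ hu)
      rcases x with u | x
      · exact ⟨Sum.inl ⟨u, hp u (by simp)⟩ :: p', rfl⟩
      · exact ⟨Sum.inr x :: p', rfl⟩
  have hpath : ∀ p : List (drawn S k E).Vertex, p.map ι ∈ paths → ∀ a b, Traverses p a b →
      Φ (ι a) < Φ (ι b) := fun p hp a b hab => (rel_of_traverses (hchain _ hp) (hab.map ι)).2
  refine ⟨⟨{p | p.map ι ∈ paths}, ?_, ?_, ?_, ?_⟩, ?_, ?_, ?_⟩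
  · intro p hp
    refine ⟨?_, ?_, ?_⟩
    · have h1 : (p.map ι).Pairwise fun a b => Φ a < Φ b := by
        have : IsTrans (U ⊕ (I ⊕ O)) fun a b => Φ a < Φ b := ⟨fun _ _ _ => lt_trans⟩
        exact List.isChain_iff_pairwise.1 ((hchain _ hp).imp fun _ _ h => h.2)
      have h2 : (p.map ι).Nodup := h1.imp fun h h' => by rw [h'] at h; exact lt_irrefl _ h
      exact h2.of_map
    · have := (List.isChain_map ι).1 (hchain _ hp)
      exact this.imp fun a b h => (hadj a b).2 h.1
    · obtain ⟨o, ho⟩ := hlast _ hp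
      refine ⟨o, ?_⟩
      rw [List.getLast?_map, Option.map_eq_some_iff] at ho
      obtain ⟨a, ha, hao⟩ := ho
      rw [ha]
      rcases a with a | a
      · cases hao
      · exact congrArg some (congrArg Sum.inr (Sum.inr_injective hao))
  · intro p hp q hq hpq x hxp hxq
    exact hdisj _ hp _ hq (fun h => hpq (List.map_injective_iff.2 hι h))
      (List.mem_map_of_mem hxp) (List.mem_map_of_mem hxq)
  · intro w
    obtain ⟨p, hp, hw⟩ := hcover (ι w) (by
      intro u hu
      rcases w with w | w
      · cases hu; exact w.2
      · cases hu)
    obtain ⟨p', rfl⟩ := hlift p (hmem p hp)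
    obtain ⟨w', hw', h⟩ := List.mem_map.1 hw
    exact ⟨p', hp, hι h ▸ hw'⟩
  -- One edge shared with one path already gives the contradiction; the second path is not
  -- consulted.
  · rintro γ ⟨v, l, rfl, -, -, hγ⟩ ⟨p, hp, -, -, -, ⟨a, b, hab, hpab⟩, -⟩
    by_contra hno
    have hmono : ∀ x y, Traverses (v :: l ++ [v]) x y → Φ (ι x) ≤ Φ (ι y) := by
      intro x y hxy
      have hE' := (hadj x y).1 (rel_of_traverses hγ hxy)
      rcases hedge _ _ hE' with ⟨q, hq, h⟩ | h
      · obtain ⟨q', rfl⟩ := hlift q (hmem q hq)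
        rcases h with h | h
        · exact (hpath q' hq x y (traverses_of_map hι h)).le
        · exact absurd ⟨q', hq, x, y, hxy, traverses_of_map hι h⟩ hno
      · exact h.le
    have hconst := eq_of_closed_monotone (fun x => Φ (ι x)) v l (isChain_of_traverses hmono)
    have hmemγ : ∀ x, x ∈ v :: l ++ [v] → Φ (ι x) = Φ (ι v) := by
      intro x hx
      rcases List.mem_append.1 hx with hx | hx
      · exact hconst x hx
      · rw [List.mem_singleton.1 hx]
    have ha : a ∈ v :: l ++ [v] := by
      obtain ⟨l₁, l₂, h⟩ := traverses_iff.1 hab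
      rw [h]; simp
    have hb : b ∈ v :: l ++ [v] := by
      obtain ⟨l₁, l₂, h⟩ := traverses_iff.1 hab
      rw [h]; simp
    have heq : Φ (ι a) = Φ (ι b) := (hmemγ a ha).trans (hmemγ b hb).symm
    rcases hpab with h | h
    · exact (hpath p hp a b h).ne heq
    · exact (hpath p hp b a h).ne heq.symm
  · rw [← hmapE] at hnodup
    exact hnodup.of_map
  · intro e he hd
    refine hdiag (e.map ι) (hmapE ▸ Multiset.mem_map_of_mem _ he) ?_
    induction e with | _ a b
    rw [Sym2.map_mk, Sym2.mk_isDiag_iff]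
    rw [Sym2.mk_isDiag_iff] at hd
    rw [hd]
  · intro u v huv
    exact htype _ _ ((hadj _ _).1 huv)

theorem drawn_isDiagram {S : Set U} {k : U → Kind 𝒱} {E : Multiset (Sym2 (U ⊕ (I ⊕ O)))}
    (hE : ∀ e ∈ E, EndsIn S e) (hfin : S.Finite) (hb : ∀ b, edgeDegree E (Sum.inr b) = 1)
    (hh : ∀ u ∈ S, k u = .hadamard → edgeDegree E (Sum.inl u) = 2)
    (hz : ∀ u c W, k u = .spider c 0 W → W = ∅) : (drawn S k E).IsDiagram := by
  let ι : (drawn S k E).Vertex → U ⊕ (I ⊕ O) := Sum.map (Subtype.val : S → U) id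
  have hι : Function.Injective ι := Subtype.val_injective.sumMap Function.injective_id
  have hmapE : (drawn S k E).edges.map (Sym2.map ι) = E := drawn_edges_map hE
  have hdeg : ∀ w, (drawn S k E).degree w = edgeDegree E (ι w) := by
    intro w
    rw [edgeDegree, degree, ← Multiset.count_map_eq_count' ι _ hι]
    congr 1
    conv_rhs => rw [← hmapE]
    rw [Multiset.map_bind, Multiset.bind_map]
    refine Multiset.bind_congr fun e _ => ?_
    induction e with | _ a b
    rfl
  exact ⟨hfin, fun b => (hdeg _).trans (hb b), fun v hv => (hdeg _).trans (hh v.1 v.2 hv),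
    fun v c W hv => hz v.1 c W hv⟩

/-! ### Edges of wires -/

theorem edgeDegree_add {X : Type} (E F : Multiset (Sym2 X)) (x : X) :
    edgeDegree (E + F) x = edgeDegree E x + edgeDegree F x := by
  simp [edgeDegree, Multiset.add_bind]

theorem edgeDegree_eq_zero {X : Type} {E : Multiset (Sym2 X)} {x : X} (h : ∀ e ∈ E, x ∉ e) :
    edgeDegree E x = 0 := by
  rw [edgeDegree, Multiset.count_eq_zero, Multiset.mem_bind]
  rintro ⟨e, he, hx⟩
  exact h e he (Sym2.mem_toMultiset.1 hx)

theorem edgeDegree_cons {X : Type} (a b : X) (E : Multiset (Sym2 X)) (x : X) :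
    edgeDegree (s(a, b) ::ₘ E) x =
      (if x = a then 1 else 0) + (if x = b then 1 else 0) + edgeDegree E x := by
  have : (s(a, b) : Sym2 X).toMultiset = a ::ₘ {b} := rfl
  rw [edgeDegree, Multiset.cons_bind, Multiset.count_add, this, Multiset.count_cons,
    Multiset.count_singleton, edgeDegree]
  omega

theorem edgeDegree_sum {X K : Type} {s : Finset K} {f : K → Multiset (Sym2 X)} {x : X} {k : K}
    (hk : k ∈ s) (h : ∀ k' ∈ s, k' ≠ k → ∀ e ∈ f k', x ∉ e) :
    edgeDegree (s.val.bind f) x = edgeDegree (f k) x := by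
  have hs : s.val = k ::ₘ (s.erase k).val := by
    rw [Finset.erase_val, Multiset.cons_erase hk]
  rw [hs, Multiset.cons_bind, edgeDegree_add, edgeDegree_eq_zero (E := (s.erase k).val.bind f),
    add_zero]
  intro e he
  obtain ⟨k', hk', he⟩ := Multiset.mem_bind.1 he
  exact h k' (Finset.mem_of_mem_erase hk') (Finset.ne_of_mem_erase hk') e he

theorem edgeDegree_chain_head {X : Type} {x y : X} {l : List X} (h : x ∉ y :: l) :
    edgeDegree (chain (x :: y :: l)) x = 1 := by
  rw [chain_cons_cons, edgeDegree_cons, edgeDegree_eq_zero]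
  · simp only [List.mem_cons, not_or] at h
    simp [h.1]
  · exact fun e he hx => h (mem_of_mem_chain he hx)

theorem edgeDegree_chain_last {X : Type} {x : X} {l : List X} (hl : l ≠ []) (h : x ∉ l) :
    edgeDegree (chain (l ++ [x])) x = 1 := by
  obtain ⟨l, y, rfl⟩ := (List.eq_nil_or_concat' l).resolve_left hl
  rw [List.append_assoc, List.singleton_append, chain_append_cons, edgeDegree_add,
    edgeDegree_eq_zero, chain_cons_cons, edgeDegree_cons]
  · have : x ≠ y := by rintro rfl; simp at h
    simp [this, edgeDegree]
  · exact fun e he hx => h (mem_of_mem_chain he hx)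

theorem edgeDegree_chain_interior {X : Type} {x : X} {l₁ l₂ : List X} (h₁ : l₁ ≠ []) (h₂ : l₂ ≠ [])
    (h : (l₁ ++ x :: l₂).Nodup) : edgeDegree (chain (l₁ ++ x :: l₂)) x = 2 := by
  obtain ⟨y, l₂, rfl⟩ := List.exists_cons_of_ne_nil h₂
  have hx : x ∉ l₁ ∧ x ∉ y :: l₂ := by
    rw [List.nodup_append, List.nodup_cons] at h
    exact ⟨fun hx => h.2.2 x hx x (by simp) rfl, h.2.1.1⟩
  rw [chain_append_cons, edgeDegree_add, edgeDegree_chain_last h₁ hx.1,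
    edgeDegree_chain_head hx.2]

theorem chain_nodup {X : Type} {l : List X} (h : l.Nodup) : (chain l).Nodup := by
  induction l with
  | nil => exact Multiset.nodup_zero
  | cons a l ih =>
    cases l with
    | nil => exact Multiset.nodup_zero
    | cons b l =>
      rw [List.nodup_cons] at h
      rw [chain_cons_cons, Multiset.nodup_cons]
      exact ⟨fun h' => h.1 (mem_of_mem_chain h' (by simp)), ih h.2⟩

theorem mem_chain_iff {X : Type} {l : List X} {e : Sym2 X} :
    e ∈ chain l ↔ ∃ a b, Traverses l a b ∧ e = s(a, b) := by
  constructor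
  · intro he
    induction l with
    | nil => simp at he
    | cons a l ih =>
      cases l with
      | nil => simp at he
      | cons b l =>
        rw [chain_cons_cons, Multiset.mem_cons] at he
        rcases he with rfl | he
        · exact ⟨a, b, traverses_iff.2 ⟨[], l, rfl⟩, rfl⟩
        · obtain ⟨x, y, h, rfl⟩ := ih he
          obtain ⟨l₁, l₂, h⟩ := traverses_iff.1 h
          exact ⟨x, y, traverses_iff.2 ⟨a :: l₁, l₂, by rw [h]; rfl⟩, rfl⟩
  · rintro ⟨a, b, h, rfl⟩
    obtain ⟨l₁, l₂, rfl⟩ := traverses_iff.1 h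
    rw [chain_append_cons]
    simp

end ZXGraph

theorem Site.finite {Q K : Type} [Finite Q] [Finite K] : Finite (Site Q K) := by
  let f : Site Q K → Fin 15 × (Q ⊕ K)
    | .start q => (0, .inl q)
    | .pad q => (1, .inl q)
    | .exit q => (2, .inl q)
    | .left k => (3, .inr k)
    | .had k => (4, .inr k)
    | .right k => (5, .inr k)
    | .corr k => (6, .inr k)
    | .corrPad k => (7, .inr k)
    | .hIn k => (8, .inr k)
    | .target k => (9, .inr k)
    | .hOut k => (10, .inr k)
    | .sep k => (11, .inr k)
    | .fused k => (12, .inr k)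
    | .auxIn k => (13, .inr k)
    | .auxOut k => (14, .inr k)
  refine Finite.of_injective f fun a b h => ?_
  cases a <;> cases b <;> simp_all [f]

namespace Pattern

variable {Q : Type} {P : Pattern Q}

namespace Schedule

variable (S : P.Schedule)

/-! ### A height that increases along the paths of the circuit-like diagram -/

/-- The wire of a successor begins in the rank layer after that of its predecessor; a wire that the
flow does not reach begins at the bottom. -/
noncomputable def baseHeight (q : Q) : ℕ :=
  if h : ∃ k, S.flow k ∧ S.hi k = q then 10 * (S.rank (S.lo h.choose) + 1) else 0

theorem baseHeight_hi {k : P.Idx} (hk : S.flow k) :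
    S.baseHeight (S.hi k) = 10 * (S.rank (S.lo k) + 1) := by
  have h : ∃ k', S.flow k' ∧ S.hi k' = S.hi k := ⟨k, hk, rfl⟩
  rw [baseHeight, dif_pos h, S.hi_inj _ k h.choose_spec.1 hk h.choose_spec.2]

theorem mem_circuitLink {k : P.Idx} {e : Sym2 P.Vtx} : e ∈ S.circuitLink k ↔
    (S.flow k ∧ (e = s(Sum.inl (.exit (S.lo k)), Sum.inl (.had k)) ∨
      e = s(Sum.inl (.had k), Sum.inl (.start (S.hi k))))) ∨
    (¬ S.flow k ∧ e = s(Sum.inl (.exit (S.lo k)), Sum.inl (.target k))) := by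
  unfold circuitLink
  split_ifs with h <;> simp [h]

theorem inr_notMem_circuitLinks {e : Sym2 P.Vtx} (he : e ∈ S.circuitLinks)
    (b : P.inputs ⊕ P.outputs) : Sum.inr b ∉ e := by
  obtain ⟨k, -, he⟩ := Multiset.mem_bind.1 he
  rcases S.mem_circuitLink.1 he with ⟨-, rfl | rfl⟩ | ⟨-, rfl⟩ <;> simp

theorem had_notMem_circuitWire (k : P.Idx) (q : Q) : Sum.inl (.had k) ∉ S.circuitWire q := by
  intro h
  rcases S.mem_circuitWire.1 h with h | h | h
  · exact P.inl_notMem_inList _ _ h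
  · cases h
  · rcases S.mem_tail.1 h with ⟨k, hk, h | h | h | h⟩ | h | h | ⟨k, hk, h | h⟩ | h
    any_goals cases h
    exact P.inl_notMem_outList _ _ h

variable [Fintype Q]

/-- A level above all `exit` vertices, from which the corrections are stacked by position. -/
noncomputable def topHeight : ℕ := 10 * (Finset.univ.sup S.rank + 2)

theorem rank_lt_topHeight (q : Q) : 10 * S.rank q + 10 < S.topHeight := by
  have := Finset.le_sup (f := S.rank) (Finset.mem_univ q)
  unfold topHeight
  omega

/-- The decisive choice is that `target k` is level with `exit (lo k)`. For lower rank `r`, the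
vertices `hIn`, `target`, `hOut`, `sep` have heights `10r+9` to `10r+12`, below `10r+19` where the
next rank begins. For a flow command, `had` at `10r+13` and the following `start` at `10(r+1)+4 =
10r+14` fit in between. The default value `0` is for sites that do not occur in the circuit. -/
noncomputable def siteHeight : Site Q P.Idx → ℕ
  | .start q => S.baseHeight q + 4
  | .pad q => 10 * S.rank q + 9
  | .exit q => 10 * S.rank q + 10
  | .hIn k => 10 * S.rank (S.lo k) + 9
  | .target k => 10 * S.rank (S.lo k) + 10
  | .hOut k => 10 * S.rank (S.lo k) + 11
  | .sep k => 10 * S.rank (S.lo k) + 12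
  | .had k => 10 * S.rank (S.lo k) + 13
  | .corr k => S.topHeight + 2 * k +
      match P.cmd k with
      | .X _ _ => 0
      | _ => 1
  | .corrPad k => S.topHeight + 2 * k +
      match P.cmd k with
      | .X _ _ => 1
      | _ => 0
  | _ => 0

noncomputable def height : P.Vtx → ℕ
  | .inl u => S.siteHeight u
  | .inr (.inl _) => 0
  | .inr (.inr _) => S.topHeight + 2 * P.commands.length

/-- The second vertex is higher than the first one and of a different type. -/
def Above (a b : P.Vtx) : Prop :=
  S.height a < S.height b ∧ ∀ u v, a = Sum.inl u → b = Sum.inl v →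
    (P.siteKind u).type ≠ (P.siteKind v).type

theorem above_inl {u v : Site Q P.Idx} : S.Above (Sum.inl u) (Sum.inl v) ↔
    S.siteHeight u < S.siteHeight v ∧ (P.siteKind u).type ≠ (P.siteKind v).type := by
  simp [Above, height]

/-- In the induction, `u` is the `Z` vertex just passed: `exit`, or the second member of the
preceding pair. -/
theorem isChain_corrs {q : Q} (c : List P.Idx) (hc : c.Pairwise (· < ·))
    (h3 : ∀ k ∈ c, (P.cmd k).stage = 3) (u : Site Q P.Idx) (hu : (P.siteKind u).type = .Z)
    (h : ∀ k ∈ c, S.siteHeight u < S.topHeight + 2 * k)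
    (h' : S.siteHeight u < S.topHeight + 2 * P.commands.length) :
    (Sum.inl u :: (c.flatMap (corrPair P) ++ P.outList q)).IsChain S.Above := by
  induction c generalizing u with
  | nil =>
    unfold outList
    split_ifs
    · simp only [List.flatMap_nil, List.nil_append, List.isChain_cons_cons, List.isChain_singleton,
        and_true]
      exact ⟨h', fun _ _ _ h => by cases h⟩
    · simp
  | cons k c ih =>
    rw [List.pairwise_cons] at hc
    have hk := h k (by simp)
    have hk' : (k : ℕ) < P.commands.length := k.2
    have hstage := h3 k (by simp)
    have hlt : ∀ k' ∈ c, (k : ℕ) < k' := fun k' h => hc.1 k' h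
    have ih' := ih hc.2 fun k' h => h3 k' (by simp [h])
    rw [List.flatMap_cons, corrPair]
    cases hcmd : P.cmd k with
    | X i s =>
      simp only [List.cons_append, List.nil_append, List.isChain_cons_cons, above_inl]
      refine ⟨⟨hk.trans_le (by simp [siteHeight, hcmd]),
        by rw [hu]; simp [siteKind, hcmd, Command.corrKind, node, Kind.type]⟩,
        ⟨by simp [siteHeight, hcmd],
        by simp [siteKind, hcmd, Command.corrKind, Command.corrPadKind, node, Kind.type]⟩,
        ih' _ (by simp [siteKind, hcmd, Command.corrPadKind, node, Kind.type]) ?_ ?_⟩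
      · intro k' h
        have := hlt k' h
        simp only [siteHeight, hcmd]; omega
      · simp only [siteHeight, hcmd]; omega
    | Z i s =>
      simp only [List.cons_append, List.nil_append, List.isChain_cons_cons, above_inl]
      refine ⟨⟨hk.trans_le (by simp [siteHeight, hcmd]),
        by rw [hu]; simp [siteKind, hcmd, Command.corrPadKind, node, Kind.type]⟩,
        ⟨by simp [siteHeight, hcmd],
        by simp [siteKind, hcmd, Command.corrKind, Command.corrPadKind, node, Kind.type]⟩,
        ih' _ (by simp [siteKind, hcmd, Command.corrKind, node, Kind.type]) ?_ ?_⟩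
      · intro k' h
        have := hlt k' h
        simp only [siteHeight, hcmd]; omega
      · simp only [siteHeight, hcmd]; omega
    | _ => simp [hcmd, Command.stage] at hstage

/-- In the induction, `u` is the `Z` vertex just passed: `start`, or the `sep` of the preceding
gate. -/
theorem isChain_gates {q : Q} (g : List P.Idx)
    (hg : g.Pairwise fun k k' => S.rank (S.lo k) < S.rank (S.lo k'))
    (hq : ∀ k ∈ g, S.rank (S.lo k) < S.rank q) (u : Site Q P.Idx)
    (hu : (P.siteKind u).type = .Z)
    (h : ∀ k ∈ g, S.siteHeight u < 10 * S.rank (S.lo k) + 9)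
    (h' : S.siteHeight u < 10 * S.rank q + 9) {rest : List P.Vtx}
    (hrest : (Sum.inl (.pad q) :: rest).IsChain S.Above) :
    (Sum.inl u :: (g.flatMap (fun k => [Sum.inl (.hIn k), Sum.inl (.target k), Sum.inl (.hOut k),
      Sum.inl (.sep k)]) ++ (Sum.inl (.pad q) :: rest))).IsChain S.Above := by
  induction g generalizing u with
  | nil =>
    simp only [List.flatMap_nil, List.nil_append]
    rw [List.isChain_cons_cons]
    refine ⟨S.above_inl.2 ⟨h', ?_⟩, hrest⟩
    rw [hu]; simp [siteKind, node, Kind.type]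
  | cons k g ih =>
    rw [List.pairwise_cons] at hg
    have hk := h k (by simp)
    simp only [List.flatMap_cons, List.cons_append, List.nil_append]
    rw [List.isChain_cons_cons, List.isChain_cons_cons, List.isChain_cons_cons,
      List.isChain_cons_cons]
    refine ⟨S.above_inl.2 ⟨hk, by rw [hu]; simp [siteKind, Kind.type]⟩,
      S.above_inl.2 ⟨by simp [siteHeight], by simp [siteKind, node, Kind.type]⟩,
      S.above_inl.2 ⟨by simp [siteHeight], by simp [siteKind, node, Kind.type]⟩,
      S.above_inl.2 ⟨by simp [siteHeight], by simp [siteKind, node, Kind.type]⟩,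
      ih hg.2 (fun k' h => hq k' (by simp [h])) _ (by simp [siteKind, node, Kind.type]) ?_ ?_⟩
    · intro k' h
      have := hg.1 k' h
      simp only [siteHeight]; omega
    · have := hq k (by simp)
      simp only [siteHeight]; omega

theorem circuitWire_isChain (q : Q) : (S.circuitWire q).IsChain S.Above := by
  have hmem : ∀ k ∈ S.gates q, P.IsE k ∧ ¬ S.flow k ∧ S.hi k = q := fun k => (S.mem_gates q k).1
  have hexit : (Sum.inl (.exit q) :: ((P.corrs q).flatMap (corrPair P) ++ P.outList q)).IsChain
      S.Above := by
    have := S.rank_lt_topHeight q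
    refine S.isChain_corrs _ ?_ (fun k hk => (P.mem_corrs.1 hk).1) _
      (by simp [siteKind, node, Kind.type]) (fun k _ => ?_) ?_
    · exact (List.pairwise_lt_finRange _).filter _
    · simp only [siteHeight]; omega
    · simp only [siteHeight]; omega
  have hpad : (Sum.inl (.pad q) :: Sum.inl (.exit q) ::
      ((P.corrs q).flatMap (corrPair P) ++ P.outList q)).IsChain S.Above := by
    rw [List.isChain_cons_cons]
    exact ⟨S.above_inl.2 ⟨by simp [siteHeight], by simp [siteKind, node, Kind.type]⟩, hexit⟩
  have hstart : (Sum.inl (.start q) :: S.tail q).IsChain S.Above := by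
    refine S.isChain_gates _ (S.gates_sorted q) ?_ _ (by simp [siteKind, node, Kind.type]) ?_ ?_ hpad
    · intro k hk
      have := S.rank_lt k (hmem k hk).1
      rwa [(hmem k hk).2.2] at this
    · intro k hk
      simp only [siteHeight]
      by_cases hq : ∃ k, S.flow k ∧ S.hi k = q
      · obtain ⟨k', hk', rfl⟩ := hq
        rw [S.baseHeight_hi hk']
        have := S.flow_first k' k hk' (hmem k hk).1 (hmem k hk).2.1 (hmem k hk).2.2
        omega
      · rw [baseHeight, dif_neg hq]; omega
    · simp only [siteHeight]
      by_cases hq : ∃ k, S.flow k ∧ S.hi k = q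
      · obtain ⟨k', hk', rfl⟩ := hq
        rw [S.baseHeight_hi hk']
        have := S.rank_lt k' (S.isE k' hk')
        omega
      · rw [baseHeight, dif_neg hq]; omega
  unfold circuitWire inList
  split_ifs
  · rw [List.singleton_append, List.isChain_cons_cons]
    exact ⟨⟨by simp [height, siteHeight], fun _ _ h => by cases h⟩, hstart⟩
  · exact hstart

/-! ### The edges of the circuit-like diagram -/

noncomputable def circuitEdges : Multiset (Sym2 P.Vtx) :=
  ZXGraph.netEdges ((Finset.univ : Finset Q).val.map S.circuitWire) S.circuitLinks

theorem mem_circuitEdges {e : Sym2 P.Vtx} : e ∈ S.circuitEdges ↔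
    (∃ q, e ∈ ZXGraph.chain (S.circuitWire q)) ∨ ∃ k, P.IsE k ∧ e ∈ S.circuitLink k := by
  simp [circuitEdges, ZXGraph.netEdges, circuitLinks, P.mem_ents]

theorem circuitWire_nodup (q : Q) : (S.circuitWire q).Nodup := by
  have h : (S.circuitWire q).Pairwise fun a b => S.height a < S.height b := by
    have : IsTrans P.Vtx fun a b => S.height a < S.height b := ⟨fun _ _ _ => lt_trans⟩
    exact List.isChain_iff_pairwise.1 ((S.circuitWire_isChain q).imp fun _ _ h => h.1)
  exact h.imp fun h h' => by rw [h'] at h; exact lt_irrefl _ h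

theorem above_of_mem_chain {q : Q} {a b : P.Vtx} (h : s(a, b) ∈ ZXGraph.chain (S.circuitWire q)) :
    S.Above a b ∨ S.Above b a := by
  obtain ⟨x, y, hxy, h⟩ := ZXGraph.mem_chain_iff.1 h
  have := ZXGraph.rel_of_traverses (S.circuitWire_isChain q) hxy
  rcases Sym2.eq_iff.1 h with ⟨rfl, rfl⟩ | ⟨rfl, rfl⟩
  exacts [.inl this, .inr this]

theorem circuitEdges_type {u v : Site Q P.Idx} (h : s(Sum.inl u, Sum.inl v) ∈ S.circuitEdges) :
    (P.siteKind u).type ≠ (P.siteKind v).type := by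
  rcases S.mem_circuitEdges.1 h with ⟨q, h⟩ | ⟨k, -, h⟩
  · rcases S.above_of_mem_chain h with h | h
    exacts [(S.above_inl.1 h).2, (S.above_inl.1 h).2.symm]
  · rcases S.mem_circuitLink.1 h with ⟨-, h | h⟩ | ⟨-, h⟩ <;>
    · simp only [Sym2.eq_iff, Sum.inl.injEq] at h
      rcases h with ⟨rfl, rfl⟩ | ⟨rfl, rfl⟩ <;> simp [siteKind, node, Kind.type]

theorem circuitEdges_not_isDiag {e : Sym2 P.Vtx} (he : e ∈ S.circuitEdges) : ¬ e.IsDiag := by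
  induction e with | _ a b
  rw [Sym2.mk_isDiag_iff]
  rintro rfl
  rcases S.mem_circuitEdges.1 he with ⟨q, h⟩ | ⟨k, -, h⟩
  · rcases S.above_of_mem_chain h with h | h <;> exact lt_irrefl _ h.1
  · rcases S.mem_circuitLink.1 h with ⟨-, h | h⟩ | ⟨-, h⟩ <;>
    · simp only [Sym2.eq_iff] at h
      rcases h with ⟨rfl, h⟩ | ⟨rfl, h⟩ <;> cases h

theorem circuitEdges_nodup : S.circuitEdges.Nodup := by
  rw [circuitEdges, ZXGraph.netEdges, Multiset.bind_map, Multiset.nodup_add, Multiset.nodup_bind,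
    circuitLinks, Multiset.nodup_bind]
  refine ⟨⟨fun q _ => ZXGraph.chain_nodup (S.circuitWire_nodup q), ?_⟩, ⟨fun k _ => ?_, ?_⟩, ?_⟩
  · refine Multiset.Nodup.pairwise (fun q _ q' _ hqq' => ?_) Finset.univ.nodup
    refine Multiset.disjoint_left.2 fun {e} he he' => hqq' ?_
    induction e with | _ a b
    rw [← S.home_circuitWire q (ZXGraph.mem_of_mem_chain he (Sym2.mem_mk_left a b)),
      S.home_circuitWire q' (ZXGraph.mem_of_mem_chain he' (Sym2.mem_mk_left a b))]
  · unfold circuitLink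
    split_ifs
    · simp
    · simp
  · refine Multiset.Nodup.pairwise (fun k _ k' _ hkk' => ?_) P.ents_nodup
    refine Multiset.disjoint_left.2 fun {e} he he' => hkk' ?_
    rcases S.mem_circuitLink.1 he with ⟨-, rfl | rfl⟩ | ⟨-, rfl⟩ <;>
      rcases S.mem_circuitLink.1 he' with ⟨-, h | h⟩ | ⟨-, h⟩ <;>
      simp_all
  · refine Multiset.disjoint_left.2 fun {e} he he' => ?_
    obtain ⟨q, -, he⟩ := Multiset.mem_bind.1 he
    obtain ⟨k, hk, he'⟩ := Multiset.mem_bind.1 he'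
    rcases S.mem_circuitLink.1 he' with ⟨-, rfl | rfl⟩ | ⟨-, rfl⟩
    · exact S.had_notMem_circuitWire k q (ZXGraph.mem_of_mem_chain he (Sym2.mem_mk_right _ _))
    · exact S.had_notMem_circuitWire k q (ZXGraph.mem_of_mem_chain he (Sym2.mem_mk_left _ _))
    -- An edge of a wire stays on that wire, whereas the link of a gate joins two wires of different
    -- rank.
    · have h1 := S.home_circuitWire q (ZXGraph.mem_of_mem_chain he (Sym2.mem_mk_left _ _))
      have h2 := S.home_circuitWire q (ZXGraph.mem_of_mem_chain he (Sym2.mem_mk_right _ _))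
      have := S.rank_lt k (P.mem_ents.1 hk)
      simp only [home] at h1 h2
      rw [h1, h2] at this
      exact lt_irrefl _ this

end Schedule
end Pattern

namespace ZXGraph

theorem edgeDegree_chain_of_mem {X : Type} {x : X} {l : List X} (hl : l.Nodup) (hx : x ∈ l)
    (h : l.head? ≠ some x) (h' : l.getLast? ≠ some x) : edgeDegree (chain l) x = 2 := by
  obtain ⟨l₁, l₂, rfl⟩ := List.append_of_mem hx
  refine edgeDegree_chain_interior ?_ ?_ hl
  · rintro rfl
    exact h rfl
  · rintro rfl
    exact h' (by simp)

end ZXGraph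

namespace Pattern

variable {Q : Type} {P : Pattern Q}

namespace Schedule

variable (S : P.Schedule)

/-! ### The circuit-like diagram is a diagram -/

theorem circuitWire_head (q : Q) : ∀ u, (S.circuitWire q).head? = some (Sum.inl u) → u = .start q := by
  intro u
  unfold circuitWire inList
  split_ifs <;> simp [eq_comm]

theorem circuitWire_notMem_outputs {q : Q} (hq : q ∉ P.outputs) :
    ∃ l, S.circuitWire q = l ++ [Sum.inl (.exit q)] :=
  ⟨P.inList q ++ Sum.inl (.start q) :: ((S.gates q).flatMap (fun k => [Sum.inl (.hIn k),
    Sum.inl (.target k), Sum.inl (.hOut k), Sum.inl (.sep k)]) ++ [Sum.inl (.pad q)]), by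
    simp [circuitWire, tail, outList, hq, S.corrs_eq_nil q hq]⟩

theorem circuitWire_mem_outputs {q : Q} (hq : q ∈ P.outputs) :
    ∃ l, l ≠ [] ∧ S.circuitWire q = l ++ [Sum.inr (Sum.inr ⟨q, hq⟩)] :=
  ⟨P.inList q ++ Sum.inl (.start q) :: ((S.gates q).flatMap (fun k => [Sum.inl (.hIn k),
    Sum.inl (.target k), Sum.inl (.hOut k), Sum.inl (.sep k)]) ++
    ([Sum.inl (.pad q), Sum.inl (.exit q)] ++ (P.corrs q).flatMap (corrPair P))), by simp, by
    simp [circuitWire, tail, outList, hq]⟩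

theorem circuitWire_getLast (q : Q) :
    ∀ u, (S.circuitWire q).getLast? = some (Sum.inl u) → u = .exit q := by
  intro u h
  by_cases hq : q ∈ P.outputs
  · obtain ⟨l, -, hl⟩ := S.circuitWire_mem_outputs hq
    simp [hl] at h
  · obtain ⟨l, hl⟩ := S.circuitWire_notMem_outputs hq
    rw [hl, List.getLast?_concat] at h
    cases h
    rfl

section Finite

variable [Fintype Q]

theorem edgeDegree_circuitEdges_wire {q : Q} {x : P.Vtx} (hx : S.home x = q)
    (hL : ∀ e ∈ S.circuitLinks, x ∉ e) :
    ZXGraph.edgeDegree S.circuitEdges x = ZXGraph.edgeDegree (ZXGraph.chain (S.circuitWire q)) x := by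
  rw [circuitEdges, ZXGraph.netEdges, Multiset.bind_map, ZXGraph.edgeDegree_add,
    ZXGraph.edgeDegree_eq_zero hL, add_zero]
  refine ZXGraph.edgeDegree_sum (Finset.mem_univ q) fun q' _ hq' e he hxe => hq' ?_
  rw [← hx, S.home_circuitWire q' (ZXGraph.mem_of_mem_chain he hxe)]

theorem edgeDegree_boundary (b : P.inputs ⊕ P.outputs) :
    ZXGraph.edgeDegree S.circuitEdges (Sum.inr b) = 1 := by
  rw [S.edgeDegree_circuitEdges_wire rfl fun e he => S.inr_notMem_circuitLinks he b]
  rcases b with ⟨i, hi⟩ | ⟨o, ho⟩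
  · have h := S.circuitWire_nodup i
    change ZXGraph.edgeDegree (ZXGraph.chain (S.circuitWire i)) _ = 1
    rw [circuitWire, inList, dif_pos hi, List.singleton_append] at h ⊢
    exact ZXGraph.edgeDegree_chain_head (List.nodup_cons.1 h).1
  · have h := S.circuitWire_nodup o
    change ZXGraph.edgeDegree (ZXGraph.chain (S.circuitWire o)) _ = 1
    obtain ⟨l, hl, h'⟩ := S.circuitWire_mem_outputs ho
    rw [h'] at h ⊢
    exact ZXGraph.edgeDegree_chain_last hl fun hx =>
      (List.nodup_append.1 h).2.2 _ hx _ (List.mem_singleton_self _) rfl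

theorem edgeDegree_hadamard_wire {k : P.Idx} {u : Site Q P.Idx} (hu : u = .hIn k ∨ u = .hOut k)
    {q : Q} (h : Sum.inl u ∈ S.circuitWire q) :
    ZXGraph.edgeDegree S.circuitEdges (Sum.inl u) = 2 := by
  rw [S.edgeDegree_circuitEdges_wire (S.home_circuitWire q h)]
  · refine ZXGraph.edgeDegree_chain_of_mem (S.circuitWire_nodup q) h (fun h => ?_) fun h => ?_
    · rcases hu with rfl | rfl <;> cases S.circuitWire_head q _ h
    · rcases hu with rfl | rfl <;> cases S.circuitWire_getLast q _ h
  · intro e he hue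
    rcases S.mem_circuitLinks he hue with ⟨_, h⟩ | ⟨_, h⟩ | ⟨_, -, h⟩ | ⟨_, -, -, h⟩ <;>
      rcases hu with rfl | rfl <;> cases h

theorem edgeDegree_had {k : P.Idx} (hk : S.flow k) :
    ZXGraph.edgeDegree S.circuitEdges (Sum.inl (.had k)) = 2 := by
  rw [circuitEdges, ZXGraph.netEdges, ZXGraph.edgeDegree_add, ZXGraph.edgeDegree_eq_zero, zero_add,
    circuitLinks]
  · refine (ZXGraph.edgeDegree_sum (s := Finset.univ.filter fun k => P.IsE k)
      (Finset.mem_filter.2 ⟨Finset.mem_univ k, S.isE k hk⟩) ?_).trans ?_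
    · intro k' _ hk' e he hke
      rcases S.mem_circuitLink.1 he with ⟨-, rfl | rfl⟩ | ⟨-, rfl⟩ <;>
        simp [hk'.symm] at hke
    · rw [circuitLink, if_pos hk, Multiset.insert_eq_cons, ZXGraph.edgeDegree_cons,
        ← Multiset.cons_zero, ZXGraph.edgeDegree_cons]
      simp [ZXGraph.edgeDegree]
  · intro e he hke
    obtain ⟨l, hl, he⟩ := Multiset.mem_bind.1 he
    obtain ⟨q, -, rfl⟩ := Multiset.mem_map.1 hl
    exact S.had_notMem_circuitWire k q (ZXGraph.mem_of_mem_chain he hke)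

theorem mem_circuit_sites {u : Site Q P.Idx} :
    u ∈ ZXGraph.sites ((Finset.univ : Finset Q).val.map S.circuitWire) S.circuitLinks ↔
      (∃ q, Sum.inl u ∈ S.circuitWire q) ∨ ∃ k, S.flow k ∧ u = .had k := by
  rw [ZXGraph.mem_sites]
  constructor
  · rintro (⟨l, hl, h⟩ | ⟨e, he, h⟩)
    · obtain ⟨q, -, rfl⟩ := Multiset.mem_map.1 hl
      exact .inl ⟨q, h⟩
    · rcases S.mem_circuitLinks he h with ⟨q, rfl⟩ | ⟨q, rfl⟩ | ⟨k, hk, rfl⟩ | ⟨k, hE, hk, rfl⟩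
      · exact .inl ⟨q, S.mem_circuitWire.2 (.inr (.inr (S.mem_tail.2 (.inr (.inr (.inl rfl))))))⟩
      · exact .inl ⟨q, S.mem_circuitWire.2 (.inr (.inl rfl))⟩
      · exact .inr ⟨k, hk, rfl⟩
      · exact .inl ⟨S.hi k, S.mem_circuitWire.2 (.inr (.inr (S.mem_tail.2 (.inl
          ⟨k, (S.mem_gates _ _).2 ⟨hE, hk, rfl⟩, .inr (.inl rfl)⟩))))⟩
  · rintro (⟨q, h⟩ | ⟨k, hk, rfl⟩)
    · exact .inl ⟨_, Multiset.mem_map_of_mem _ (Finset.mem_univ q), h⟩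
    · exact .inr ⟨s(Sum.inl (.exit (S.lo k)), Sum.inl (.had k)), Multiset.mem_bind.2
        ⟨k, P.mem_ents.2 (S.isE k hk), S.mem_circuitLink.2 (.inl ⟨hk, .inl rfl⟩)⟩, by simp⟩

/-- The vertices `hIn` and `hOut` are interior to a wire and `had` lies on exactly two link edges,
so all `H` vertices have degree two. Each wire contains `start`, so boundary vertices have a
neighbour even on otherwise empty wires. -/
theorem circuit_isDiagram : S.circuit.IsDiagram := by
  have := Site.finite (Q := Q) (K := P.Idx)
  refine ZXGraph.drawn_isDiagram (fun e => ZXGraph.netEdges_endsIn) (Set.toFinite _)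
    S.edgeDegree_boundary ?_ ?_
  · intro u hu hk
    have hcorr : ∀ c : Command Q, c.corrKind ≠ .hadamard ∧ c.corrPadKind ≠ .hadamard := by
      intro c
      cases c <;> simp [Command.corrKind, Command.corrPadKind, node]
    rcases S.mem_circuit_sites.1 hu with ⟨q, h⟩ | ⟨k, hk', rfl⟩
    · cases u with
      | hIn k => exact S.edgeDegree_hadamard_wire (.inl rfl) h
      | hOut k => exact S.edgeDegree_hadamard_wire (.inr rfl) h
      | had k => exact absurd h (S.had_notMem_circuitWire k q)
      | corr k => exact absurd hk (hcorr _).1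
      | corrPad k => exact absurd hk (hcorr _).2
      | auxIn k =>
        rcases S.mem_circuitWire.1 h with h | h | h
        · exact absurd h (P.inl_notMem_inList _ _)
        · cases h
        · rcases S.mem_tail.1 h with ⟨_, -, h | h | h | h⟩ | h | h | ⟨_, -, h | h⟩ | h
          any_goals cases h
          exact absurd h (P.inl_notMem_outList _ _)
      | auxOut k =>
        rcases S.mem_circuitWire.1 h with h | h | h
        · exact absurd h (P.inl_notMem_inList _ _)
        · cases h
        · rcases S.mem_tail.1 h with ⟨_, -, h | h | h | h⟩ | h | h | ⟨_, -, h | h⟩ | h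
          any_goals cases h
          exact absurd h (P.inl_notMem_outList _ _)
      | _ => simp [siteKind, node] at hk
    · exact S.edgeDegree_had hk'
  · intro u c W h
    have hpi : (Real.pi : Real.Angle) ≠ 0 := Real.Angle.pi_ne_zero
    have hcorr : ∀ d : Command Q, (d.corrKind = .spider c 0 W → W = ∅) ∧
        (d.corrPadKind = .spider c 0 W → W = ∅) := by
      intro d
      cases d <;> simp [Command.corrKind, Command.corrPadKind, node, hpi, hpi.symm, eq_comm]
    cases u with
    | corr k => exact (hcorr _).1 h
    | corrPad k => exact (hcorr _).2 h
    | _ =>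
      simp only [siteKind, node, if_true, Kind.spider.injEq, reduceCtorEq] at h
      try exact h.2.2.symm

end Finite

/-! ### The paths of the circuit-like diagram -/

/-- The path that consists of the wires leading to the qubit along the flow, and its own wire. -/
noncomputable def trunk (q : Q) : List P.Vtx :=
  if h : ∃ k, S.flow k ∧ S.hi k = q then
    trunk (S.lo h.choose) ++ Sum.inl (.had h.choose) :: S.circuitWire q
  else S.circuitWire q
termination_by S.rank q
decreasing_by
  have := S.rank_lt _ (S.isE _ h.choose_spec.1)
  rwa [h.choose_spec.2] at this

theorem trunk_hi {k : P.Idx} (hk : S.flow k) :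
    S.trunk (S.hi k) = S.trunk (S.lo k) ++ Sum.inl (.had k) :: S.circuitWire (S.hi k) := by
  have h : ∃ k', S.flow k' ∧ S.hi k' = S.hi k := ⟨k, hk, rfl⟩
  rw [trunk, dif_pos h, S.hi_inj _ k h.choose_spec.1 hk h.choose_spec.2]

theorem trunk_of_forall {q : Q} (h : ¬ ∃ k, S.flow k ∧ S.hi k = q) : S.trunk q = S.circuitWire q := by
  rw [trunk, dif_neg h]

theorem trunk_induction {motive : Q → Prop}
    (base : ∀ q, (¬ ∃ k, S.flow k ∧ S.hi k = q) → motive q)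
    (step : ∀ k, S.flow k → motive (S.lo k) → motive (S.hi k)) (q : Q) : motive q := by
  induction h : S.rank q using Nat.strong_induction_on generalizing q with | _ n ih
  by_cases hq : ∃ k, S.flow k ∧ S.hi k = q
  · obtain ⟨k, hk, rfl⟩ := hq
    exact step k hk (ih _ (h ▸ S.rank_lt k (S.isE k hk)) _ rfl)
  · exact base q hq

theorem circuitWire_ne_nil (q : Q) : S.circuitWire q ≠ [] := by simp [circuitWire]

theorem trunk_ends (q : Q) : ∃ l, S.trunk q = l ++ S.circuitWire q := by
  refine S.trunk_induction (motive := fun q => ∃ l, S.trunk q = l ++ S.circuitWire q)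
    (fun q hq => ⟨[], S.trunk_of_forall hq⟩) (fun k hk _ => ?_) q
  exact ⟨S.trunk (S.lo k) ++ [Sum.inl (.had k)], by rw [S.trunk_hi hk]; simp⟩

theorem trunk_getLast (q : Q) : (S.trunk q).getLast? = (S.circuitWire q).getLast? := by
  obtain ⟨l, hl⟩ := S.trunk_ends q
  rw [hl, List.getLast?_append_of_ne_nil _ (S.circuitWire_ne_nil q)]

/-- The second qubit is the successor of the first one in the flow. -/
def Next (q q' : Q) : Prop := ∃ k, S.flow k ∧ S.lo k = q ∧ S.hi k = q'

theorem Next.rightUnique : Relator.RightUnique S.Next := by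
  rintro q _ _ ⟨k, hk, rfl, rfl⟩ ⟨k', hk', h, rfl⟩
  rw [S.lo_inj _ _ hk' hk h]

theorem trunk_prefix {q q' : Q} (h : Relation.ReflTransGen S.Next q q') :
    S.trunk q <+: S.trunk q' := by
  induction h with
  | refl => exact List.prefix_rfl
  | tail _ h ih =>
    obtain ⟨k, hk, rfl, rfl⟩ := h
    rw [S.trunk_hi hk]
    exact ih.trans (List.prefix_append _ _)

/-- The qubit to whose part of a path the vertex belongs. -/
def owner : P.Vtx → Q
  | .inl (.had k) => S.lo k
  | x => S.home x

theorem owner_circuitWire {q : Q} {x : P.Vtx} (hx : x ∈ S.circuitWire q) : S.owner x = q := by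
  rcases x with u | x
  · cases u with
    | had k => exact absurd hx (S.had_notMem_circuitWire k q)
    | _ => exact S.home_circuitWire q hx
  · exact S.home_circuitWire q hx

theorem owner_trunk {q : Q} : ∀ {x : P.Vtx}, x ∈ S.trunk q →
    Relation.ReflTransGen S.Next (S.owner x) q := by
  refine S.trunk_induction (motive := fun q => ∀ {x : P.Vtx}, x ∈ S.trunk q →
    Relation.ReflTransGen S.Next (S.owner x) q) (fun q hq x hx => ?_) (fun k hk ih x hx => ?_) q
  · rw [S.trunk_of_forall hq] at hx
    rw [S.owner_circuitWire hx]
  · rw [S.trunk_hi hk, List.mem_append, List.mem_cons] at hx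
    have hnext : S.Next (S.lo k) (S.hi k) := ⟨k, hk, rfl, rfl⟩
    rcases hx with hx | rfl | hx
    · exact (ih hx).tail hnext
    · exact .single hnext
    · rw [S.owner_circuitWire hx]

theorem mem_trunk {q : Q} : ∀ {x : P.Vtx}, x ∈ S.trunk q →
    (∃ q', x ∈ S.circuitWire q') ∨ ∃ k, S.flow k ∧ x = Sum.inl (.had k) := by
  refine S.trunk_induction (motive := fun q => ∀ {x : P.Vtx}, x ∈ S.trunk q →
    (∃ q', x ∈ S.circuitWire q') ∨ ∃ k, S.flow k ∧ x = Sum.inl (.had k))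
    (fun q hq x hx => ?_) (fun k hk ih x hx => ?_) q
  · rw [S.trunk_of_forall hq] at hx
    exact .inl ⟨q, hx⟩
  · rw [S.trunk_hi hk, List.mem_append, List.mem_cons] at hx
    rcases hx with hx | rfl | hx
    exacts [ih hx, .inr ⟨k, hk, rfl⟩, .inl ⟨_, hx⟩]

theorem eq_of_mem_outputs {o o' : Q} (ho : o ∈ P.outputs)
    (h : Relation.ReflTransGen S.Next o o') : o = o' := by
  rcases h.cases_head with h | ⟨q, ⟨k, hk, rfl, -⟩, -⟩
  · exact h
  · exact absurd ho (S.lo_notMem k hk)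

/-- From the owner of a common vertex the flow leads to both outputs. Successors are unique, so one
output would be reached from the other, but an output has no successor. -/
theorem trunk_disjoint {o o' : Q} (ho : o ∈ P.outputs) (ho' : o' ∈ P.outputs) (hne : o ≠ o') :
    (S.trunk o).Disjoint (S.trunk o') := by
  intro x hx hx'
  rcases Relation.ReflTransGen.total_of_right_unique (Next.rightUnique S) (S.owner_trunk hx)
    (S.owner_trunk hx') with h | h
  · exact hne (S.eq_of_mem_outputs ho h)
  · exact hne (S.eq_of_mem_outputs ho' h).symm

variable [Fintype Q]

/-- Following the flow raises the rank, which is bounded on a finite set; the walk stops only at an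
output. -/
theorem exists_output (q : Q) : ∃ o ∈ P.outputs, Relation.ReflTransGen S.Next q o := by
  induction h : Finset.univ.sup S.rank - S.rank q using Nat.strong_induction_on generalizing q with
  | _ n ih
  by_cases hq : q ∈ P.outputs
  · exact ⟨q, hq, .refl⟩
  · obtain ⟨k, hk, rfl⟩ := S.flow_exists q hq
    have h1 := S.rank_lt k (S.isE k hk)
    have h2 := Finset.le_sup (f := S.rank) (Finset.mem_univ (S.hi k))
    obtain ⟨o, ho, h'⟩ := ih _ (by omega) (S.hi k) rfl
    exact ⟨o, ho, .head ⟨k, hk, rfl, rfl⟩ h'⟩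

/-- The junctions fit because `lo k` is not an output, so its wire ends at `exit`, and `hi k` is not
an input, so its wire begins at `start`. The vertex `had k` is adjacent to both and lies between
them in height. -/
theorem trunk_isChain (q : Q) :
    (S.trunk q).IsChain fun a b => s(a, b) ∈ S.circuitEdges ∧ S.height a < S.height b := by
  have hwire : ∀ q, (S.circuitWire q).IsChain fun a b =>
      s(a, b) ∈ S.circuitEdges ∧ S.height a < S.height b := fun q =>
    ZXGraph.isChain_of_traverses fun a b hab =>
      ⟨S.mem_circuitEdges.2 (.inl ⟨q, ZXGraph.mem_chain_iff.2 ⟨a, b, hab, rfl⟩⟩),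
        (ZXGraph.rel_of_traverses (S.circuitWire_isChain q) hab).1⟩
  refine S.trunk_induction (motive := fun q => (S.trunk q).IsChain fun a b =>
    s(a, b) ∈ S.circuitEdges ∧ S.height a < S.height b) (fun q hq => ?_) (fun k hk ih => ?_) q
  · rw [S.trunk_of_forall hq]
    exact hwire q
  · obtain ⟨l, hl⟩ := S.circuitWire_notMem_outputs (S.lo_notMem k hk)
    have hin : P.inList (S.hi k) = [] := by rw [inList, dif_neg (S.hi_notMem k hk)]
    have hw := hwire (S.hi k)
    rw [S.trunk_hi hk]
    rw [circuitWire, hin, List.nil_append] at hw ⊢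
    rw [List.isChain_append]
    refine ⟨ih, ?_, ?_⟩
    · rw [List.isChain_cons_cons]
      refine ⟨⟨S.mem_circuitEdges.2 (.inr ⟨k, S.isE k hk, S.mem_circuitLink.2
        (.inl ⟨hk, .inr rfl⟩)⟩), ?_⟩, hw⟩
      simp only [height, siteHeight, S.baseHeight_hi hk]
      omega
    · intro x hx y hy
      rw [S.trunk_getLast, hl, List.getLast?_concat, Option.mem_some_iff] at hx
      rw [List.head?_cons, Option.mem_some_iff] at hy
      subst hx hy
      refine ⟨S.mem_circuitEdges.2 (.inr ⟨k, S.isE k hk, S.mem_circuitLink.2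
        (.inl ⟨hk, .inl rfl⟩)⟩), ?_⟩
      simp only [height, siteHeight]
      omega

/-- The only edges outside the trunks are the links of gates, which are horizontal by the choice of
heights. -/
theorem traverses_trunk {a b : P.Vtx} (h : s(a, b) ∈ S.circuitEdges) :
    (∃ q, ZXGraph.Traverses (S.trunk q) a b ∨ ZXGraph.Traverses (S.trunk q) b a) ∨ S.height a = S.height b := by
  have key : ∀ x y q, ZXGraph.Traverses (S.trunk q) x y → s(a, b) = s(x, y) →
      ∃ q, ZXGraph.Traverses (S.trunk q) a b ∨ ZXGraph.Traverses (S.trunk q) b a := by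
    intro x y q hxy h
    rcases Sym2.eq_iff.1 h with ⟨rfl, rfl⟩ | ⟨rfl, rfl⟩
    exacts [⟨q, .inl hxy⟩, ⟨q, .inr hxy⟩]
  rcases S.mem_circuitEdges.1 h with ⟨q, h⟩ | ⟨k, -, h⟩
  · obtain ⟨x, y, hxy, h⟩ := ZXGraph.mem_chain_iff.1 h
    obtain ⟨l, hl⟩ := S.trunk_ends q
    exact .inl (key x y q (hxy.trans (hl ▸ (List.suffix_append l _).isInfix)) h)
  · rcases S.mem_circuitLink.1 h with ⟨hk, h | h⟩ | ⟨hk, h⟩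
    · obtain ⟨l, hl⟩ := S.circuitWire_notMem_outputs (S.lo_notMem k hk)
      obtain ⟨l', hl'⟩ := S.trunk_ends (S.lo k)
      exact .inl (key _ _ (S.hi k) (ZXGraph.traverses_iff.2 ⟨l' ++ l, S.circuitWire (S.hi k), by
        rw [S.trunk_hi hk, hl', hl]; simp⟩) h)
    · have hin : P.inList (S.hi k) = [] := by rw [inList, dif_neg (S.hi_notMem k hk)]
      exact .inl (key _ _ (S.hi k) (ZXGraph.traverses_iff.2 ⟨S.trunk (S.lo k), S.tail (S.hi k), by
        rw [S.trunk_hi hk, circuitWire, hin]; simp⟩) h)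
    · right
      rcases Sym2.eq_iff.1 h with ⟨rfl, rfl⟩ | ⟨rfl, rfl⟩ <;> rfl

theorem circuit_isCircuitLike : S.circuit.IsCircuitLike := by
  have hsub : ∀ q, ∃ o ∈ P.outputs, S.trunk q <+: S.trunk o := fun q => by
    obtain ⟨o, ho, h⟩ := S.exists_output q
    exact ⟨o, ho, S.trunk_prefix h⟩
  refine ZXGraph.drawn_isCircuitLike (fun e => ZXGraph.netEdges_endsIn)
    {p | ∃ o ∈ P.outputs, p = S.trunk o} S.height ?_ ?_ ?_ ?_ ?_ ?_ S.circuitEdges_nodup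
    (fun e => S.circuitEdges_not_isDiag) fun u v => S.circuitEdges_type
  · rintro _ ⟨o, -, rfl⟩
    exact S.trunk_isChain o
  · rintro _ ⟨o, ho, rfl⟩
    obtain ⟨l, -, hl⟩ := S.circuitWire_mem_outputs ho
    exact ⟨⟨o, ho⟩, by rw [S.trunk_getLast, hl, List.getLast?_concat]⟩
  · rintro _ ⟨o, -, rfl⟩ u hu
    refine S.mem_circuit_sites.2 ((S.mem_trunk hu).imp_right ?_)
    rintro ⟨k, hk, h⟩
    exact ⟨k, hk, Sum.inl_injective h⟩
  · rintro _ ⟨o, ho, rfl⟩ _ ⟨o', ho', rfl⟩ hne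
    exact S.trunk_disjoint ho ho' fun h => hne (h ▸ rfl)
  · intro x hx
    have : (∃ q, x ∈ S.circuitWire q) ∨ ∃ k, S.flow k ∧ x = Sum.inl (.had k) := by
      rcases x with u | ⟨i, hi⟩ | ⟨o, ho⟩
      · refine (S.mem_circuit_sites.1 (hx u rfl)).imp_right ?_
        rintro ⟨k, hk, rfl⟩
        exact ⟨k, hk, rfl⟩
      · exact .inl ⟨i, by simp [circuitWire, inList, hi]⟩
      · obtain ⟨l, -, hl⟩ := S.circuitWire_mem_outputs ho
        exact .inl ⟨o, by simp [hl]⟩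
    have hq : ∃ q, x ∈ S.trunk q := by
      rcases this with ⟨q, hq⟩ | ⟨k, hk, rfl⟩
      · obtain ⟨l, hl⟩ := S.trunk_ends q
        exact ⟨q, by rw [hl]; exact List.mem_append_right _ hq⟩
      · exact ⟨S.hi k, by rw [S.trunk_hi hk]; simp⟩
    obtain ⟨q, hq⟩ := hq
    obtain ⟨o, ho, h⟩ := hsub q
    exact ⟨_, ⟨o, ho, rfl⟩, h.subset hq⟩
  · intro a b hab
    refine (S.traverses_trunk hab).imp_left ?_
    rintro ⟨q, h⟩
    obtain ⟨o, ho, hp⟩ := hsub q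
    exact ⟨_, ⟨o, ho, rfl⟩, h.imp (fun h => h.trans hp.isInfix) fun h => h.trans hp.isInfix⟩

end Schedule
end Pattern

/-! ### From a flow to a schedule -/

theorem List.exists_sorted {X : Type} [Fintype X] (s : X → Prop) (g : X → ℕ)
    (hg : ∀ a b, s a → s b → g a = g b → a = b) :
    ∃ l : List X, (∀ a, a ∈ l ↔ s a) ∧ l.Pairwise fun a b => g a < g b := by
  let r : X → X → Prop := fun a b => g a ≤ g b
  have : Std.Total r := ⟨fun a b => le_total (g a) (g b)⟩
  have : IsTrans X r := ⟨fun _ _ _ => le_trans⟩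
  let l := (Finset.univ.filter s).toList.insertionSort r
  have hperm : l.Perm (Finset.univ.filter s).toList := List.perm_insertionSort r _
  have hmem : ∀ a, a ∈ l ↔ s a := fun a => by simp [hperm.mem_iff]
  refine ⟨l, hmem, ?_⟩
  have hnodup : l.Nodup := hperm.nodup_iff.2 (Finset.nodup_toList _)
  have hsorted : l.Pairwise r := List.pairwise_insertionSort r _
  refine (hsorted.and hnodup).imp_of_mem fun {a b} ha hb h => ?_
  exact lt_of_le_of_ne h.1 fun h' => h.2 (hg a b ((hmem a).1 ha) ((hmem b).1 hb) h')

theorem exists_injective_rank {X : Type} [Fintype X] (ord : PartialOrder X) :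
    ∃ r : X → ℕ, Function.Injective r ∧ ∀ a b, ord.lt a b → r a < r b := by
  -- The number of elements strictly below `a` respects the order. Scaled by the size of `X`, it
  -- leaves room for an enumeration `e` that breaks ties.
  let c : X → ℕ := fun a => (Finset.univ.filter fun w => ord.lt w a).card
  let e := Fintype.equivFin X
  have hc : ∀ a b, ord.lt a b → c a < c b := by
    intro a b hab
    refine Finset.card_lt_card (Finset.ssubset_iff_of_subset ?_ |>.2 ⟨a, ?_, ?_⟩)
    · intro w hw
      simp only [Finset.mem_filter, Finset.mem_univ, true_and] at hw ⊢
      exact lt_trans hw hab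
    · simpa using hab
    · simp
  refine ⟨fun a => c a * Fintype.card X + e a, fun a b h => ?_, fun a b hab => ?_⟩
  · have ha := (e a).2
    have hb := (e b).2
    have h' := congrArg (· % Fintype.card X) h
    simp only [Nat.mul_add_mod_self_right, Nat.mod_eq_of_lt ha, Nat.mod_eq_of_lt hb] at h'
    exact e.injective (Fin.ext h')
  · have ha := (e a).2
    have := Nat.mul_le_mul_right (Fintype.card X) (Nat.succ_le_of_lt (hc a b hab))
    rw [Nat.succ_mul] at this
    show c a * Fintype.card X + e a < c b * Fintype.card X + e b
    omega

namespace Pattern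

variable {Q : Type} (P : Pattern Q)

theorem entangles_iff {k : P.Idx} {u v : Q} : (P.cmd k).Entangles u v ↔
    P.IsE k ∧ ((u = (P.cmd k).fst ∧ v = (P.cmd k).snd) ∨
      (u = (P.cmd k).snd ∧ v = (P.cmd k).fst)) := by
  unfold IsE
  cases P.cmd k <;> simp [Command.Entangles, Command.stage, Command.fst, Command.snd]

theorem adj_iff {u v : Q} : P.geometry.graph.Adj u v ↔ ∃ k, (P.cmd k).Entangles u v := by
  constructor
  · rintro ⟨c, hc, h⟩
    obtain ⟨k, rfl⟩ := P.mem_commands.1 hc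
    exact ⟨k, h⟩
  · rintro ⟨k, h⟩
    exact ⟨_, P.mem_commands.2 ⟨k, rfl⟩, h⟩

theorem entangles_unique (honce : P.EntanglesOnce) {k k' : P.Idx} {u v : Q}
    (h : (P.cmd k).Entangles u v) (h' : (P.cmd k').Entangles u v) : k = k' := by
  have key := List.pairwise_iff_get.1 honce
  rcases lt_trichotomy k k' with hlt | heq | hlt
  exacts [absurd h' (key _ _ hlt u v h), heq, absurd h (key _ _ hlt u v h')]

theorem exists_schedule [Fintype Q] (hs : P.IsStandard) (honce : P.EntanglesOnce)
    (hflow : P.geometry.HasFlow) : Nonempty P.Schedule := by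
  obtain ⟨f, ord, hf⟩ := hflow
  obtain ⟨r, hr, hmono⟩ := exists_injective_rank ord
  let lo : P.Idx → Q := fun k => if r (P.cmd k).fst < r (P.cmd k).snd then (P.cmd k).fst
    else (P.cmd k).snd
  let hi : P.Idx → Q := fun k => if r (P.cmd k).fst < r (P.cmd k).snd then (P.cmd k).snd
    else (P.cmd k).fst
  have hends : ∀ k, P.IsE k → (lo k = (P.cmd k).fst ∧ hi k = (P.cmd k).snd) ∨
      (lo k = (P.cmd k).snd ∧ hi k = (P.cmd k).fst) := by
    intro k _
    by_cases h : r (P.cmd k).fst < r (P.cmd k).snd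
    · exact .inl ⟨if_pos h, if_pos h⟩
    · exact .inr ⟨if_neg h, if_neg h⟩
  have hlt : ∀ k, P.IsE k → r (lo k) < r (hi k) := by
    intro k hk
    by_cases h : r (P.cmd k).fst < r (P.cmd k).snd
    · simpa only [lo, hi, if_pos h] using h
    · simpa only [lo, hi, if_neg h] using
        lt_of_le_of_ne (not_lt.1 h) fun h' => hk.fst_ne_snd P (hr h').symm
  have hent : ∀ k, P.IsE k → (P.cmd k).Entangles (lo k) (hi k) := fun k hk =>
    P.entangles_iff.2 ⟨hk, hends k hk⟩
  -- No pair is entangled twice, so a command is determined by its two ends.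
  have hunique : ∀ k k', P.IsE k → P.IsE k' → lo k = lo k' → hi k = hi k' → k = k' := by
    intro k k' hk hk' h1 h2
    have := hent k' hk'
    rw [← h1, ← h2] at this
    exact P.entangles_unique honce (hent k hk) this
  -- A common image would make each of `u` and `v` a further neighbour of the other's image, so each
  -- would precede the other.
  have hinj : ∀ u v, (f u : Q) = f v → (u : Q) = v := by
    intro u v huv
    by_contra hne
    have h1 := (hf u).2.2 v (huv ▸ (hf v).1) hne
    have h2 := (hf v).2.2 u (huv ▸ (hf u).1) (Ne.symm hne)
    exact lt_asymm (hmono _ _ h1) (hmono _ _ h2)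
  let flow : P.Idx → Prop := fun k => P.IsE k ∧ ∃ h : lo k ∉ P.outputs, (f ⟨lo k, h⟩ : Q) = hi k
  have hgates : ∀ q, ∃ l : List P.Idx, (∀ k, k ∈ l ↔ P.IsE k ∧ ¬ flow k ∧ hi k = q) ∧
      l.Pairwise fun k k' => r (lo k) < r (lo k') := fun q =>
    List.exists_sorted _ _ fun k k' h h' hrr =>
      hunique k k' h.1 h'.1 (hr hrr) (h.2.2.trans h'.2.2.symm)
  choose gates hgates using hgates
  refine ⟨⟨r, lo, hi, hends, hlt, flow, fun k h => h.1, ?_, fun k h => h.2.1, ?_, ?_, ?_, ?_,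
    gates, fun q => (hgates q).1, fun q => P.corrs_eq_nil hs, fun q => (hgates q).2⟩⟩
  · intro q hq
    obtain ⟨k, hk⟩ := P.adj_iff.1 (hf ⟨q, hq⟩).1
    have hk' := P.entangles_iff.1 hk
    have hrank := hmono _ _ (hf ⟨q, hq⟩).2.1
    have hE := hlt k hk'.1
    -- A qubit precedes its image under the flow, so it is the lower end of the command that joins
    -- them.
    have hlohi : lo k = q ∧ hi k = f ⟨q, hq⟩ := by
      rcases hk'.2 with ⟨h1, h2⟩ | ⟨h1, h2⟩ <;> rcases hends k hk'.1 with ⟨h3, h4⟩ | ⟨h3, h4⟩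
      · rw [h3, h4, ← h1, ← h2] at hE
        exact absurd hE hrank.not_gt
      · exact ⟨h3.trans h2.symm, h4.trans h1.symm⟩
      · exact ⟨h3.trans h2.symm, h4.trans h1.symm⟩
      · rw [h3, h4, ← h1, ← h2] at hE
        exact absurd hE hrank.not_gt
    obtain ⟨rfl, h⟩ := hlohi
    exact ⟨k, ⟨hk'.1, hq, h.symm⟩, rfl⟩
  · rintro k ⟨-, h, h'⟩
    exact h' ▸ (f ⟨lo k, h⟩).2
  · rintro k k' ⟨hk, h, hh⟩ ⟨hk', h', hh'⟩ heq
    refine hunique k k' hk hk' heq ?_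
    rw [← hh, ← hh']
    congr 2
    exact Subtype.ext heq
  · rintro k k' ⟨hk, h, hh⟩ ⟨hk', h', hh'⟩ heq
    exact hunique k k' hk hk' (hinj ⟨lo k, h⟩ ⟨lo k', h'⟩ (hh.trans (heq.trans hh'.symm))) heq
  · rintro k k' ⟨hk, h, hh⟩ hk' hnot heq
    -- The qubit `lo k'` is a neighbour of `f (lo k)`. It differs from `lo k`, since otherwise the
    -- two commands would coincide and `k'` would be a flow command.
    refine hmono _ _ ((hf ⟨lo k, h⟩).2.2 (lo k') ?_ fun hlo => ?_)
    · rw [hh, ← heq]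
      exact (P.adj_iff.2 ⟨k', hent k' hk'⟩).symm
    · obtain rfl := hunique k k' hk hk' hlo heq.symm
      exact hnot ⟨hk, h, hh⟩

/-- A measured qubit is entangled at least with its flow successor, so an input wire does not become
empty when the measurement is deleted. -/
theorem Schedule.entList_ne_nil {P : Pattern Q} (S : P.Schedule) {q : Q} (hq : q ∉ P.outputs) :
    P.entList q ≠ [] := by
  obtain ⟨k, hk, rfl⟩ := S.flow_exists q hq
  have hE := S.isE k hk
  rcases S.ends k hE with ⟨h, -⟩ | ⟨h, -⟩
  · exact List.ne_nil_of_mem (P.mem_entList.2 (.inl ⟨k, hE, h.symm, rfl⟩))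
  · exact List.ne_nil_of_mem (P.mem_entList.2 (.inr ⟨k, hE, h.symm, rfl⟩))

end Pattern

theorem mainTheorem8 {Q : Type} [Fintype Q] (P : Pattern Q)
    (hstandard : P.IsStandard) (honce : P.EntanglesOnce)
    (hflow : P.geometry.HasFlow) :
    ∃ D : ZXGraph Q P.inputs P.outputs,
      D.IsDiagram ∧ D.IsCircuitLike ∧ P.measurementFreeDiagram.Rewrites D := by
  obtain ⟨S⟩ := P.exists_schedule hstandard honce hflow
  refine ⟨S.circuit, S.circuit_isDiagram, S.circuit_isCircuitLike, ?_⟩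
  refine (P.measurementFree_rewrites_merged hstandard fun q _ => ?_).trans'
    S.circuit_rewrites_merged.symm'
  by_cases hq : q ∈ P.outputs
  exacts [.inr hq, .inl (S.entList_ne_nil hq)]
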